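/- Let $M$ be a smooth ($C^\infty$, Hausdorff, second countable) manifold without boundary of dimension $m$, and let $(V_i)_{i\in I}$ be a finite family of closed embedded submanifolds of $M$ of codimension 1. \textbf{Transversality.} A family of smooth maps of manifolds $\varphi_i : X_i \to Y$ is \emph{transverse} if, for all points $x_i\in X_i$ with a common image $y=\varphi_i(x_i)$, the orthogonals in $T_y^*Y$ of the subspaces $d\varphi_i(T_{x_i}X_i)\subset T_yY$ are in direct sum. A family of submanifolds is transverse if the family of their inclusions is. $(M,(V_i)_{i\in I})$ is called a \emph{decoupage} if for every $J\subset I$ the family $(V_j)_{j\in J}$ is transverse. \textbf{The groupoid of a hypersurface.} For $V\subset M$ a closed submanifold of codimension 1, put $N_xV=T_xM/T_xV$ for $x\in V$. The groupoid $\mathbf G(V)$ over $M$ is the disjoint union of $(M\setminus V)^2$ (the pair groupoid) and of the set of triples $(x,y,\alpha)$ with $x,y\in V$ and $\alpha:N_yV\to N_xV$ a linear isomorphism, with $r(x,y,\alpha)=x$, $s(x,y,\alpha)=y$, $(x,y,\alpha)(y,z,\beta)=(x,z,\alpha\circ\beta)$. Its smooth structure is the unique one for which the following maps are diffeomorphisms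 onto open subsets: the inclusion of $(M\setminus V)^2$; and, for any two diffeomorphisms $e_1,e_2$ from open subsets of $M$ onto open subsets of $\mathbb R^{m-1}\times\mathbb R$ in which $V$ becomes the zero locus of the last coordinate, the map which sends $(a,b,t,\lambda)$ (with $\lambda\in\mathbb R^*$, and $(a,\lambda t)$, $(b,t)$ in the images of $e_1$, $e_2$) to $(e_1^{-1}(a,\lambda t),\,e_2^{-1}(b,t))$ if $t\ne0$, and to $(x,y,\alpha)$ if $t=0$, where $x=e_1^{-1}(a,0)$, $y=e_2^{-1}(b,0)$ and $\alpha$ is the dilation of rate $\lambda$ in the trivialisations of the normal bundle given by the last coordinates of $e_1$ and $e_2$. \textbf{Proposition.} Let $\mathcal E=(M,(V_i)_{i\in I})$ be a decoupage. Then each $\mathbf G(V_i)$, with the smooth structure above (which exists), is a Lie groupoid (Hausdorff and second countable), and the maps $r\oplus s:\mathbf G(V_i)\to M^2$, $i\in I$, are smooth and transverse. Consequently their fiber product over $M^2$, the puff $$\mathbf G(\mathcal E)=\Big\{\big((x,y),(\gamma_i)_{i\in I}\big)\in M^2\times\prod_{i\in I}\mathbf G(V_i)\ :\ r(\gamma_i)=x,\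 s(\gamma_i)=y\ \text{ for all } i\in I\Big\},$$ is a smooth (Hausdorff, second countable) manifold of dimension $2m$, smoothly embedded in $M^2\times\prod_{i}\mathbf G(V_i)$ and, if $I\neq\emptyset$, in $\prod_{i}\mathbf G(V_i)$ by forgetting the point $(x,y)$; with the componentwise operations it is a Lie groupoid over $M$. -/

import Mathlib

open scoped Manifold ContDiff Topology

noncomputable section

/-- A groupoid with set of units `M` and set of arrows `G`.
An arrow `g` goes from `src g` to `tgt g`, and `mul g h` (first `h`, then `g`) is defined when
`src g = tgt h`. -/
structure GroupoidOver (M G : Type*) where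
  tgt : G → M
  src : G → M
  unit : M → G
  mul : ∀ g h : G, src g = tgt h → G
  inv : G → G
  tgt_unit : ∀ x, tgt (unit x) = x
  src_unit : ∀ x, src (unit x) = x
  tgt_mul : ∀ g h p, tgt (mul g h p) = tgt g
  src_mul : ∀ g h p, src (mul g h p) = src h
  tgt_inv : ∀ g, tgt (inv g) = src g
  src_inv : ∀ g, src (inv g) = tgt g
  mul_assoc : ∀ g h k (p : src g = tgt h) (q : src h = tgt k),
    mul (mul g h p) k ((src_mul g h p).trans q) = mul g (mul h k q) (p.trans (tgt_mul h k q).symm)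
  unit_mul : ∀ g, mul (unit (tgt g)) g (src_unit _) = g
  mul_unit : ∀ g, mul g (unit (src g)) (tgt_unit _).symm = g
  mul_inv : ∀ g, mul g (inv g) (tgt_inv g).symm = unit (tgt g)
  inv_mul : ∀ g, mul (inv g) g (src_inv g) = unit (src g)

/-- A groupoid over `M` is a Lie groupoid: units and arrows are smooth manifolds, source and range
are submersions, and units, inversion and composition are smooth. Composition is smooth on the
submanifold of composable pairs of `G × G`; smoothness on a subset only concerns the values
there, so the choice of the extension `μ` does not matter. -/
structure IsLieGroupoid {EM HM EG HG M G : Type*}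
    [NormedAddCommGroup EM] [NormedSpace ℝ EM] [TopologicalSpace HM]
    [NormedAddCommGroup EG] [NormedSpace ℝ EG] [TopologicalSpace HG]
    (I : ModelWithCorners ℝ EM HM) (J : ModelWithCorners ℝ EG HG)
    [TopologicalSpace M] [ChartedSpace HM M] [TopologicalSpace G] [ChartedSpace HG G]
    (𝒢 : GroupoidOver M G) : Prop where
  isManifold_units : IsManifold I ∞ M
  isManifold_arrows : IsManifold J ∞ G
  isSubmersion_tgt : Manifold.IsSubmersion J I ∞ 𝒢.tgt
  isSubmersion_src : Manifold.IsSubmersion J I ∞ 𝒢.src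
  contMDiff_unit : ContMDiff I J ∞ 𝒢.unit
  contMDiff_inv : ContMDiff J J ∞ 𝒢.inv
  contMDiffOn_mul : ∃ μ : G × G → G, (∀ g h p, μ (g, h) = 𝒢.mul g h p) ∧
    ContMDiffOn (J.prod J) J ∞ μ {p | 𝒢.src p.1 = 𝒢.tgt p.2}

/-- The orthogonals, in the dual of `T`, of the subspaces `W i` are in direct sum. -/
def TransverseSubspaces {ι T : Type*} [AddCommGroup T] [Module ℝ T]
    (W : ι → Submodule ℝ T) : Prop :=
  iSupIndep fun i => (W i).dualAnnihilator

/-- A family of smooth maps `φ i : X i → Y` is transverse: whenever the points `x i` all have the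
same image `y`, the orthogonals in the dual of `T_y Y` of the images of the differentials
`d(φ i)` at `x i` are in direct sum. -/
structure TransverseMaps {ι EX HX EY HY Y : Type*} {X : ι → Type*}
    [NormedAddCommGroup EX] [NormedSpace ℝ EX] [TopologicalSpace HX]
    [NormedAddCommGroup EY] [NormedSpace ℝ EY] [TopologicalSpace HY]
    (I : ModelWithCorners ℝ EX HX) (J : ModelWithCorners ℝ EY HY)
    [∀ i, TopologicalSpace (X i)] [∀ i, ChartedSpace HX (X i)]
    [TopologicalSpace Y] [ChartedSpace HY Y] (φ : ∀ i, X i → Y) : Prop where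
  contMDiff : ∀ i, ContMDiff I J ∞ (φ i)
  transverse : ∀ (x : ∀ i, X i) (y : Y) (hxy : ∀ i, φ i (x i) = y),
    TransverseSubspaces (T := TangentSpace J y) fun i =>
      hxy i ▸ (mfderiv I J (φ i) (x i)).toLinearMap.range

variable {M : Type*} [TopologicalSpace M]

section Hypersurface

variable (m : ℕ) [ChartedSpace (EuclideanSpace ℝ (Fin m)) M]

/-- A diffeomorphism `e` from an open subset of the `m`-dimensional manifold `M` onto an open
subset of `ℝ^(m-1) × ℝ` that straightens `V`: in its domain, `V` is the zero locus of the last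
coordinate. -/
def IsSliceChart (V : Set M)
    (e : PartialDiffeomorph (𝓡 m) 𝓘(ℝ, EuclideanSpace ℝ (Fin (m - 1)) × ℝ)
      M (EuclideanSpace ℝ (Fin (m - 1)) × ℝ) ∞) : Prop :=
  ∀ y ∈ e.source, y ∈ V ↔ (e y).2 = 0

/-- The differential at `x` of the last coordinate of `e`. If `e` straightens `V` and `x ∈ V` lies
in the domain of `e`, it induces the isomorphism `N_x V ≃ ℝ` that trivialises the normal bundle. -/
def lastCoordDeriv (e : PartialDiffeomorph (𝓡 m) 𝓘(ℝ, EuclideanSpace ℝ (Fin (m - 1)) × ℝ)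
      M (EuclideanSpace ℝ (Fin (m - 1)) × ℝ) ∞) (x : M) (v : TangentSpace (𝓡 m) x) : ℝ :=
  mfderiv (𝓡 m) 𝓘(ℝ, ℝ) (fun z => (e z).2) x v

/-- `V` is a (closed, embedded) submanifold of codimension 1 of the `m`-dimensional manifold `M`. -/
structure IsHypersurface (V : Set M) : Prop where
  isClosed : IsClosed V
  exists_sliceChart : ∀ x ∈ V, ∃ e, x ∈ e.source ∧ IsSliceChart m V e

/-- For `x ∈ V`, the tangent space `T_x V` as a subspace of `T_x M`: the vectors that kill every
function which is smooth near `x` and vanishes on `V` near `x`. For `x ∉ V` this is, by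
convention, all of `T_x M`. -/
def tangentTo (V : Set M) (x : M) : Submodule ℝ (TangentSpace (𝓡 m) x) where
  carrier := {v | x ∈ V → ∀ f : M → ℝ, ContMDiffAt (𝓡 m) 𝓘(ℝ, ℝ) ∞ f x →
    (∀ᶠ y in 𝓝[V] x, f y = 0) → mfderiv (𝓡 m) 𝓘(ℝ, ℝ) f x v = 0}
  add_mem' hv hw hx f hf h0 := by
    rw [map_add, hv hx f hf h0, hw hx f hf h0, add_zero]
  zero_mem' _ _ _ _ := map_zero _
  smul_mem' c v hv hx f hf h0 := by
    rw [map_smul, hv hx f hf h0, smul_zero]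

/-- A decoupage of `M`: a family of submanifolds of codimension 1 such that for every set `J` of
indices the inclusions of the `V j`, `j ∈ J`, are transverse, that is, at each common point the
orthogonals of the tangent spaces of the `V j` are in direct sum. -/
structure IsDecoupage {ι : Type*} (V : ι → Set M) : Prop where
  isHypersurface : ∀ i, IsHypersurface m (V i)
  transverse : ∀ (J : Set ι) (x : M), (∀ j ∈ J, x ∈ V j) →
    TransverseSubspaces fun j : J => tangentTo m (V j) x

/-- The normal space `N_x V = T_x M / T_x V` for `x ∈ V`; it is zero for `x ∉ V`. -/
abbrev NormalFiber (V : Set M) (x : M) : Type :=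
  TangentSpace (𝓡 m) x ⧸ tangentTo m V x

lemma subsingleton_normalFiber {V : Set M} {x : M} (hx : x ∉ V) :
    Subsingleton (NormalFiber m V x) :=
  Submodule.Quotient.subsingleton_iff.2
    (eq_top_iff.2 fun _ _ hx' => absurd hx' hx)

/-- Transport of normal spaces along an equality of points. -/
def normalCast (V : Set M) {x y : M} (h : x = y) : NormalFiber m V x ≃ₗ[ℝ] NormalFiber m V y :=
  h ▸ LinearEquiv.refl ℝ (NormalFiber m V x)

/-- The arrows of the puff `G(V)` of `V`. It is the disjoint union of
* the pairs `(tgt, src)` of points of `M \ V` (the field `iso` is then the unique isomorphism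
  between two zero spaces and carries no information), and
* the triples `(tgt, src, α)` with `tgt` and `src` in `V` and `α` an isomorphism from
  `N_src V` to `N_tgt V`. -/
@[ext]
structure PuffArrow (V : Set M) where
  tgt : M
  src : M
  mem_iff : tgt ∈ V ↔ src ∈ V
  iso : NormalFiber m V src ≃ₗ[ℝ] NormalFiber m V tgt

/-- Over `(M \ V)²` there is exactly one arrow for each pair of points. -/
lemma PuffArrow.ext_of_notMem {V : Set M} {g h : PuffArrow m V} (ht : g.tgt = h.tgt)
    (hs : g.src = h.src) (hg : g.tgt ∉ V) : g = h := by
  obtain ⟨x, y, hxy, α⟩ := g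
  obtain ⟨x', y', hxy', β⟩ := h
  dsimp only at ht hs hg
  subst ht hs
  have := subsingleton_normalFiber m hg
  have hab : α = β := LinearEquiv.ext fun n => Subsingleton.elim _ _
  rw [hab]

/-- The groupoid structure on `G(V)`: `(x, y, α) (y, z, β) = (x, z, α ∘ β)`. -/
def puffArrowGroupoid (V : Set M) : GroupoidOver M (PuffArrow m V) where
  tgt := PuffArrow.tgt
  src := PuffArrow.src
  unit x := ⟨x, x, Iff.rfl, LinearEquiv.refl ℝ _⟩
  mul g h p := ⟨g.tgt, h.src, g.mem_iff.trans ((iff_of_eq (congrArg (· ∈ V) p)).trans h.mem_iff),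
    (h.iso.trans (normalCast m V p.symm)).trans g.iso⟩
  inv g := ⟨g.src, g.tgt, g.mem_iff.symm, g.iso.symm⟩
  tgt_unit _ := rfl
  src_unit _ := rfl
  tgt_mul _ _ _ := rfl
  src_mul _ _ _ := rfl
  tgt_inv _ := rfl
  src_inv _ := rfl
  mul_assoc _ _ _ _ _ := rfl
  unit_mul _ := rfl
  mul_unit _ := rfl
  mul_inv g := PuffArrow.ext rfl rfl (heq_of_eq (LinearEquiv.symm_trans_self g.iso))
  inv_mul g := PuffArrow.ext rfl rfl (heq_of_eq (LinearEquiv.self_trans_symm g.iso))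

/-- The map `r ⊕ s : G(V) → M²`. -/
def anchor {V : Set M} (g : PuffArrow m V) : M × M := (g.tgt, g.src)

/-- A topology and an atlas on `G(V)` form the smooth structure of the puff of `V`:
* `(M \ V)²` is an open submanifold, with its structure as an open subset of `M²`;
* for any two diffeomorphisms `e₁`, `e₂` straightening `V`, the parametrisation
  `(a, b, t, l) ↦ (e₁⁻¹ (a, l * t), e₂⁻¹ (b, t))` for `t ≠ 0`, and `(a, b, 0, l) ↦ (x, y, α)` with
  `x = e₁⁻¹ (a, 0)`, `y = e₂⁻¹ (b, 0)` and `α : N_y V → N_x V` the dilation of rate `l` in the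
  trivialisations of the normal bundle given by the last coordinates of `e₁` and `e₂`, is a
  diffeomorphism from its natural (open) domain onto an open subset of `G(V)`.
The images of these maps cover `G(V)`, so that there is at most one such smooth structure. -/
structure IsPuffManifold (V : Set M) [TopologicalSpace (PuffArrow m V)]
    [ChartedSpace (EuclideanSpace ℝ (Fin m) × EuclideanSpace ℝ (Fin m)) (PuffArrow m V)] :
    Prop where
  isManifold : IsManifold 𝓘(ℝ, EuclideanSpace ℝ (Fin m) × EuclideanSpace ℝ (Fin m)) ∞
    (PuffArrow m V)
  exists_compl : ∃ Φ : PartialDiffeomorph ((𝓡 m).prod (𝓡 m))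
      𝓘(ℝ, EuclideanSpace ℝ (Fin m) × EuclideanSpace ℝ (Fin m)) (M × M) (PuffArrow m V) ∞,
    Φ.source = Vᶜ ×ˢ Vᶜ ∧ ∀ p ∈ Vᶜ ×ˢ Vᶜ, anchor m (Φ p) = p
  exists_slice : ∀ e₁ e₂, IsSliceChart m V e₁ → IsSliceChart m V e₂ →
    ∃ Φ : PartialDiffeomorph
        𝓘(ℝ, EuclideanSpace ℝ (Fin (m - 1)) × EuclideanSpace ℝ (Fin (m - 1)) × ℝ × ℝ)
        𝓘(ℝ, EuclideanSpace ℝ (Fin m) × EuclideanSpace ℝ (Fin m))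
        (EuclideanSpace ℝ (Fin (m - 1)) × EuclideanSpace ℝ (Fin (m - 1)) × ℝ × ℝ)
        (PuffArrow m V) ∞,
      Φ.source = {q | q.2.2.2 ≠ 0 ∧ (q.1, q.2.2.2 * q.2.2.1) ∈ e₁.target ∧
        (q.2.1, q.2.2.1) ∈ e₂.target} ∧
      ∀ a b t l, (a, b, t, l) ∈ Φ.source →
        (Φ (a, b, t, l)).tgt = e₁.symm (a, l * t) ∧
        (Φ (a, b, t, l)).src = e₂.symm (b, t) ∧
        (t = 0 → ∀ (v : TangentSpace (𝓡 m) (Φ (a, b, t, l)).src)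
            (w : TangentSpace (𝓡 m) (Φ (a, b, t, l)).tgt),
          (Φ (a, b, t, l)).iso (Submodule.Quotient.mk v) = Submodule.Quotient.mk w →
          lastCoordDeriv m e₁ (Φ (a, b, t, l)).tgt w =
            l * lastCoordDeriv m e₂ (Φ (a, b, t, l)).src v)

/-- The puff of the family `V` in `M²`: the fiber product over `M²` of the maps
`r ⊕ s : G(V i) → M²`, as a subset of `M² × ∏ i, G(V i)`. The factor `M²` is redundant unless the
family is empty; then the fiber product over `M²` is `M²` itself. -/
abbrev Puff {ι : Type*} (V : ι → Set M) : Type _ :=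
  {q : (M × M) × (∀ i, PuffArrow m (V i)) // ∀ i, anchor m (q.2 i) = q.1}

/-- The groupoid structure on the puff of a family: all operations are componentwise. -/
def puffGroupoid {ι : Type*} (V : ι → Set M) : GroupoidOver M (Puff m V) where
  tgt q := q.1.1.1
  src q := q.1.1.2
  unit x := ⟨((x, x), fun i => (puffArrowGroupoid m (V i)).unit x), fun _ => rfl⟩
  mul g h p := ⟨((g.1.1.1, h.1.1.2), fun i => (puffArrowGroupoid m (V i)).mul (g.1.2 i) (h.1.2 i)
      (((congrArg Prod.snd (g.2 i)).trans p).trans (congrArg Prod.fst (h.2 i)).symm)),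
    fun i => Prod.ext (congrArg Prod.fst (g.2 i) :) (congrArg Prod.snd (h.2 i) :)⟩
  inv g := ⟨((g.1.1.2, g.1.1.1), fun i => (puffArrowGroupoid m (V i)).inv (g.1.2 i)),
    fun i => Prod.ext (congrArg Prod.snd (g.2 i) :) (congrArg Prod.fst (g.2 i) :)⟩
  tgt_unit _ := rfl
  src_unit _ := rfl
  tgt_mul _ _ _ := rfl
  src_mul _ _ _ := rfl
  tgt_inv _ := rfl
  src_inv _ := rfl
  mul_assoc _ _ _ _ _ := rfl
  unit_mul := by
    rintro ⟨⟨⟨x, y⟩, g⟩, hg⟩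
    refine Subtype.ext (Prod.ext rfl (funext fun i => ?_))
    have hx : (g i).tgt = x := congrArg Prod.fst (hg i)
    subst hx
    exact (puffArrowGroupoid m (V i)).unit_mul (g i)
  mul_unit := by
    rintro ⟨⟨⟨x, y⟩, g⟩, hg⟩
    refine Subtype.ext (Prod.ext rfl (funext fun i => ?_))
    have hy : (g i).src = y := congrArg Prod.snd (hg i)
    subst hy
    exact (puffArrowGroupoid m (V i)).mul_unit (g i)
  mul_inv := by
    rintro ⟨⟨⟨x, y⟩, g⟩, hg⟩
    refine Subtype.ext (Prod.ext rfl (funext fun i => ?_))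
    have hx : (g i).tgt = x := congrArg Prod.fst (hg i)
    subst hx
    exact (puffArrowGroupoid m (V i)).mul_inv (g i)
  inv_mul := by
    rintro ⟨⟨⟨x, y⟩, g⟩, hg⟩
    refine Subtype.ext (Prod.ext rfl (funext fun i => ?_))
    have hy : (g i).src = y := congrArg Prod.snd (hg i)
    subst hy
    exact (puffArrowGroupoid m (V i)).inv_mul (g i)

end Hypersurface

end

/-! The whole proof rests on one real number attached to an arrow. Let `e₁` and `e₂` be charts
straightening `V`, around the range and the source of an arrow of `G(V)`. The rate of the arrow is
the quotient of the last coordinates of range and source when these lie off `V`, and the dilation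
rate of the isomorphism of normal lines when they lie on `V` (`HasRate`, `rate`). It exists, is
unique and nonzero, and together with range and source it determines the arrow (`exists_hasRate`,
`HasRate.unique`, `HasRate.ne_zero`, `HasRate.arrow_ext`). It is multiplicative: units have rate `1`
in a common chart, inverses have the inverse rate, products the product.

Existence of the smooth structure: changing the charts multiplies the rate by the rates of two units
(`rate_eq_rate_mul`). The rate of a unit is the quotient of two equations of `V`, which is smooth
across `V` by Hadamard's lemma (`contMDiffAt_rate_unit`). Hence "range, source and rate depend
smoothly on parameters" is a condition independent of the charts (`IsPlotAt`), and the
parametrisations of the statement form an atlas (`exists_isPuffManifold`). Multiplicativity gives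
smoothness of the operations, and explicit local sections show that range and source are
submersions.

Transversality: moving the range along `V`, with source and rate fixed, shows that the image of the
differential of `r ⊕ s` contains `T_xV × 0`. This image also projects onto the second factor, as the
source is a submersion. A covector orthogonal to it is therefore determined by its restriction to
the first factor, which is orthogonal to `T_xV`; the decoupage hypothesis at `x` concludes
(`iSupIndep_dualAnnihilator_of_prod`).

The fiber product is parametrised by hand. Near an arrow from `y` to `x`, the indices `j` with `x ∈
V j` and with `y ∈ V j` are the same. The corresponding equations `f j` have independent
differentials, so they become linear in suitable charts (`IsDecoupage.exists_adaptedChart`). On the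
puff `f j (x) = l j * f j (y)`, where `l j` is the rate. So in the coordinates of the pair `(x, y)`
the numbers `f j (x)` can be traded for the rates, which leaves `2m` free coordinates
(`AdaptedChart.coord`). These extend smoothly to the ambient product, so the puff is an embedded
submanifold with smooth local retractions, and the Lie groupoid axioms are inherited from the
factors. -/

noncomputable section

open Set Filter

/-! ### Partial diffeomorphisms and the inverse function theorem -/

section PartialDiffeomorph

variable {E F H : Type*} [NormedAddCommGroup E] [NormedSpace ℝ E]
  [NormedAddCommGroup F] [NormedSpace ℝ F] [TopologicalSpace H]
  {I : ModelWithCorners ℝ E H}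
  {X : Type*} [TopologicalSpace X] [ChartedSpace H X]
  {H' : Type*} [TopologicalSpace H'] {J : ModelWithCorners ℝ F H'}
  {Y : Type*} [TopologicalSpace Y] [ChartedSpace H' Y]

namespace PartialDiffeomorph

/-- The restriction of a partial diffeomorphism to an open set. -/
def restrOpen (Φ : PartialDiffeomorph I J X Y ∞) (s : Set X) (hs : IsOpen s) :
    PartialDiffeomorph I J X Y ∞ where
  toPartialEquiv := (Φ.toOpenPartialHomeomorph.restrOpen s hs).toPartialEquiv
  open_source := (Φ.toOpenPartialHomeomorph.restrOpen s hs).open_source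
  open_target := (Φ.toOpenPartialHomeomorph.restrOpen s hs).open_target
  contMDiffOn_toFun := Φ.contMDiffOn_toFun.mono inter_subset_left
  contMDiffOn_invFun := Φ.contMDiffOn_invFun.mono fun _ hy => hy.1

lemma contMDiffAt (Φ : PartialDiffeomorph I J X Y ∞) {x : X} (hx : x ∈ Φ.source) :
    ContMDiffAt I J ∞ Φ x :=
  Φ.contMDiffOn_toFun.contMDiffAt (Φ.open_source.mem_nhds hx)

lemma contMDiffAt_symm (Φ : PartialDiffeomorph I J X Y ∞) {y : Y} (hy : y ∈ Φ.target) :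
    ContMDiffAt J I ∞ Φ.symm y :=
  Φ.contMDiffOn_invFun.contMDiffAt (Φ.open_target.mem_nhds hy)

lemma map_mem_target (Φ : PartialDiffeomorph I J X Y ∞) {x : X} (hx : x ∈ Φ.source) :
    Φ x ∈ Φ.target :=
  Φ.map_source' hx

lemma symm_mem_source (Φ : PartialDiffeomorph I J X Y ∞) {y : Y} (hy : y ∈ Φ.target) :
    Φ.symm y ∈ Φ.source :=
  Φ.map_target' hy

lemma symm_apply_apply (Φ : PartialDiffeomorph I J X Y ∞) {x : X} (hx : x ∈ Φ.source) :
    Φ.symm (Φ x) = x :=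
  Φ.left_inv' hx

lemma apply_symm_apply (Φ : PartialDiffeomorph I J X Y ∞) {y : Y} (hy : y ∈ Φ.target) :
    Φ (Φ.symm y) = y :=
  Φ.right_inv' hy

variable (I) in
/-- The preferred chart at a point of a manifold without boundary, as a partial diffeomorphism to
the model vector space. -/
def extChart [I.Boundaryless] [IsManifold I ∞ X] (x : X) :
    PartialDiffeomorph I 𝓘(ℝ, E) X E ∞ where
  toPartialEquiv := extChartAt I x
  open_source := isOpen_extChartAt_source x
  open_target := isOpen_extChartAt_target x
  contMDiffOn_toFun := by
    rw [extChartAt_source]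
    exact contMDiffOn_extChartAt
  contMDiffOn_invFun := contMDiffOn_extChartAt_symm x

lemma mem_extChart_source [I.Boundaryless] [IsManifold I ∞ X] (x : X) :
    x ∈ (extChart I x).source :=
  mem_extChartAt_source (I := I) x

/-- A partial homeomorphism that is smooth in both directions belongs to the maximal atlas. -/
lemma _root_.mem_maximalAtlas_of_contMDiffOn [IsManifold I ∞ X] {e : OpenPartialHomeomorph X H}
    (he : ContMDiffOn I I ∞ e e.source) (he' : ContMDiffOn I I ∞ e.symm e.target) :
    e ∈ IsManifold.maximalAtlas I ∞ X := by
  have key : ∀ f : OpenPartialHomeomorph H H, ContMDiffOn I I ∞ f f.source →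
      ContDiffOn ℝ ∞ (I ∘ f ∘ I.symm) (I.symm ⁻¹' f.source ∩ range I) := by
    rintro f hf _ ⟨hy, y, rfl⟩
    have hy' : y ∈ f.source := by simpa using hy
    exact (contMDiffWithinAt_iff.1 (hf y hy')).2
  have key' : ∀ f : OpenPartialHomeomorph H H, ContMDiffOn I I ∞ f f.source →
      ContMDiffOn I I ∞ f.symm f.target → f ∈ contDiffGroupoid ∞ I := fun f h1 h2 => by
    rw [contDiffGroupoid, mem_groupoid_of_pregroupoid]
    exact ⟨key f h1, key f.symm h2⟩
  have comp : ∀ f g : OpenPartialHomeomorph X H, ContMDiffOn I I ∞ f.symm f.target →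
      ContMDiffOn I I ∞ g g.source →
      ContMDiffOn I I ∞ (f.symm.trans g) (f.symm.trans g).source := fun f g hf hg =>
    hg.comp (hf.mono inter_subset_left) fun _ h => h.2
  rw [IsManifold.maximalAtlas, mem_maximalAtlas_iff]
  intro c hc
  have hc' := IsManifold.subset_maximalAtlas (I := I) (n := ∞) hc
  have h1 := contMDiffOn_of_mem_maximalAtlas hc'
  have h2 := contMDiffOn_symm_of_mem_maximalAtlas hc'
  exact ⟨key' _ (comp e c he' h1) (comp c e h2 he), key' _ (comp c e h2 he) (comp e c he' h1)⟩

/-- A partial diffeomorphism to the model vector space comes from a chart of the maximal atlas. -/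
lemma exists_mem_maximalAtlas [I.Boundaryless] [IsManifold I ∞ X]
    (Φ : PartialDiffeomorph I 𝓘(ℝ, E) X E ∞) :
    ∃ e ∈ IsManifold.maximalAtlas I ∞ X, e.extend I = Φ.toPartialEquiv := by
  let e : OpenPartialHomeomorph X H :=
    Φ.toOpenPartialHomeomorph.transHomeomorph I.toHomeomorph.symm
  refine ⟨e, mem_maximalAtlas_of_contMDiffOn ?_ ?_, ?_⟩
  · change ContMDiffOn I I ∞ (I.symm ∘ Φ) Φ.source
    exact I.contMDiffOn_symm.comp Φ.contMDiffOn_toFun fun x _ => by simp [I.range_eq_univ]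
  · exact Φ.contMDiffOn_invFun.comp I.contMDiff.contMDiffOn fun _ h => h
  · refine PartialEquiv.ext (fun x => ?_) (fun x => ?_) ?_
    · exact I.right_inv (by simp [I.range_eq_univ])
    · exact congrArg Φ.symm (I.right_inv (by simp [I.range_eq_univ]))
    · simp [e]

end PartialDiffeomorph

/-- **Inverse function theorem** for smooth maps between Banach spaces. -/
lemma exists_partialDiffeomorph_of_hasFDerivAt [CompleteSpace E] {f : E → F} {U : Set E}
    (hU : IsOpen U) {x : E} (hx : x ∈ U) (hf : ContDiffOn ℝ ∞ f U) {A : E ≃L[ℝ] F}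
    (hA : HasFDerivAt f (A : E →L[ℝ] F) x) :
    ∃ Φ : PartialDiffeomorph 𝓘(ℝ, E) 𝓘(ℝ, F) E F ∞, x ∈ Φ.source ∧ Φ.source ⊆ U ∧
      ∀ z, Φ z = f z := by
  have hfx : ContDiffAt ℝ ∞ f x := hf.contDiffAt (hU.mem_nhds hx)
  let h := hfx.toOpenPartialHomeomorph f hA (by simp)
  -- The inverse is smooth at the image of every point where the derivative is invertible. This is
  -- an open condition, so the local inverse is restricted to it.
  let W := U ∩ fderiv ℝ f ⁻¹' range ((↑) : (E ≃L[ℝ] F) → E →L[ℝ] F)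
  have hW : IsOpen W :=
    (hf.continuousOn_fderiv_of_isOpen hU (by simp)).isOpen_inter_preimage hU
      ContinuousLinearEquiv.isOpen
  have hxW : x ∈ W := ⟨hx, A, hA.fderiv.symm⟩
  let h' := h.restrOpen W hW
  refine ⟨⟨h'.toPartialEquiv, h'.open_source, h'.open_target, ?_, ?_⟩, ⟨?_, hxW⟩, ?_, fun z => rfl⟩
  · exact contMDiffOn_iff_contDiffOn.2 (hf.mono fun z hz => hz.2.1)
  · refine contMDiffOn_iff_contDiffOn.2 fun y hy => ContDiffAt.contDiffWithinAt ?_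
    have hy' : h'.symm y ∈ h'.source := h'.map_target hy
    obtain ⟨B, hB⟩ := hy'.2.2
    have hd : ContDiffAt ℝ ∞ f (h'.symm y) := hf.contDiffAt (hU.mem_nhds hy'.2.1)
    refine h'.contDiffAt_symm (f₀' := B) hy ?_ hd
    rw [hB]
    exact (hd.differentiableAt (by simp)).hasFDerivAt
  · exact hfx.mem_toOpenPartialHomeomorph_source hA (by simp)
  · exact fun z hz => hz.2.1

/-- A smooth map with surjective derivative is linear in suitable coordinates. -/
lemma exists_partialDiffeomorph_of_surjective_fderiv [FiniteDimensional ℝ E]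
    [FiniteDimensional ℝ F] {f : E → F}
    {U : Set E} (hU : IsOpen U) {x : E} (hx : x ∈ U) (hf : ContDiffOn ℝ ∞ f U) {D : E →L[ℝ] F}
    (hD : HasFDerivAt f D x) (hD' : Function.Surjective D) :
    ∃ Φ : PartialDiffeomorph 𝓘(ℝ, E) 𝓘(ℝ, E) E E ∞, x ∈ Φ.source ∧ Φ.source ⊆ U ∧
      ∀ z, D (Φ z) = f z := by
  have : CompleteSpace E := FiniteDimensional.complete ℝ E
  obtain ⟨s, hs⟩ := D.toLinearMap.exists_rightInverse_of_surjective (LinearMap.range_eq_top.2 hD')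
  let s' : F →L[ℝ] E := LinearMap.toContinuousLinearMap s
  have hs' : ∀ v, D (s' v) = v := fun v => LinearMap.congr_fun hs v
  -- The map `z ↦ s' (f z) + (z - s' (D z))` has derivative the identity at `x`, and `D` sends its
  -- value to `f z` because `D ∘ s' = id`.
  obtain ⟨Φ, h1, h2, h3⟩ := exists_partialDiffeomorph_of_hasFDerivAt (A := .refl ℝ E)
    (f := fun z => s' (f z) + (z - s' (D z))) hU hx
    ((s'.contDiff.comp_contDiffOn hf).add
      (contDiff_id.sub (s'.contDiff.comp D.contDiff)).contDiffOn) (by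
      have := (s'.hasFDerivAt.comp x hD).add
        ((hasFDerivAt_id x).sub (s'.hasFDerivAt.comp x D.hasFDerivAt))
      refine this.congr_fderiv ?_
      exact ContinuousLinearMap.ext fun v : E => by simp)
  exact ⟨Φ, h1, h2, fun z => by rw [h3]; simp [hs']⟩

/-- The decomposition of a space defined by a linear map with a right inverse. -/
def splitEquiv (D : F →L[ℝ] E) (A : E →L[ℝ] F) (h : ∀ v, D (A v) = v) :
    F ≃L[ℝ] E × LinearMap.ker D.toLinearMap :=
  ContinuousLinearEquiv.equivOfInverse
    (D.prod ((ContinuousLinearMap.id ℝ F - A.comp D).codRestrict _ fun v => by simp [h]))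
    (A.coprod (Submodule.subtypeL _))
    (fun v => by simp)
    (fun v => by
      have hv : D (v.2 : F) = 0 := v.2.2
      ext <;> simp [h, hv])

lemma splitEquiv_symm_zero (D : F →L[ℝ] E) (A : E →L[ℝ] F) (h : ∀ v, D (A v) = v) (v : E) :
    (splitEquiv D A h).symm (v, 0) = A v := by
  simp [splitEquiv]

/-- The space `ℝ^(p - q)`, where `p` and `q` are the dimensions of `E` and `F`. -/
abbrev CodimSpace (E F : Type*) [NormedAddCommGroup E] [NormedSpace ℝ E] [NormedAddCommGroup F]
    [NormedSpace ℝ F] :=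
  EuclideanSpace ℝ (Fin (Module.finrank ℝ E - Module.finrank ℝ F))

/-- `Manifold.IsSubmersionOfComplement` and its analogue for immersions use one complement for all
points, whereas the kernel of `D` varies with the point. Its dimension does not, so all kernels are
identified with `CodimSpace`. -/
lemma nonempty_kerEquiv [FiniteDimensional ℝ E] [FiniteDimensional ℝ F] (D : F →L[ℝ] E)
    (A : E →L[ℝ] F) (h : ∀ v, D (A v) = v) :
    Nonempty (LinearMap.ker D.toLinearMap ≃L[ℝ] CodimSpace F E) := by
  refine ⟨ContinuousLinearEquiv.ofFinrankEq ?_⟩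
  have := (splitEquiv D A h).toLinearEquiv.finrank_eq
  rw [Module.finrank_prod] at this
  rw [finrank_euclideanSpace_fin]
  omega

/-- If `s` is a local section of `f`, then the derivative of `s` is a section of that of `f`. -/
lemma mfderiv_comp_apply_of_eventually_eq {f : X → Y} {s : Y → X} {y : Y}
    (hf : MDifferentiableAt I J f (s y)) (hs : MDifferentiableAt J I s y)
    (h : ∀ᶠ z in 𝓝 y, f (s z) = z) (v : TangentSpace J y) :
    (mfderiv I J f (s y) (mfderiv J I s y v) : F) = v := by
  have h1 := mfderiv_comp y hf hs
  have h2 : mfderiv J J (f ∘ s) y = mfderiv J J id y :=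
    Filter.EventuallyEq.mfderiv_eq h
  have h3 := congrArg (fun A => (A v : F)) (h1.symm.trans h2)
  rw [mfderiv_id] at h3
  exact h3

/-- A smooth map with values in a vector space and with surjective derivative is linear in a
suitable chart. -/
lemma exists_partialDiffeomorph_of_surjective_mfderiv [I.Boundaryless] [IsManifold I ∞ X]
    [FiniteDimensional ℝ E] [FiniteDimensional ℝ F] {f : X → F} {U : Set X} (hU : IsOpen U) {x : X}
    (hx : x ∈ U) (hf : ContMDiffOn I 𝓘(ℝ, F) ∞ f U)
    (hD : Function.Surjective (mfderiv I 𝓘(ℝ, F) f x)) :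
    ∃ (Φ : PartialDiffeomorph I 𝓘(ℝ, E) X E ∞) (D : E →L[ℝ] F), Function.Surjective D ∧
      x ∈ Φ.source ∧ Φ.source ⊆ U ∧ ∀ z ∈ Φ.source, D (Φ z) = f z := by
  let c := PartialDiffeomorph.extChart I x
  have hxc : x ∈ c.source := PartialDiffeomorph.mem_extChart_source x
  have hxt := c.map_mem_target hxc
  have hcx : c.symm (c x) = x := c.symm_apply_apply hxc
  let W := c.target ∩ c.symm ⁻¹' U
  have hW : IsOpen W := c.symm.contMDiffOn_toFun.continuousOn.isOpen_inter_preimage c.open_target hU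
  have hxW : c x ∈ W := ⟨hxt, by rw [mem_preimage, hcx]; exact hx⟩
  have hg : ContDiffOn ℝ ∞ (f ∘ c.symm) W := contMDiffOn_iff_contDiffOn.1
    (hf.comp (c.symm.contMDiffOn_toFun.mono inter_subset_left) fun _ h => h.2)
  have hgd : HasFDerivAt (f ∘ c.symm) (fderiv ℝ (f ∘ c.symm) (c x)) (c x) :=
    ((hg.contDiffAt (hW.mem_nhds hxW)).differentiableAt (by simp)).hasFDerivAt
  have hcd : MDifferentiableAt I 𝓘(ℝ, E) c x := (c.contMDiffAt hxc).mdifferentiableAt (by simp)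
  have hcs : MDifferentiableAt 𝓘(ℝ, E) I c.symm (c x) :=
    (c.contMDiffAt_symm hxt).mdifferentiableAt (by simp)
  have hsurj : Function.Surjective (fderiv ℝ (f ∘ c.symm) (c x)) := by
    intro w
    obtain ⟨v, hv⟩ := hD w
    have h1 := mfderiv_comp_apply_of_eventually_eq hcs hcd
      (eventually_of_mem (c.open_source.mem_nhds hxc) fun z hz => c.symm_apply_apply hz) v
    refine ⟨mfderiv I 𝓘(ℝ, E) c x v, ?_⟩
    have hfd : MDifferentiableAt I 𝓘(ℝ, F) f (c.symm (c x)) := by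
      rw [hcx]
      exact (hf.contMDiffAt (hU.mem_nhds hx)).mdifferentiableAt (by simp)
    have h2 := mfderiv_comp (c x) hfd hcs
    rw [mfderiv_eq_fderiv] at h2
    rw [h2]
    change mfderiv I 𝓘(ℝ, F) f (c.symm (c x)) (mfderiv 𝓘(ℝ, E) I c.symm (c x) _) = w
    erw [h1]
    rw [hcx]
    exact hv
  obtain ⟨Ψ, h1, h2, h3⟩ :=
    exists_partialDiffeomorph_of_surjective_fderiv hW hxW hg hgd hsurj
  refine ⟨c.trans Ψ, fderiv ℝ (f ∘ c.symm) (c x), hsurj, ⟨hxc, h1⟩, ?_, ?_⟩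
  · intro z hz
    have : c.symm (c z) ∈ U := (h2 hz.2).2
    rwa [c.symm_apply_apply hz.1] at this
  · intro z hz
    exact (h3 (c z)).trans (congrArg f (c.symm_apply_apply hz.1))

/-- A smooth map with a smooth local section through `x` is a submersion at `x`. -/
lemma isSubmersionAtOfComplement_of_local_section [I.Boundaryless] [IsManifold I ∞ X]
    [J.Boundaryless]
    [IsManifold J ∞ Y] [FiniteDimensional ℝ E] [FiniteDimensional ℝ F] {f : X → Y}
    (hf : ContMDiff I J ∞ f) {x : X} {s : Y → X} (hs : ContMDiffAt J I ∞ s (f x))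
    (hsx : s (f x) = x) (h : ∀ᶠ y in 𝓝 (f x), f (s y) = y) :
    Manifold.IsSubmersionAtOfComplement (CodimSpace E F) I J ∞ f x := by
  let c := PartialDiffeomorph.extChart J (f x)
  have hxc : f x ∈ c.source := PartialDiffeomorph.mem_extChart_source (f x)
  have hU : IsOpen (f ⁻¹' c.source) := c.open_source.preimage hf.continuous
  have hcd : MDifferentiableAt J 𝓘(ℝ, F) c (f x) := (c.contMDiffAt hxc).mdifferentiableAt (by simp)
  have hcs : MDifferentiableAt 𝓘(ℝ, F) J c.symm (c (f x)) :=
    (c.contMDiffAt_symm (c.map_mem_target hxc)).mdifferentiableAt (by simp)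
  have hsurj : Function.Surjective (mfderiv I 𝓘(ℝ, F) (c ∘ f) x) := by
    intro w
    have hcx : c.symm (c (f x)) = f x := c.symm_apply_apply hxc
    have h1 := mfderiv_comp_apply_of_eventually_eq (f := c) (s := c.symm) (y := c (f x))
      (by rw [hcx]; exact hcd) hcs (eventually_of_mem
        (c.open_target.mem_nhds (c.map_mem_target hxc)) fun z hz => c.apply_symm_apply hz) w
    rw [hcx] at h1
    have h2 := mfderiv_comp_apply_of_eventually_eq (f := f) (s := s) (y := f x)
      (hf.mdifferentiableAt (by simp)) (hs.mdifferentiableAt (by simp)) h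
      (mfderiv 𝓘(ℝ, F) J c.symm (c (f x)) w)
    rw [hsx] at h2
    rw [mfderiv_comp x hcd (hf.mdifferentiableAt (by simp))]
    refine ⟨mfderiv J I s (f x) (mfderiv 𝓘(ℝ, F) J c.symm (c (f x)) w), ?_⟩
    change mfderiv J 𝓘(ℝ, F) c (f x) (mfderiv I J f x _) = w
    erw [h2]
    exact h1
  obtain ⟨Φ, D, hD, h1, h2, h3⟩ := exists_partialDiffeomorph_of_surjective_mfderiv hU hxc
    (c.contMDiffOn_toFun.comp hf.contMDiffOn fun _ h => h) hsurj
  obtain ⟨e, he, hee⟩ := Φ.exists_mem_maximalAtlas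
  obtain ⟨A, hA⟩ := D.toLinearMap.exists_rightInverse_of_surjective (LinearMap.range_eq_top.2 hD)
  have hes : e.source = Φ.source := by rw [← hee, OpenPartialHomeomorph.extend_source]
  let A' := LinearMap.toContinuousLinearMap A
  have hA' : ∀ v, D (A' v) = v := fun v => LinearMap.congr_fun hA v
  obtain ⟨C⟩ := nonempty_kerEquiv D A' hA'
  refine Manifold.IsSubmersionAtOfComplement.trans_F (e := C)
    (Manifold.IsSubmersionAtOfComplement.mk_of_charts (splitEquiv D A' hA') e
    (chartAt _ (f x)) (by rw [hes]; exact h1)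
    (mem_chart_source _ _) he (IsManifold.chart_mem_maximalAtlas _) ?_ ?_)
  · rw [hes]
    intro z hz
    have := h2 hz
    change f z ∈ (extChartAt J (f x)).source at this
    rwa [extChartAt_source] at this
  · rw [hee]
    intro z hz
    have := h3 (Φ.symm z) (Φ.symm_mem_source hz)
    rw [Φ.apply_symm_apply hz] at this
    exact this.symm

/-- A smooth map with a smooth local left inverse is an immersion. -/
lemma isImmersionAtOfComplement_of_local_leftInverse [I.Boundaryless] [IsManifold I ∞ X]
    [J.Boundaryless]
    [IsManifold J ∞ Y] [FiniteDimensional ℝ E] [FiniteDimensional ℝ F] {f : X → Y}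
    (hf : ContMDiff I J ∞ f) {x : X} {r : Y → X} {W : Set Y} (hW : IsOpen W) (hxW : f x ∈ W)
    (hr : ContMDiffOn J I ∞ r W) (h : ∀ᶠ z in 𝓝 x, r (f z) = z) :
    Manifold.IsImmersionAtOfComplement (CodimSpace F E) I J ∞ f x := by
  have : CompleteSpace F := FiniteDimensional.complete ℝ F
  let c := PartialDiffeomorph.extChart I x
  have hxc : x ∈ c.source := PartialDiffeomorph.mem_extChart_source x
  let d := PartialDiffeomorph.extChart J (f x)
  have hxd : f x ∈ d.source := PartialDiffeomorph.mem_extChart_source (f x)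
  obtain ⟨O, hO, hOo, hxO⟩ := eventually_nhds_iff.1
    (h.and ((c.open_source.eventually_mem hxc).and
      ((d.open_source.preimage hf.continuous).eventually_mem hxd)))
  have hrx : r (f x) = x := (hO x hxO).1
  let j : E → F := d ∘ f ∘ c.symm
  let T : Set E := c.target ∩ c.symm ⁻¹' O
  have hT : IsOpen T :=
    c.symm.contMDiffOn_toFun.continuousOn.isOpen_inter_preimage c.open_target hOo
  have hj : ContDiffOn ℝ ∞ j T := contMDiffOn_iff_contDiffOn.1 <|
    d.contMDiffOn_toFun.comp (hf.contMDiffOn.comp (t := univ)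
      (c.symm.contMDiffOn_toFun.mono inter_subset_left) fun _ _ => mem_univ _)
      fun z hz => (hO _ hz.2).2.2
  have hcx : c.symm (c x) = x := c.symm_apply_apply hxc
  have hxT : c x ∈ T := ⟨c.map_mem_target hxc, by rw [mem_preimage, hcx]; exact hxO⟩
  have hdx : d.symm (d (f x)) = f x := d.symm_apply_apply hxd
  let R : F → E := c ∘ r ∘ d.symm
  let W₁ : Set F := d.target ∩ d.symm ⁻¹' W
  have hW₁ : IsOpen W₁ :=
    d.symm.contMDiffOn_toFun.continuousOn.isOpen_inter_preimage d.open_target hW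
  have hrd : ContMDiffOn 𝓘(ℝ, F) I ∞ (r ∘ d.symm) W₁ :=
    hr.comp (d.symm.contMDiffOn_toFun.mono inter_subset_left) fun _ h => h.2
  let W₂ : Set F := W₁ ∩ (r ∘ d.symm) ⁻¹' O
  have hW₂ : IsOpen W₂ := hrd.continuousOn.isOpen_inter_preimage hW₁ hOo
  have hR : ContDiffOn ℝ ∞ R W₂ := contMDiffOn_iff_contDiffOn.1 <|
    c.contMDiffOn_toFun.comp (hrd.mono inter_subset_left) fun z hz => (hO _ hz.2).2.1
  have hRT : MapsTo R W₂ T := fun z hz => by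
    refine ⟨c.map_mem_target (hO _ hz.2).2.1, ?_⟩
    change c.symm (c ((r ∘ d.symm) z)) ∈ O
    rw [c.symm_apply_apply (hO _ hz.2).2.1]
    exact hz.2
  have hxW₂ : d (f x) ∈ W₂ := by
    refine ⟨⟨d.map_mem_target hxd, by rw [mem_preimage, hdx]; exact hxW⟩, ?_⟩
    change r (d.symm (d (f x))) ∈ O
    rw [hdx, hrx]
    exact hxO
  have hRx : R (d (f x)) = c x := by
    change c (r (d.symm (d (f x)))) = c x
    rw [hdx, hrx]
  have hjx : j (c x) = d (f x) := by
    change d (f (c.symm (c x))) = d (f x)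
    rw [hcx]
  have hRj : ∀ u ∈ T, R (j u) = u := fun u hu => by
    change c (r (d.symm (d (f (c.symm u))))) = u
    rw [d.symm_apply_apply (hO _ hu.2).2.2, (hO _ hu.2).1, c.apply_symm_apply hu.1]
  let A := fderiv ℝ j (c x)
  let B := fderiv ℝ R (d (f x))
  have hA : HasFDerivAt j A (c x) :=
    ((hj.contDiffAt (hT.mem_nhds hxT)).differentiableAt (by simp)).hasFDerivAt
  have hB : HasFDerivAt R B (d (f x)) :=
    ((hR.contDiffAt (hW₂.mem_nhds hxW₂)).differentiableAt (by simp)).hasFDerivAt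
  have hBA : ∀ v, B (A v) = v := by
    have h1 : HasFDerivAt (R ∘ j) (B.comp A) (c x) := HasFDerivAt.comp (c x) (hjx.symm ▸ hB) hA
    have h2 : HasFDerivAt (R ∘ j) (.id ℝ E) (c x) :=
      (hasFDerivAt_id (c x)).congr_of_eventuallyEq
        (eventually_of_mem (hT.mem_nhds hxT) fun u hu => hRj u hu)
    exact fun v => congrArg (fun L => L v) (h1.unique h2)
  -- The correction `y ↦ y - j (R y) + A (R y)` has derivative the identity, and it sends `j u` to
  -- `A u` because `R (j u) = u`: it straightens the image of `j`.
  obtain ⟨Ψ, h1, h2, h3⟩ := exists_partialDiffeomorph_of_hasFDerivAt (A := .refl ℝ F)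
    (f := fun y => (y - j (R y)) + A (R y)) hW₂ hxW₂
    ((contDiff_id.contDiffOn.sub (hj.comp hR hRT)).add (A.contDiff.comp_contDiffOn hR)) (by
      have hA' : HasFDerivAt j A (R (d (f x))) := hRx.symm ▸ hA
      refine (((hasFDerivAt_id (d (f x))).sub (hA'.comp _ hB)).add
        (A.hasFDerivAt.comp _ hB)).congr_fderiv ?_
      exact ContinuousLinearMap.ext fun v : F => by simp)
  have hO' : IsOpen (O ∩ (d ∘ f) ⁻¹' Ψ.source) := by
    refine ContinuousOn.isOpen_inter_preimage ?_ hOo Ψ.open_source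
    exact d.contMDiffOn_toFun.continuousOn.comp hf.continuous.continuousOn fun z hz => (hO z hz).2.2
  obtain ⟨e, he, hee⟩ := (c.restrOpen _ hO').exists_mem_maximalAtlas
  obtain ⟨e', he', hee'⟩ := (d.trans Ψ).exists_mem_maximalAtlas
  obtain ⟨C⟩ := nonempty_kerEquiv B A hBA
  refine Manifold.IsImmersionAtOfComplement.trans_F (e := C)
    (Manifold.IsImmersionAtOfComplement.mk_of_continuousAt hf.continuous.continuousAt
    (splitEquiv B A hBA).symm e e' ?_ ?_ he he' ?_)
  · rw [← OpenPartialHomeomorph.extend_source (I := I), hee]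
    exact ⟨hxc, hxO, h1⟩
  · rw [← OpenPartialHomeomorph.extend_source (I := J), hee']
    exact ⟨hxd, h1⟩
  · rw [hee, hee']
    intro u hu
    have hu' : u ∈ T := ⟨hu.1, hu.2.1⟩
    refine (h3 (j u)).trans ?_
    simp only [Function.comp_apply]
    rw [hRj u hu', splitEquiv_symm_zero, sub_self, zero_add]

end PartialDiffeomorph

/-! ### Finite products of manifolds -/

section Pi

universe u v w
variable {ι : Type u} [Fintype ι] {E : ι → Type v} [∀ i, NormedAddCommGroup (E i)]
  [∀ i, NormedSpace ℝ (E i)] {H : ι → Type w} [∀ i, TopologicalSpace (H i)]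
  {I : ∀ i, ModelWithCorners ℝ (E i) (H i)} {n : ℕ∞ω}
  {X : ι → Type*} [∀ i, TopologicalSpace (X i)] [∀ i, ChartedSpace (H i) (X i)]
  {E' H' : Type*} [NormedAddCommGroup E'] [NormedSpace ℝ E'] [TopologicalSpace H']
  {J : ModelWithCorners ℝ E' H'} {Y : Type*} [TopologicalSpace Y] [ChartedSpace H' Y]

instance ModelWithCorners.boundaryless_pi [∀ i, (I i).Boundaryless] :
    (ModelWithCorners.pi I).Boundaryless where
  range_eq_univ := by
    refine eq_univ_of_forall fun f => ⟨fun i => (I i).symm (f i), funext fun i => ?_⟩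
    exact (I i).right_inv (by simp [(I i).range_eq_univ])

/-- Coordinate changes of product charts act componentwise. -/
instance IsManifold.pi [∀ i, IsManifold (I i) n (X i)] :
    IsManifold (ModelWithCorners.pi I) n (∀ i, X i) := by
  refine isManifold_of_contDiffOn _ _ _ ?_
  rintro _ _ ⟨e, he, rfl⟩ ⟨e', he', rfl⟩
  rw [contDiffOn_pi]
  intro i
  have h := ((contDiffGroupoid n (I i)).compatible (he i trivial) (he' i trivial))
  rw [contDiffGroupoid, mem_groupoid_of_pregroupoid] at h
  refine ContDiffOn.comp (g := I i ∘ ((e i).symm.trans (e' i)) ∘ (I i).symm) h.1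
    (f := fun f : ∀ i, E i => f i) (contDiff_pi.1 contDiff_id i).contDiffOn ?_
  rintro _ ⟨hy, y, rfl⟩
  simp only [mfld_simps] at hy ⊢
  have hi : ModelWithCorners.pi I y i = I i (y i) := rfl
  rw [hi, (I i).left_inv]
  exact ⟨⟨hy.1 i trivial, hy.2 i trivial⟩, mem_range_self _⟩

lemma contMDiffWithinAt_pi_manifold {f : Y → ∀ i, X i} {s : Set Y} {y : Y} :
    ContMDiffWithinAt J (ModelWithCorners.pi I) n f s y ↔
      ∀ i, ContMDiffWithinAt J (I i) n (fun z => f z i) s y := by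
  simp_rw [contMDiffWithinAt_iff_target (I := J) (I' := ModelWithCorners.pi I),
    continuousWithinAt_pi,
    contMDiffWithinAt_pi_space, ← forall_and]
  refine forall_congr' fun i => ?_
  rw [contMDiffWithinAt_iff_target (I := J) (I' := I i)]
  rfl

lemma contMDiffAt_pi_manifold {f : Y → ∀ i, X i} {y : Y} :
    ContMDiffAt J (ModelWithCorners.pi I) n f y ↔
      ∀ i, ContMDiffAt J (I i) n (fun z => f z i) y :=
  contMDiffWithinAt_pi_manifold

lemma contMDiff_pi_manifold {f : Y → ∀ i, X i} :
    ContMDiff J (ModelWithCorners.pi I) n f ↔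
      ∀ i, ContMDiff J (I i) n (fun z => f z i) :=
  ⟨fun h i y => contMDiffAt_pi_manifold.1 (h y) i,
    fun h y => contMDiffAt_pi_manifold.2 fun i => h i y⟩

lemma contMDiff_eval (i : ι) :
    ContMDiff (ModelWithCorners.pi I) (I i) n (fun f : ∀ i, X i => f i) :=
  contMDiff_pi_manifold.1 contMDiff_id i

end Pi

/-! ### Embedded submanifolds given by local parametrisations -/

section Submanifold

variable {E : Type*} [NormedAddCommGroup E] [NormedSpace ℝ E]
  {E' H' : Type*} [NormedAddCommGroup E'] [NormedSpace ℝ E'] [TopologicalSpace H']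
  {J : ModelWithCorners ℝ E' H'} {Y : Type*} [TopologicalSpace Y] [ChartedSpace H' Y]

variable (E J) in
/-- A regular local parametrisation of a subset `S` of a manifold `Y`: in the open set `domain`
of `Y`, the set `S` is the image of the smooth map `param`, and `param` is inverted by the
restriction to `S` of the smooth map `coord`. -/
structure SubmanifoldParam (S : Set Y) where
  domain : Set Y
  isOpen_domain : IsOpen domain
  coord : Y → E
  contMDiffOn_coord : ContMDiffOn J 𝓘(ℝ, E) ∞ coord domain
  range : Set E
  isOpen_range : IsOpen range
  param : E → Y
  contMDiffOn_param : ContMDiffOn 𝓘(ℝ, E) J ∞ param range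
  param_mem : ∀ u ∈ range, param u ∈ S ∩ domain
  coord_mem : ∀ y ∈ S ∩ domain, coord y ∈ range
  coord_param : ∀ u ∈ range, coord (param u) = u
  param_coord : ∀ y ∈ S ∩ domain, param (coord y) = y

variable {S : Set Y}

open Classical in
/-- The chart of the subset `S` defined by a regular local parametrisation. -/
def SubmanifoldParam.chart (p : SubmanifoldParam E J S) (x₀ : S) : OpenPartialHomeomorph S E where
  toFun x := p.coord x
  -- On `range` the point `p.param u` lies in `S`; elsewhere `x₀` is a default value.
  invFun u := if h : p.param u ∈ S then ⟨p.param u, h⟩ else x₀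
  source := Subtype.val ⁻¹' p.domain
  target := p.range
  map_source' x hx := p.coord_mem x ⟨x.2, hx⟩
  map_target' u hu := by
    have h := p.param_mem u hu
    simpa [h.1] using h.2
  left_inv' x hx := by
    have h := p.param_coord x ⟨x.2, hx⟩
    simp [h]
  right_inv' u hu := by
    simp [(p.param_mem u hu).1, p.coord_param u hu]
  open_source := p.isOpen_domain.preimage continuous_subtype_val
  open_target := p.isOpen_range
  continuousOn_toFun :=
    p.contMDiffOn_coord.continuousOn.comp continuous_subtype_val.continuousOn fun _ h => h
  continuousOn_invFun := by
    rw [Topology.IsInducing.subtypeVal.continuousOn_iff]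
    refine p.contMDiffOn_param.continuousOn.congr fun u hu => ?_
    simp [(p.param_mem u hu).1]

lemma SubmanifoldParam.chart_apply (p : SubmanifoldParam E J S) (x₀ x : S) :
    p.chart x₀ x = p.coord x := rfl

lemma SubmanifoldParam.coe_chart_symm (p : SubmanifoldParam E J S) (x₀ : S) {u : E}
    (hu : u ∈ p.range) : ((p.chart x₀).symm u : Y) = p.param u := by
  simp [SubmanifoldParam.chart, (p.param_mem u hu).1]

/-- A subset of a manifold that has regular local parametrisations is a manifold, the inclusion is
smooth, and it has smooth local left inverses. -/
theorem exists_chartedSpace_of_submanifoldParam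
    (h : ∀ x : S, ∃ p : SubmanifoldParam E J S, (x : Y) ∈ p.domain) :
    ∃ _ : ChartedSpace E S, IsManifold 𝓘(ℝ, E) ∞ S ∧
      ContMDiff 𝓘(ℝ, E) J ∞ (Subtype.val : S → Y) ∧
      ∀ x : S, ∃ (ρ : Y → S) (W : Set Y), IsOpen W ∧ (x : Y) ∈ W ∧
        ContMDiffOn J 𝓘(ℝ, E) ∞ ρ W ∧ ∀ z : S, (z : Y) ∈ W → ρ z = z := by
  choose p hp using h
  let cs : ChartedSpace E S :=
    { atlas := range fun x => (p x).chart x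
      chartAt := fun x => (p x).chart x
      mem_chart_source := hp
      chart_mem_atlas := mem_range_self }
  have hm : IsManifold 𝓘(ℝ, E) ∞ S := by
    refine isManifold_of_contDiffOn _ _ _ ?_
    rintro _ _ ⟨x, rfl⟩ ⟨y, rfl⟩
    simp only [mfld_simps]
    refine contMDiffOn_iff_contDiffOn.1 ?_
    have hs : ((p x).chart x).target ∩ ((p x).chart x).symm ⁻¹' ((p y).chart y).source ⊆
      (p x).range := inter_subset_left
    refine ((p y).contMDiffOn_coord.comp ((p x).contMDiffOn_param.mono hs) ?_).congr ?_
    · rintro u ⟨hu, hu'⟩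
      have : (((p x).chart x).symm u : Y) ∈ (p y).domain := hu'
      rwa [SubmanifoldParam.coe_chart_symm _ _ hu] at this
    · rintro u ⟨hu, hu'⟩
      simp only [Function.comp_apply, SubmanifoldParam.chart_apply]
      rw [SubmanifoldParam.coe_chart_symm _ _ hu]
  refine ⟨cs, hm, ?_, ?_⟩
  · intro x
    have hc : ContMDiffAt 𝓘(ℝ, E) 𝓘(ℝ, E) ∞ ((p x).chart x) x :=
      contMDiffAt_of_mem_maximalAtlas (IsManifold.chart_mem_maximalAtlas x) (hp x)
    have hu : (p x).chart x x ∈ (p x).range := (p x).coord_mem x ⟨x.2, hp x⟩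
    refine (((p x).contMDiffOn_param.contMDiffAt
      ((p x).isOpen_range.mem_nhds hu)).comp x hc).congr_of_eventuallyEq ?_
    filter_upwards [((p x).chart x).open_source.mem_nhds (hp x)] with y hy
    exact ((p x).param_coord y ⟨y.2, hy⟩).symm
  · intro x
    -- Since `coord` is smooth on an open subset of `Y` and not only on `S`, following it by the
    -- inverse chart gives a retraction.
    refine ⟨((p x).chart x).symm ∘ (p x).coord, (p x).domain ∩ (p x).coord ⁻¹' (p x).range,
      (p x).contMDiffOn_coord.continuousOn.isOpen_inter_preimage (p x).isOpen_domain
        (p x).isOpen_range, ⟨hp x, (p x).coord_mem x ⟨x.2, hp x⟩⟩, ?_, ?_⟩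
    · exact (contMDiffOn_symm_of_mem_maximalAtlas (IsManifold.chart_mem_maximalAtlas x)).comp
        ((p x).contMDiffOn_coord.mono inter_subset_left) fun _ h => h.2
    · exact fun z hz => ((p x).chart x).left_inv hz.1

/-- A map to a subset with smooth local retractions is smooth if it is smooth as a map to the
ambient manifold. -/
lemma contMDiffWithinAt_subtype_of_retraction {EX HX : Type*} [NormedAddCommGroup EX]
    [NormedSpace ℝ EX] [TopologicalSpace HX] {I : ModelWithCorners ℝ EX HX} {X : Type*}
    [TopologicalSpace X] [ChartedSpace HX X] [ChartedSpace E S] {f : X → S} {s : Set X} {x : X}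
    {ρ : Y → S} {W : Set Y} (hW : IsOpen W) (hx : (f x : Y) ∈ W)
    (hρ : ContMDiffOn J 𝓘(ℝ, E) ∞ ρ W) (hρ' : ∀ z : S, (z : Y) ∈ W → ρ z = z)
    (hf : ContMDiffWithinAt I J ∞ (fun z => (f z : Y)) s x) :
    ContMDiffWithinAt I 𝓘(ℝ, E) ∞ f s x := by
  have h1 : ContMDiffWithinAt I 𝓘(ℝ, E) ∞ (ρ ∘ fun z => (f z : Y)) s x :=
    (hρ.contMDiffAt (hW.mem_nhds hx)).comp_contMDiffWithinAt x hf
  refine h1.congr_of_eventuallyEq ?_ (hρ' _ hx).symm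
  filter_upwards [hf.continuousWithinAt.preimage_mem_nhdsWithin (hW.mem_nhds hx)] with z hz
  exact (hρ' _ hz).symm

end Submanifold

/-! ### Straightening charts and rates of arrows -/

section Rate

/-- Charts of an `m`-dimensional manifold with a distinguished last coordinate. -/
abbrev StraightChart (m : ℕ) (M : Type*) [TopologicalSpace M]
    [ChartedSpace (EuclideanSpace ℝ (Fin m)) M] :=
  PartialDiffeomorph (𝓡 m) 𝓘(ℝ, EuclideanSpace ℝ (Fin (m - 1)) × ℝ)
    M (EuclideanSpace ℝ (Fin (m - 1)) × ℝ) ∞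

variable {m : ℕ} {M : Type*} [TopologicalSpace M] [ChartedSpace (EuclideanSpace ℝ (Fin m)) M]
  {V : Set M} {e e₁ e₂ e₃ : StraightChart m M} {x : M}

lemma contMDiffOn_lastCoord (e : StraightChart m M) :
    ContMDiffOn (𝓡 m) 𝓘(ℝ, ℝ) ∞ (fun z => (e z).2) e.source :=
  contDiff_snd.contMDiff.comp_contMDiffOn e.contMDiffOn_toFun

lemma contMDiffAt_lastCoord (hx : x ∈ e.source) :
    ContMDiffAt (𝓡 m) 𝓘(ℝ, ℝ) ∞ (fun z => (e z).2) x :=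
  (contMDiffOn_lastCoord e).contMDiffAt (e.open_source.mem_nhds hx)

lemma lastCoordDeriv_eq_snd (hx : x ∈ e.source) (v : TangentSpace (𝓡 m) x) :
    lastCoordDeriv m e x v =
      (mfderiv (𝓡 m) 𝓘(ℝ, EuclideanSpace ℝ (Fin (m - 1)) × ℝ) e x v :
        EuclideanSpace ℝ (Fin (m - 1)) × ℝ).2 := by
  have h := mfderiv_comp (I'' := 𝓘(ℝ, ℝ)) (g := Prod.snd) x
    (differentiableAt_snd (𝕜 := ℝ) (p := e x)).mdifferentiableAt
    ((e.contMDiffAt hx).mdifferentiableAt (by simp))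
  rw [mfderiv_eq_fderiv, fderiv_snd] at h
  exact congrArg (fun A => (A v : ℝ)) h

lemma mfderiv_symm_apply_mfderiv (hx : x ∈ e.source) (v : TangentSpace (𝓡 m) x) :
    (mfderiv 𝓘(ℝ, EuclideanSpace ℝ (Fin (m - 1)) × ℝ) (𝓡 m) e.symm (e x)
      (mfderiv (𝓡 m) 𝓘(ℝ, EuclideanSpace ℝ (Fin (m - 1)) × ℝ) e x v) :
        EuclideanSpace ℝ (Fin m)) = v :=
  mfderiv_comp_apply_of_eventually_eq
    ((e.contMDiffAt_symm (e.map_mem_target hx)).mdifferentiableAt (by simp))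
    ((e.contMDiffAt hx).mdifferentiableAt (by simp))
    (eventually_of_mem (e.open_source.mem_nhds hx) fun _ hz => e.symm_apply_apply hz) v

lemma exists_lastCoordDeriv_eq_one (hx : x ∈ e.source) :
    ∃ v : TangentSpace (𝓡 m) x, lastCoordDeriv m e x v = 1 := by
  have hex : e.symm (e x) = x := e.symm_apply_apply hx
  have h := mfderiv_comp_apply_of_eventually_eq (f := e) (s := e.symm) (y := e x)
    (by rw [hex]; exact (e.contMDiffAt hx).mdifferentiableAt (by simp))
    ((e.contMDiffAt_symm (e.map_mem_target hx)).mdifferentiableAt (by simp))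
    (eventually_of_mem (e.open_target.mem_nhds (e.map_mem_target hx)) fun _ hz =>
      e.apply_symm_apply hz) ((0, 1) : EuclideanSpace ℝ (Fin (m - 1)) × ℝ)
  rw [hex] at h
  refine ⟨mfderiv 𝓘(ℝ, EuclideanSpace ℝ (Fin (m - 1)) × ℝ) (𝓡 m) e.symm (e x)
    ((0, 1) : EuclideanSpace ℝ (Fin (m - 1)) × ℝ), ?_⟩
  exact (lastCoordDeriv_eq_snd hx _).trans (congrArg Prod.snd h)

/-- The retraction that freezes the last coordinate. -/
def freezeLast (e : StraightChart m M) (t : ℝ) (z : M) : M := e.symm ((e z).1, t)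

lemma freezeLast_self (hx : x ∈ e.source) : freezeLast e (e x).2 x = x :=
  e.symm_apply_apply hx

lemma contMDiffAt_freezeLast (hx : x ∈ e.source) :
    ContMDiffAt (𝓡 m) (𝓡 m) ∞ (freezeLast e (e x).2) x := by
  have h1 : ContMDiffAt (𝓡 m) 𝓘(ℝ, EuclideanSpace ℝ (Fin (m - 1)) × ℝ) ∞
      (fun z => ((e z).1, (e x).2)) x :=
    (contDiff_fst.prodMk contDiff_const).contMDiff.contMDiffAt.comp x (e.contMDiffAt hx)
  exact ContMDiffAt.comp x (g := e.symm) (e.contMDiffAt_symm (e.map_mem_target hx)) h1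

lemma mfderiv_freezeLast (hx : x ∈ e.source) {v : TangentSpace (𝓡 m) x}
    (hv : lastCoordDeriv m e x v = 0) :
    (mfderiv (𝓡 m) (𝓡 m) (freezeLast e (e x).2) x v : EuclideanSpace ℝ (Fin m)) = v := by
  let P : EuclideanSpace ℝ (Fin (m - 1)) × ℝ → EuclideanSpace ℝ (Fin (m - 1)) × ℝ :=
    fun p => (p.1, (e x).2)
  have hP : HasFDerivAt P ((ContinuousLinearMap.fst ℝ (EuclideanSpace ℝ (Fin (m - 1))) ℝ).prod 0)
      (e x) := hasFDerivAt_fst.prodMk (hasFDerivAt_const _ _)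
  have hPx : P (e x) = e x := rfl
  have hd : MDifferentiableAt (𝓡 m) 𝓘(ℝ, EuclideanSpace ℝ (Fin (m - 1)) × ℝ) e x :=
    (e.contMDiffAt hx).mdifferentiableAt (by simp)
  have hs : MDifferentiableAt 𝓘(ℝ, EuclideanSpace ℝ (Fin (m - 1)) × ℝ) (𝓡 m) e.symm (P (e x)) :=
    (e.contMDiffAt_symm (e.map_mem_target hx)).mdifferentiableAt (by simp)
  have h1 := mfderiv_comp x hs (hP.differentiableAt.mdifferentiableAt.comp x hd)
  have h2 := mfderiv_comp x hP.differentiableAt.mdifferentiableAt hd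
  rw [mfderiv_eq_fderiv, hP.fderiv] at h2
  have h3 := congrArg (fun A => (A v : EuclideanSpace ℝ (Fin m))) h1
  refine h3.trans (Eq.trans ?_ (mfderiv_symm_apply_mfderiv hx v))
  refine congrArg (mfderiv 𝓘(ℝ, EuclideanSpace ℝ (Fin (m - 1)) × ℝ) (𝓡 m) e.symm (e x)) ?_
  refine (congrArg (fun A => (A v : EuclideanSpace ℝ (Fin (m - 1)) × ℝ)) h2).trans ?_
  rw [lastCoordDeriv_eq_snd hx] at hv
  exact Prod.ext rfl hv.symm

/-- The last coordinate is one of the test functions, which gives one direction. Conversely,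
`freezeLast` at the value `0` maps a neighborhood of `x` into `V`, so a test function composed with
it vanishes near `x`; and its differential fixes the vectors killed by the last coordinate. -/
lemma IsSliceChart.mem_tangentTo_iff (he : IsSliceChart m V e) (hx : x ∈ e.source) (hxV : x ∈ V)
    {v : TangentSpace (𝓡 m) x} : v ∈ tangentTo m V x ↔ lastCoordDeriv m e x v = 0 := by
  constructor
  · intro hv
    refine hv hxV _ (contMDiffAt_lastCoord hx) ?_
    filter_upwards [self_mem_nhdsWithin, mem_nhdsWithin_of_mem_nhds (e.open_source.mem_nhds hx)]
      with y hy hy'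
    exact (he y hy').1 hy
  · intro hv _ f hf hf0
    have hx0 : (e x).2 = 0 := (he x hx).1 hxV
    have hfr := contMDiffAt_freezeLast hx
    have hev : ∀ᶠ z in 𝓝 x, freezeLast e (e x).2 z ∈ V := by
      have h1 : ∀ᶠ z in 𝓝 x, ((e z).1, (e x).2) ∈ e.target := by
        have : ContinuousAt (fun z => ((e z).1, (e x).2)) x :=
          ((e.contMDiffAt hx).continuousAt.fst).prodMk continuousAt_const
        exact this.eventually (e.open_target.mem_nhds (e.map_mem_target hx))
      filter_upwards [h1] with z hz
      refine (he _ (e.symm_mem_source hz)).2 ?_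
      rw [e.apply_symm_apply hz]
      exact hx0
    have h0 : ∀ᶠ z in 𝓝 x, (f ∘ freezeLast e (e x).2) z = (fun _ => (0 : ℝ)) z := by
      have ht : Tendsto (freezeLast e (e x).2) (𝓝 x) (𝓝[V] x) := by
        refine tendsto_nhdsWithin_iff.2 ⟨?_, hev⟩
        have := hfr.continuousAt.tendsto
        rwa [freezeLast_self hx] at this
      exact ht.eventually hf0
    have h1 := mfderiv_comp_of_eq (hf.mdifferentiableAt (by simp))
      (hfr.mdifferentiableAt (by simp)) (freezeLast_self hx)
    rw [EventuallyEq.mfderiv_eq h0, mfderiv_const] at h1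
    have h2 := congrArg (fun A => (A v : ℝ)) h1
    have h3 : mfderiv (𝓡 m) 𝓘(ℝ, ℝ) f x (mfderiv (𝓡 m) (𝓡 m) (freezeLast e (e x).2) x v) =
      mfderiv (𝓡 m) 𝓘(ℝ, ℝ) f x v := congrArg _ (mfderiv_freezeLast hx hv)
    have h4 : ∀ y, y = x → ∀ u : EuclideanSpace ℝ (Fin m),
        (mfderiv (𝓡 m) 𝓘(ℝ, ℝ) f y u : ℝ) = mfderiv (𝓡 m) 𝓘(ℝ, ℝ) f x u := by
      rintro _ rfl _
      rfl
    exact h3.symm.trans ((h4 _ (freezeLast_self hx) _).symm.trans h2.symm)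

lemma lastCoordDeriv_sub (v w : TangentSpace (𝓡 m) x) :
    lastCoordDeriv m e x (v - w) = lastCoordDeriv m e x v - lastCoordDeriv m e x w :=
  map_sub (mfderiv (𝓡 m) 𝓘(ℝ, ℝ) (fun z => (e z).2) x) v w

lemma lastCoordDeriv_smul (c : ℝ) (v : TangentSpace (𝓡 m) x) :
    lastCoordDeriv m e x (c • v) = c * lastCoordDeriv m e x v :=
  map_smul (mfderiv (𝓡 m) 𝓘(ℝ, ℝ) (fun z => (e z).2) x) c v

lemma IsSliceChart.mk_eq_mk_iff (he : IsSliceChart m V e) (hx : x ∈ e.source) (hxV : x ∈ V)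
    {v w : TangentSpace (𝓡 m) x} :
    (Submodule.Quotient.mk v : NormalFiber m V x) = Submodule.Quotient.mk w ↔
      lastCoordDeriv m e x v = lastCoordDeriv m e x w := by
  rw [Submodule.Quotient.eq, he.mem_tangentTo_iff hx hxV, lastCoordDeriv_sub, sub_eq_zero]

lemma IsSliceChart.mk_eq_zero_iff (he : IsSliceChart m V e) (hx : x ∈ e.source) (hxV : x ∈ V)
    {v : TangentSpace (𝓡 m) x} :
    (Submodule.Quotient.mk v : NormalFiber m V x) = 0 ↔ lastCoordDeriv m e x v = 0 := by
  rw [Submodule.Quotient.mk_eq_zero, he.mem_tangentTo_iff hx hxV]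

/-- The rate of an arrow of the puff of `V` with respect to two straightening charts, around its
range and its source: the quotient of the last coordinates off `V`, and the rate of dilation of
the normal bundles on `V`. -/
def HasRate (e₁ e₂ : StraightChart m M) (γ : PuffArrow m V) (l : ℝ) : Prop :=
  (e₁ γ.tgt).2 = l * (e₂ γ.src).2 ∧
    (γ.src ∈ V → ∀ (v : TangentSpace (𝓡 m) γ.src) (w : TangentSpace (𝓡 m) γ.tgt),
      γ.iso (Submodule.Quotient.mk v) = Submodule.Quotient.mk w →
      lastCoordDeriv m e₁ γ.tgt w = l * lastCoordDeriv m e₂ γ.src v)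

variable {γ γ' : PuffArrow m V} {l l' : ℝ}

/-- On `V` the normal spaces are lines, and the rate is read off the image of the class of a vector
`v₀` with last coordinate `1`. Off `V` the rate is a quotient of last coordinates. -/
lemma exists_hasRate (h₁ : IsSliceChart m V e₁) (h₂ : IsSliceChart m V e₂)
    (ht : γ.tgt ∈ e₁.source) (hs : γ.src ∈ e₂.source) : ∃ l, HasRate e₁ e₂ γ l := by
  by_cases hV : γ.src ∈ V
  · obtain ⟨v₀, hv₀⟩ := exists_lastCoordDeriv_eq_one hs
    obtain ⟨w₀, hw₀⟩ := Submodule.Quotient.mk_surjective _ (γ.iso (Submodule.Quotient.mk v₀))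
    refine ⟨lastCoordDeriv m e₁ γ.tgt w₀, ?_, fun _ v w hvw => ?_⟩
    · rw [(h₁ _ ht).1 (γ.mem_iff.2 hV), (h₂ _ hs).1 hV, mul_zero]
    · have h3 : (Submodule.Quotient.mk v : NormalFiber m V γ.src) =
          lastCoordDeriv m e₂ γ.src v • Submodule.Quotient.mk v₀ := by
        rw [← Submodule.Quotient.mk_smul, h₂.mk_eq_mk_iff hs hV, lastCoordDeriv_smul, hv₀, mul_one]
      rw [h3, map_smul, ← hw₀, ← Submodule.Quotient.mk_smul,
        h₁.mk_eq_mk_iff ht (γ.mem_iff.2 hV), lastCoordDeriv_smul] at hvw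
      rw [← hvw, mul_comm]
  · refine ⟨(e₁ γ.tgt).2 / (e₂ γ.src).2, ?_, fun h => absurd h hV⟩
    rw [div_mul_cancel₀]
    exact fun h => hV ((h₂ _ hs).2 h)

lemma HasRate.unique (hl : HasRate e₁ e₂ γ l) (hl' : HasRate e₁ e₂ γ l')
    (h₂ : IsSliceChart m V e₂) (hs : γ.src ∈ e₂.source) : l = l' := by
  by_cases hV : γ.src ∈ V
  · obtain ⟨v, hv⟩ := exists_lastCoordDeriv_eq_one hs
    obtain ⟨w, hw⟩ := Submodule.Quotient.mk_surjective _ (γ.iso (Submodule.Quotient.mk v))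
    have h1 := hl.2 hV v w hw.symm
    rw [hl'.2 hV v w hw.symm, hv, mul_one, mul_one] at h1
    exact h1.symm
  · have h0 : (e₂ γ.src).2 ≠ 0 := fun h => hV ((h₂ _ hs).2 h)
    exact mul_right_cancel₀ h0 (hl.1.symm.trans hl'.1)

/-- A zero rate would make the isomorphism kill a nonzero class or, off `V`, would put the range on
`V`. -/
lemma HasRate.ne_zero (hl : HasRate e₁ e₂ γ l) (h₁ : IsSliceChart m V e₁)
    (h₂ : IsSliceChart m V e₂) (ht : γ.tgt ∈ e₁.source) (hs : γ.src ∈ e₂.source) : l ≠ 0 := by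
  rintro rfl
  by_cases hV : γ.src ∈ V
  · obtain ⟨v, hv⟩ := exists_lastCoordDeriv_eq_one hs
    obtain ⟨w, hw⟩ := Submodule.Quotient.mk_surjective _ (γ.iso (Submodule.Quotient.mk v))
    have h1 := hl.2 hV v w hw.symm
    rw [zero_mul, ← h₁.mk_eq_zero_iff ht (γ.mem_iff.2 hV), hw, LinearEquiv.map_eq_zero_iff,
      h₂.mk_eq_zero_iff hs hV, hv] at h1
    exact one_ne_zero h1
  · refine hV (γ.mem_iff.1 ((h₁ _ ht).2 ?_))
    rw [hl.1, zero_mul]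

/-- An isomorphism of normal lines is determined by its rate; off `V` there is only one arrow
between two points. -/
lemma HasRate.arrow_ext (hl : HasRate e₁ e₂ γ l) (hl' : HasRate e₁ e₂ γ' l)
    (h₁ : IsSliceChart m V e₁) (ht : γ.tgt ∈ e₁.source)
    (htt : γ.tgt = γ'.tgt) (hss : γ.src = γ'.src) : γ = γ' := by
  by_cases hV : γ.src ∈ V
  · obtain ⟨x, y, hxy, α⟩ := γ
    obtain ⟨x', y', hxy', β⟩ := γ'
    dsimp only at htt hss ht hV
    subst htt hss
    have hab : α = β := by
      refine LinearEquiv.ext fun n => ?_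
      obtain ⟨v, rfl⟩ := Submodule.Quotient.mk_surjective _ n
      obtain ⟨w, hw⟩ := Submodule.Quotient.mk_surjective _ (α (Submodule.Quotient.mk v))
      obtain ⟨w', hw'⟩ := Submodule.Quotient.mk_surjective _ (β (Submodule.Quotient.mk v))
      rw [← hw, ← hw', h₁.mk_eq_mk_iff ht (hxy.2 hV)]
      exact (hl.2 hV v w hw.symm).trans (hl'.2 hV v w' hw'.symm).symm
    rw [hab]
  · exact PuffArrow.ext_of_notMem m htt hss fun h => hV (γ.mem_iff.1 h)

lemma hasRate_unit (he : IsSliceChart m V e) (hx : x ∈ e.source) :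
    HasRate e e ((puffArrowGroupoid m V).unit x) 1 := by
  refine ⟨(one_mul _).symm, fun hV v w hvw => ?_⟩
  rw [one_mul]
  exact ((he.mk_eq_mk_iff hx hV).1 hvw).symm

lemma HasRate.inv (hl : HasRate e₁ e₂ γ l) (h0 : l ≠ 0) :
    HasRate e₂ e₁ ((puffArrowGroupoid m V).inv γ) l⁻¹ := by
  refine ⟨?_, fun hV v w hvw => ?_⟩
  · change (e₂ γ.src).2 = l⁻¹ * (e₁ γ.tgt).2
    rw [hl.1, inv_mul_cancel_left₀ h0]
  · have h1 := hl.2 (γ.mem_iff.1 hV) w v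
      ((congrArg γ.iso hvw.symm).trans (γ.iso.apply_symm_apply _))
    change lastCoordDeriv m e₂ γ.src w = l⁻¹ * lastCoordDeriv m e₁ γ.tgt v
    rw [h1, inv_mul_cancel_left₀ h0]

/-- The chart `e₂` is used both at the source of `γ` and at the range of `γ'`, so that the middle
trivialisation cancels. -/
lemma HasRate.mul (hl : HasRate e₁ e₂ γ l) (hl' : HasRate e₂ e₃ γ' l') (p : γ.src = γ'.tgt) :
    HasRate e₁ e₃ ((puffArrowGroupoid m V).mul γ γ' p) (l * l') := by
  obtain ⟨x, y, hxy, α⟩ := γ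
  obtain ⟨y', z, hyz, β⟩ := γ'
  dsimp only [puffArrowGroupoid] at p
  subst p
  refine ⟨?_, fun hV v w hvw => ?_⟩
  · change (e₁ x).2 = l * l' * (e₃ z).2
    rw [hl.1, hl'.1, mul_assoc]
  · obtain ⟨u, hu⟩ := Submodule.Quotient.mk_surjective _ (β (Submodule.Quotient.mk v))
    have h1 := hl'.2 hV v u hu.symm
    have h2 := hl.2 (hyz.2 hV) u w ((congrArg α hu).trans hvw)
    change lastCoordDeriv m e₁ x w = l * l' * lastCoordDeriv m e₃ z v
    rw [h2, mul_assoc]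
    exact congrArg (l * ·) h1

open Classical in
/-- The rate of an arrow with respect to two straightening charts, see `HasRate`. -/
def rate (e₁ e₂ : StraightChart m M) (γ : PuffArrow m V) : ℝ :=
  Classical.epsilon (HasRate e₁ e₂ γ)

lemma hasRate_rate (h₁ : IsSliceChart m V e₁) (h₂ : IsSliceChart m V e₂)
    (ht : γ.tgt ∈ e₁.source) (hs : γ.src ∈ e₂.source) : HasRate e₁ e₂ γ (rate e₁ e₂ γ) :=
  Classical.epsilon_spec (exists_hasRate h₁ h₂ ht hs)

lemma HasRate.rate_eq (hl : HasRate e₁ e₂ γ l) (h₁ : IsSliceChart m V e₁)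
    (h₂ : IsSliceChart m V e₂) (ht : γ.tgt ∈ e₁.source) (hs : γ.src ∈ e₂.source) :
    rate e₁ e₂ γ = l :=
  (hasRate_rate h₁ h₂ ht hs).unique hl h₂ hs

end Rate

/-! ### The smooth structure of the puff of a hypersurface -/

section PuffManifold

/-- The model space of the puffs of the hypersurfaces of an `m`-dimensional manifold. -/
abbrev PairSpace (m : ℕ) := EuclideanSpace ℝ (Fin m) × EuclideanSpace ℝ (Fin m)

/-- The space of the parameters `(a, b, t, l)` of the puff of a hypersurface. -/
abbrev SliceSpace (m : ℕ) :=
  EuclideanSpace ℝ (Fin (m - 1)) × EuclideanSpace ℝ (Fin (m - 1)) × ℝ × ℝ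

variable {m : ℕ} {M : Type*} [TopologicalSpace M] [ChartedSpace (EuclideanSpace ℝ (Fin m)) M]
  {V : Set M} {e e₁ e₂ e₃ : StraightChart m M}

/-- The coordinates of an arrow in a pair of straightening charts. -/
def sliceCoord (e₁ e₂ : StraightChart m M) (γ : PuffArrow m V) : SliceSpace m :=
  ((e₁ γ.tgt).1, (e₂ γ.src).1, (e₂ γ.src).2, rate e₁ e₂ γ)

/-- The arrows with range and source in the domains of two charts. -/
def arrowsBetween (V : Set M) (e₁ e₂ : StraightChart m M) : Set (PuffArrow m V) :=
  {γ | γ.tgt ∈ e₁.source ∧ γ.src ∈ e₂.source}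

open Classical in
/-- The composition of the puff, extended to all pairs of arrows. -/
def puffMul (p : PuffArrow m V × PuffArrow m V) : PuffArrow m V :=
  if h : p.1.src = p.2.tgt then (puffArrowGroupoid m V).mul p.1 p.2 h else p.1

lemma puffMul_eq (γ δ : PuffArrow m V) (p : γ.src = δ.tgt) :
    puffMul (γ, δ) = (puffArrowGroupoid m V).mul γ δ p :=
  dif_pos p

variable [TopologicalSpace (PuffArrow m V)] [ChartedSpace (PairSpace m) (PuffArrow m V)]

/-- `IsPuffManifold` prescribes only the source and the values of this parametrisation. Since an
arrow off `V` is determined by its anchor, the target and the inverse follow. -/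
lemma IsPuffManifold.exists_complParam (h : IsPuffManifold m V) :
    ∃ Φ : PartialDiffeomorph ((𝓡 m).prod (𝓡 m)) 𝓘(ℝ, PairSpace m) (M × M) (PuffArrow m V) ∞,
      Φ.source = Vᶜ ×ˢ Vᶜ ∧ Φ.target = {γ | γ.src ∉ V} ∧
      (∀ p ∈ Vᶜ ×ˢ Vᶜ, anchor m (Φ p) = p) ∧ ∀ γ ∈ Φ.target, Φ.symm γ = anchor m γ := by
  obtain ⟨Φ, h1, h2⟩ := h.exists_compl
  have h3 : ∀ γ ∈ Φ.target, Φ.symm γ = anchor m γ := fun γ hγ => by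
    have := h2 _ (h1 ▸ Φ.symm_mem_source hγ)
    rwa [Φ.apply_symm_apply hγ, eq_comm] at this
  refine ⟨Φ, h1, Set.ext fun γ => ⟨fun hγ => ?_, fun hγ => ?_⟩, h2, h3⟩
  · have := Φ.symm_mem_source hγ
    rw [h3 γ hγ, h1] at this
    exact this.2
  · have hp : anchor m γ ∈ Vᶜ ×ˢ Vᶜ := ⟨fun h => hγ (γ.mem_iff.1 h), hγ⟩
    have h4 : Φ (anchor m γ) = γ :=
      PuffArrow.ext_of_notMem m (congrArg Prod.fst (h2 _ hp)) (congrArg Prod.snd (h2 _ hp))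
        (by rw [show (Φ (anchor m γ)).tgt = γ.tgt from congrArg Prod.fst (h2 _ hp)]; exact hp.1)
    rw [← h4]
    exact Φ.map_mem_target (h1 ▸ hp)

/-- The analogue for slices: the condition of `IsPuffManifold` at `t = 0` becomes `HasRate`, and
since range, source and rate determine an arrow, the target consists of all arrows between the two
domains and the inverse is `sliceCoord`. -/
lemma IsPuffManifold.exists_sliceParam (h : IsPuffManifold m V) (h₁ : IsSliceChart m V e₁)
    (h₂ : IsSliceChart m V e₂) :
    ∃ Φ : PartialDiffeomorph 𝓘(ℝ, SliceSpace m) 𝓘(ℝ, PairSpace m) (SliceSpace m)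
        (PuffArrow m V) ∞,
      (∀ a b t l, (a, b, t, l) ∈ Φ.source ↔
        l ≠ 0 ∧ (a, l * t) ∈ e₁.target ∧ (b, t) ∈ e₂.target) ∧
      Φ.target = arrowsBetween V e₁ e₂ ∧
      (∀ γ ∈ Φ.target, Φ.symm γ = sliceCoord e₁ e₂ γ) ∧
      ∀ a b t l, (a, b, t, l) ∈ Φ.source →
        (Φ (a, b, t, l)).tgt = e₁.symm (a, l * t) ∧ (Φ (a, b, t, l)).src = e₂.symm (b, t) ∧
        HasRate e₁ e₂ (Φ (a, b, t, l)) l := by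
  obtain ⟨Φ, h1, h2⟩ := h.exists_slice e₁ e₂ h₁ h₂
  have hs : ∀ a b t l, (a, b, t, l) ∈ Φ.source ↔
        l ≠ 0 ∧ (a, l * t) ∈ e₁.target ∧ (b, t) ∈ e₂.target := fun a b t l => by
    rw [h1]
    rfl
  have hΦ : ∀ a b t l, (a, b, t, l) ∈ Φ.source →
        (Φ (a, b, t, l)).tgt = e₁.symm (a, l * t) ∧ (Φ (a, b, t, l)).src = e₂.symm (b, t) ∧
        HasRate e₁ e₂ (Φ (a, b, t, l)) l := fun a b t l hq => by
    obtain ⟨ht, hs', hr⟩ := h2 a b t l hq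
    obtain ⟨-, hq1, hq2⟩ := (hs a b t l).1 hq
    have hsrc : e₂ (Φ (a, b, t, l)).src = (b, t) := by rw [hs', e₂.apply_symm_apply hq2]
    refine ⟨ht, hs', ?_, fun hV => hr ?_⟩
    · rw [ht, e₁.apply_symm_apply hq1, hsrc]
    · have := (h₂ _ (by rw [hs']; exact e₂.symm_mem_source hq2)).1 hV
      rwa [hsrc] at this
  have hmem : ∀ a b t l, (a, b, t, l) ∈ Φ.source → Φ (a, b, t, l) ∈ arrowsBetween V e₁ e₂ :=
    fun a b t l hq => by
      obtain ⟨ht, hs', -⟩ := hΦ a b t l hq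
      obtain ⟨-, hq1, hq2⟩ := (hs a b t l).1 hq
      exact ⟨by rw [ht]; exact e₁.symm_mem_source hq1, by rw [hs']; exact e₂.symm_mem_source hq2⟩
  have hcoord : ∀ a b t l, (a, b, t, l) ∈ Φ.source →
      sliceCoord e₁ e₂ (Φ (a, b, t, l)) = (a, b, t, l) := fun a b t l hq => by
    obtain ⟨ht, hs', hr⟩ := hΦ a b t l hq
    obtain ⟨-, hq1, hq2⟩ := (hs a b t l).1 hq
    have h3 := hmem a b t l hq
    rw [sliceCoord, hr.rate_eq h₁ h₂ h3.1 h3.2, ht, hs', e₁.apply_symm_apply hq1,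
      e₂.apply_symm_apply hq2]
  refine ⟨Φ, hs, Set.ext fun γ => ⟨fun hγ => ?_, fun hγ => ?_⟩, fun γ hγ => ?_, hΦ⟩
  · rw [← Φ.apply_symm_apply hγ]
    exact hmem _ _ _ _ (Φ.symm_mem_source hγ)
  · have hr := hasRate_rate h₁ h₂ hγ.1 hγ.2
    have h3 : sliceCoord e₁ e₂ γ ∈ Φ.source := by
      refine (hs _ _ _ _).2 ⟨hr.ne_zero h₁ h₂ hγ.1 hγ.2, ?_, e₂.map_mem_target hγ.2⟩
      rw [← hr.1]
      exact e₁.map_mem_target hγ.1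
    obtain ⟨ht, hs', hr'⟩ := hΦ _ _ _ _ h3
    have h4 : γ = Φ (sliceCoord e₁ e₂ γ) := by
      refine hr.arrow_ext hr' h₁ hγ.1 ?_ ?_
      · refine Eq.trans ?_ ht.symm
        rw [← hr.1]
        exact (e₁.symm_apply_apply hγ.1).symm
      · refine Eq.trans ?_ hs'.symm
        exact (e₂.symm_apply_apply hγ.2).symm
    rw [h4]
    exact Φ.map_mem_target h3
  · have := hcoord _ _ _ _ (Φ.symm_mem_source hγ)
    exact (this.symm.trans (congrArg (sliceCoord e₁ e₂) (Φ.apply_symm_apply hγ)) :)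

variable {EX HX X : Type*} [NormedAddCommGroup EX] [NormedSpace ℝ EX] [TopologicalSpace HX]
  {I : ModelWithCorners ℝ EX HX} [TopologicalSpace X] [ChartedSpace HX X]

lemma IsPuffManifold.isOpen_arrowsBetween (h : IsPuffManifold m V) (h₁ : IsSliceChart m V e₁)
    (h₂ : IsSliceChart m V e₂) : IsOpen (arrowsBetween V e₁ e₂) := by
  obtain ⟨Φ, -, h3, -⟩ := h.exists_sliceParam h₁ h₂
  rw [← h3]
  exact Φ.open_target

lemma IsPuffManifold.contMDiffOn_sliceCoord (h : IsPuffManifold m V) (h₁ : IsSliceChart m V e₁)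
    (h₂ : IsSliceChart m V e₂) :
    ContMDiffOn 𝓘(ℝ, PairSpace m) 𝓘(ℝ, SliceSpace m) ∞ (sliceCoord e₁ e₂)
      (arrowsBetween V e₁ e₂) := by
  obtain ⟨Φ, -, h3, h4, -⟩ := h.exists_sliceParam h₁ h₂
  rw [← h3]
  exact Φ.symm.contMDiffOn_toFun.congr fun γ hγ => (h4 γ hγ).symm

lemma IsPuffManifold.contMDiffOn_rate (h : IsPuffManifold m V) (h₁ : IsSliceChart m V e₁)
    (h₂ : IsSliceChart m V e₂) :
    ContMDiffOn 𝓘(ℝ, PairSpace m) 𝓘(ℝ, ℝ) ∞ (rate e₁ e₂) (arrowsBetween V e₁ e₂) :=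
  (contDiff_snd.comp (contDiff_snd.comp contDiff_snd)).contMDiff.comp_contMDiffOn
    (h.contMDiffOn_sliceCoord h₁ h₂)

lemma IsPuffManifold.contMDiff_anchor (h : IsPuffManifold m V) (hV : IsHypersurface m V) :
    ContMDiff 𝓘(ℝ, PairSpace m) ((𝓡 m).prod (𝓡 m)) ∞ (anchor m : PuffArrow m V → M × M) := by
  intro γ
  by_cases hγ : γ.src ∈ V
  · obtain ⟨e₁, ht, h₁⟩ := hV.exists_sliceChart _ (γ.mem_iff.2 hγ)
    obtain ⟨e₂, hs, h₂⟩ := hV.exists_sliceChart _ hγ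
    have hγm : γ ∈ arrowsBetween V e₁ e₂ := ⟨ht, hs⟩
    have hnhds := (h.isOpen_arrowsBetween h₁ h₂).mem_nhds hγm
    have hc := (h.contMDiffOn_sliceCoord h₁ h₂).contMDiffAt hnhds
    have hr := hasRate_rate h₁ h₂ ht hs
    have hA : ContMDiffAt 𝓘(ℝ, PairSpace m) (𝓡 m) ∞ (fun γ : PuffArrow m V => γ.tgt) γ := by
      -- The last coordinate of the range is not among the coordinates `(a, b, t, l)`; it is
      -- recovered as `l * t`.
      have h1 : ContMDiffAt 𝓘(ℝ, PairSpace m) 𝓘(ℝ, EuclideanSpace ℝ (Fin (m - 1)) × ℝ) ∞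
          (fun γ : PuffArrow m V => ((e₁ γ.tgt).1, rate e₁ e₂ γ * (e₂ γ.src).2)) γ := by
        refine ContMDiffAt.comp γ (g := fun q : SliceSpace m => (q.1, q.2.2.2 * q.2.2.1))
          (ContDiff.contMDiff ?_).contMDiffAt hc
        fun_prop
      refine (ContMDiffAt.comp γ (g := e₁.symm) (e₁.contMDiffAt_symm ?_) h1).congr_of_eventuallyEq
        ?_
      · rw [← hr.1]
        exact e₁.map_mem_target ht
      · filter_upwards [hnhds] with δ hδ
        rw [Function.comp_apply, ← (hasRate_rate h₁ h₂ hδ.1 hδ.2).1]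
        exact (e₁.symm_apply_apply hδ.1).symm
    have hB : ContMDiffAt 𝓘(ℝ, PairSpace m) (𝓡 m) ∞ (fun γ : PuffArrow m V => γ.src) γ := by
      have h1 : ContMDiffAt 𝓘(ℝ, PairSpace m) 𝓘(ℝ, EuclideanSpace ℝ (Fin (m - 1)) × ℝ) ∞
          (fun γ : PuffArrow m V => e₂ γ.src) γ := by
        refine ContMDiffAt.comp γ (g := fun q : SliceSpace m => (q.2.1, q.2.2.1))
          (ContDiff.contMDiff ?_).contMDiffAt hc
        fun_prop
      refine (ContMDiffAt.comp γ (g := e₂.symm) (e₂.contMDiffAt_symm (e₂.map_mem_target hs))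
        h1).congr_of_eventuallyEq ?_
      filter_upwards [hnhds] with δ hδ
      exact (e₂.symm_apply_apply hδ.2).symm
    exact hA.prodMk hB
  · obtain ⟨Φ, -, h3, -, h4⟩ := h.exists_complParam
    have hγm : γ ∈ Φ.target := by rw [h3]; exact hγ
    refine (Φ.contMDiffAt_symm hγm).congr_of_eventuallyEq ?_
    filter_upwards [Φ.open_target.mem_nhds hγm] with δ hδ
    exact (h4 δ hδ).symm

lemma IsPuffManifold.contMDiff_tgt (h : IsPuffManifold m V) (hV : IsHypersurface m V) :
    ContMDiff 𝓘(ℝ, PairSpace m) (𝓡 m) ∞ (PuffArrow.tgt : PuffArrow m V → M) :=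
  contMDiff_fst.comp (h.contMDiff_anchor hV)

lemma IsPuffManifold.contMDiff_src (h : IsPuffManifold m V) (hV : IsHypersurface m V) :
    ContMDiff 𝓘(ℝ, PairSpace m) (𝓡 m) ∞ (PuffArrow.src : PuffArrow m V → M) :=
  contMDiff_snd.comp (h.contMDiff_anchor hV)

/-- Off the hypersurface, a map to the puff is smooth if its range and source are. -/
lemma IsPuffManifold.contMDiffWithinAt_of_notMem (h : IsPuffManifold m V)
    (hV : IsClosed V) {f : X → PuffArrow m V} {s : Set X} {x : X} (hx : (f x).src ∉ V)
    (hf : ContMDiffWithinAt I ((𝓡 m).prod (𝓡 m)) ∞ (fun z => anchor m (f z)) s x) :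
    ContMDiffWithinAt I 𝓘(ℝ, PairSpace m) ∞ f s x := by
  obtain ⟨Φ, h1, -, h2, -⟩ := h.exists_complParam
  have hmem : ∀ γ : PuffArrow m V, γ.src ∉ V → anchor m γ ∈ Vᶜ ×ˢ Vᶜ := fun γ hγ =>
    ⟨fun h => hγ (γ.mem_iff.1 h), hγ⟩
  have hΦ : ∀ γ : PuffArrow m V, γ.src ∉ V → γ = Φ (anchor m γ) := fun γ hγ =>
    PuffArrow.ext_of_notMem m (congrArg Prod.fst (h2 _ (hmem γ hγ))).symm
      (congrArg Prod.snd (h2 _ (hmem γ hγ))).symm (hmem γ hγ).1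
  refine ((Φ.contMDiffAt (h1 ▸ hmem _ hx)).comp_contMDiffWithinAt x hf).congr_of_eventuallyEq
    ?_ (hΦ _ hx)
  have : ∀ᶠ z in 𝓝[s] x, anchor m (f z) ∈ univ ×ˢ Vᶜ :=
    hf.continuousWithinAt.eventually ((isOpen_univ.prod hV.isOpen_compl).mem_nhds ⟨trivial, hx⟩)
  filter_upwards [this] with z hz
  exact hΦ _ hz.2

/-- A map to the puff is smooth if its range, its source and its rate are. -/
lemma IsPuffManifold.contMDiffWithinAt_of_rate (h : IsPuffManifold m V)
    (h₁ : IsSliceChart m V e₁) (h₂ : IsSliceChart m V e₂) {f : X → PuffArrow m V} {s : Set X}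
    {x : X} (hx : f x ∈ arrowsBetween V e₁ e₂)
    (hf : ContMDiffWithinAt I ((𝓡 m).prod (𝓡 m)) ∞ (fun z => anchor m (f z)) s x)
    (hr : ContMDiffWithinAt I 𝓘(ℝ, ℝ) ∞ (fun z => rate e₁ e₂ (f z)) s x) :
    ContMDiffWithinAt I 𝓘(ℝ, PairSpace m) ∞ f s x := by
  obtain ⟨Φ, -, h3, h4, -⟩ := h.exists_sliceParam h₁ h₂
  have ht : ContMDiffWithinAt I (𝓡 m) ∞ (fun z => (f z).tgt) s x :=
    contMDiff_fst.contMDiffAt.comp_contMDiffWithinAt x hf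
  have hs : ContMDiffWithinAt I (𝓡 m) ∞ (fun z => (f z).src) s x :=
    contMDiff_snd.contMDiffAt.comp_contMDiffWithinAt x hf
  have hc : ContMDiffWithinAt I 𝓘(ℝ, SliceSpace m) ∞ (fun z => sliceCoord e₁ e₂ (f z)) s x := by
    have h5 : ContMDiffWithinAt I _ ∞ (fun z => e₁ (f z).tgt) s x :=
      (e₁.contMDiffAt hx.1).comp_contMDiffWithinAt x ht
    have h6 : ContMDiffWithinAt I _ ∞ (fun z => e₂ (f z).src) s x :=
      (e₂.contMDiffAt hx.2).comp_contMDiffWithinAt x hs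
    exact (contDiff_fst.contMDiff.contMDiffAt.comp_contMDiffWithinAt x h5).prodMk_space
      ((contDiff_fst.contMDiff.contMDiffAt.comp_contMDiffWithinAt x h6).prodMk_space
        ((contDiff_snd.contMDiff.contMDiffAt.comp_contMDiffWithinAt x h6).prodMk_space hr))
  have hΦ : ∀ γ ∈ arrowsBetween V e₁ e₂, γ = Φ (sliceCoord e₁ e₂ γ) := fun γ hγ => by
    rw [← h4 γ (h3 ▸ hγ), Φ.apply_symm_apply (h3 ▸ hγ)]
  have hsrc : sliceCoord e₁ e₂ (f x) ∈ Φ.source := by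
    rw [← h4 _ (h3 ▸ hx)]
    exact Φ.symm_mem_source (h3 ▸ hx)
  refine ((Φ.contMDiffAt hsrc).comp_contMDiffWithinAt x hc).congr_of_eventuallyEq ?_ (hΦ _ hx)
  filter_upwards [ht.continuousWithinAt.eventually (e₁.open_source.mem_nhds hx.1),
    hs.continuousWithinAt.eventually (e₂.open_source.mem_nhds hx.2)] with z hz hz'
  exact hΦ _ ⟨hz, hz'⟩

/-- Arrows with distinct anchors are separated in `M × M`. Distinct arrows with the same anchor lie
over `V`, hence in the target of one slice parametrisation, where they are separated by their
coordinates. -/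
lemma IsPuffManifold.t2Space [T2Space M] (h : IsPuffManifold m V) (hV : IsHypersurface m V) :
    T2Space (PuffArrow m V) := by
  refine ⟨fun γ δ hne => ?_⟩
  by_cases ha : anchor m γ = anchor m δ
  · have ht : γ.tgt = δ.tgt := congrArg Prod.fst ha
    have hs : γ.src = δ.src := congrArg Prod.snd ha
    have hγ : γ.src ∈ V := by
      by_contra hγ
      exact hne (PuffArrow.ext_of_notMem m ht hs fun h => hγ (γ.mem_iff.1 h))
    obtain ⟨e₁, ht₁, h₁⟩ := hV.exists_sliceChart _ (γ.mem_iff.2 hγ)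
    obtain ⟨e₂, hs₂, h₂⟩ := hV.exists_sliceChart _ hγ
    obtain ⟨Φ, -, h3, -, -⟩ := h.exists_sliceParam h₁ h₂
    have hγm : γ ∈ Φ.target := h3 ▸ ⟨ht₁, hs₂⟩
    have hδm : δ ∈ Φ.target := h3 ▸ ⟨ht ▸ ht₁, hs ▸ hs₂⟩
    have hne' : Φ.symm γ ≠ Φ.symm δ := fun h =>
      hne ((Φ.apply_symm_apply hγm).symm.trans ((congrArg Φ h).trans (Φ.apply_symm_apply hδm)))
    obtain ⟨u, v, hu, hv, hγu, hδv, huv⟩ := t2_separation hne'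
    have hc := Φ.symm.contMDiffOn_toFun.continuousOn
    exact ⟨_, _, hc.isOpen_inter_preimage Φ.open_target hu,
      hc.isOpen_inter_preimage Φ.open_target hv, ⟨hγm, hγu⟩, ⟨hδm, hδv⟩,
      (huv.preimage _).mono inter_subset_right inter_subset_right⟩
  · exact separated_by_continuous (h.contMDiff_anchor hV).continuous ha

lemma PartialDiffeomorph.secondCountableTopology_target {EY HY Y : Type*} [NormedAddCommGroup EY]
    [NormedSpace ℝ EY] [TopologicalSpace HY] {J : ModelWithCorners ℝ EY HY} [TopologicalSpace Y]
    [ChartedSpace HY Y] [SecondCountableTopology X] (Φ : PartialDiffeomorph I J X Y ∞) :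
    SecondCountableTopology Φ.target :=
  Φ.toOpenPartialHomeomorph.toHomeomorphSourceTarget.symm.secondCountableTopology

/-- Countably many straightening charts cover `V`. The arrows off `V` and the arrows between two of
these charts form a countable open cover, each member being homeomorphic to a subspace of `M × M` or
of a vector space. -/
lemma IsPuffManifold.secondCountableTopology [SecondCountableTopology M] (h : IsPuffManifold m V)
    (hV : IsHypersurface m V) : SecondCountableTopology (PuffArrow m V) := by
  choose e he he' using hV.exists_sliceChart
  obtain ⟨t, htV, htc, ht⟩ := TopologicalSpace.countable_cover_nhdsWithin (s := V)
    (f := fun x => {y | ∃ hx : x ∈ V, y ∈ (e x hx).source}) (fun x hx => by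
      refine mem_nhdsWithin_of_mem_nhds ?_
      filter_upwards [(e x hx).open_source.mem_nhds (he x hx)] with y hy
      exact ⟨hx, hy⟩)
  have := htc.to_subtype
  let U : Option (t × t) → Set (PuffArrow m V) := fun k =>
    k.elim {γ | γ.src ∉ V} fun p => arrowsBetween V (e p.1 (htV p.1.2)) (e p.2 (htV p.2.2))
  have hU : ∀ k, IsOpen (U k) ∧ SecondCountableTopology (U k) := by
    rintro (_ | p)
    · obtain ⟨Φ, -, h3, -, -⟩ := h.exists_complParam
      change IsOpen {γ : PuffArrow m V | γ.src ∉ V} ∧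
        SecondCountableTopology {γ : PuffArrow m V | γ.src ∉ V}
      rw [← h3]
      exact ⟨Φ.open_target, Φ.secondCountableTopology_target⟩
    · obtain ⟨Φ, -, h3, -, -⟩ :=
        h.exists_sliceParam (he' p.1 (htV p.1.2)) (he' p.2 (htV p.2.2))
      change IsOpen (arrowsBetween V (e p.1 (htV p.1.2)) (e p.2 (htV p.2.2))) ∧
        SecondCountableTopology (arrowsBetween V (e p.1 (htV p.1.2)) (e p.2 (htV p.2.2)))
      rw [← h3]
      exact ⟨Φ.open_target, Φ.secondCountableTopology_target⟩
  have := fun k => (hU k).2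
  refine TopologicalSpace.secondCountableTopology_of_countable_cover (fun k => (hU k).1)
    (eq_univ_of_forall fun γ => mem_iUnion.2 ?_)
  by_cases hγ : γ.src ∈ V
  · obtain ⟨a, ha, _, ha'⟩ := mem_iUnion₂.1 (ht (γ.mem_iff.2 hγ))
    obtain ⟨b, hb, _, hb'⟩ := mem_iUnion₂.1 (ht hγ)
    exact ⟨some (⟨a, ha⟩, ⟨b, hb⟩), ha', hb'⟩
  · exact ⟨none, hγ⟩

/-- In a groupoid with smooth inversion whose source map has smooth local sections, the source
and range maps are submersions. -/
lemma isSubmersion_of_local_sections {EM HM EG HG G : Type*} {M : Type*}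
    [NormedAddCommGroup EM] [NormedSpace ℝ EM] [TopologicalSpace HM]
    [NormedAddCommGroup EG] [NormedSpace ℝ EG] [TopologicalSpace HG]
    {I : ModelWithCorners ℝ EM HM} {J : ModelWithCorners ℝ EG HG} [I.Boundaryless] [J.Boundaryless]
    [FiniteDimensional ℝ EM] [FiniteDimensional ℝ EG]
    [TopologicalSpace M] [ChartedSpace HM M] [TopologicalSpace G] [ChartedSpace HG G]
    [IsManifold I ∞ M] [IsManifold J ∞ G] (𝒢 : GroupoidOver M G)
    (hsrc : ContMDiff J I ∞ 𝒢.src) (hinv : ContMDiff J J ∞ 𝒢.inv)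
    (hinvinv : ∀ g, 𝒢.inv (𝒢.inv g) = g)
    (h : ∀ g, ∃ σ : M → G, ContMDiffAt I J ∞ σ (𝒢.src g) ∧ σ (𝒢.src g) = g ∧
      ∀ᶠ y in 𝓝 (𝒢.src g), 𝒢.src (σ y) = y) :
    Manifold.IsSubmersion J I ∞ 𝒢.tgt ∧ Manifold.IsSubmersion J I ∞ 𝒢.src := by
  -- Inversion turns a section of the source through `g⁻¹` into a section of the range through `g`.
  have ht : 𝒢.tgt = 𝒢.src ∘ 𝒢.inv := funext fun g => (𝒢.src_inv g).symm
  constructor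
  · refine Manifold.IsSubmersionOfComplement.isSubmersion (F := CodimSpace EG EM) fun g => ?_
    obtain ⟨σ, h1, h2, h3⟩ := h (𝒢.inv g)
    rw [𝒢.src_inv] at h1 h2 h3
    refine isSubmersionAtOfComplement_of_local_section (s := 𝒢.inv ∘ σ) ?_
      (hinv.contMDiffAt.comp _ h1) ?_ ?_
    · rw [ht]
      exact hsrc.comp hinv
    · rw [Function.comp_apply, h2, hinvinv]
    · filter_upwards [h3] with y hy
      rw [Function.comp_apply, 𝒢.tgt_inv, hy]
  · refine Manifold.IsSubmersionOfComplement.isSubmersion (F := CodimSpace EG EM) fun g => ?_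
    obtain ⟨σ, h1, h2, h3⟩ := h g
    exact isSubmersionAtOfComplement_of_local_section hsrc h1 h2 h3

/-- The source map of the puff of a hypersurface has smooth local sections. -/
lemma IsPuffManifold.exists_local_section (h : IsPuffManifold m V) (hV : IsHypersurface m V)
    (γ : PuffArrow m V) : ∃ σ : M → PuffArrow m V,
      ContMDiffAt (𝓡 m) 𝓘(ℝ, PairSpace m) ∞ σ γ.src ∧ σ γ.src = γ ∧
      ∀ᶠ y in 𝓝 γ.src, (σ y).src = y := by
  by_cases hγ : γ.src ∈ V
  · obtain ⟨e₁, ht, h₁⟩ := hV.exists_sliceChart _ (γ.mem_iff.2 hγ)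
    obtain ⟨e₂, hs, h₂⟩ := hV.exists_sliceChart _ hγ
    obtain ⟨Φ, h3, h4, h5, h6⟩ := h.exists_sliceParam h₁ h₂
    have hγm : γ ∈ Φ.target := h4 ▸ ⟨ht, hs⟩
    -- The coordinates `a` and `l` remain those of `γ` while the source varies. The range moves too,
    -- its last coordinate being `l * t`.
    let c : M → SliceSpace m := fun y =>
      ((e₁ γ.tgt).1, (e₂ y).1, (e₂ y).2, rate e₁ e₂ γ)
    have hc : ContMDiffAt (𝓡 m) 𝓘(ℝ, SliceSpace m) ∞ c γ.src := by
      refine ContMDiffAt.comp γ.src (g := fun q : EuclideanSpace ℝ (Fin (m - 1)) × ℝ =>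
        (((e₁ γ.tgt).1, q.1, q.2, rate e₁ e₂ γ) : SliceSpace m))
        (ContDiff.contMDiff ?_).contMDiffAt (e₂.contMDiffAt hs)
      fun_prop
    have hcγ : c γ.src = Φ.symm γ := (h5 γ hγm).symm
    have hcs : c γ.src ∈ Φ.source := hcγ ▸ Φ.symm_mem_source hγm
    refine ⟨Φ ∘ c, (Φ.contMDiffAt hcs).comp _ hc, ?_, ?_⟩
    · rw [Function.comp_apply, hcγ, Φ.apply_symm_apply hγm]
    · filter_upwards [hc.continuousAt.eventually (Φ.open_source.mem_nhds hcs),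
        e₂.open_source.mem_nhds hs] with y hy hy'
      exact (h6 _ _ _ _ hy).2.1.trans (e₂.symm_apply_apply hy')
  · obtain ⟨Φ, h3, h4, h5, h6⟩ := h.exists_complParam
    have hp : (γ.tgt, γ.src) ∈ Vᶜ ×ˢ Vᶜ := ⟨fun h => hγ (γ.mem_iff.1 h), hγ⟩
    refine ⟨fun y => Φ (γ.tgt, y), ?_, ?_, ?_⟩
    · exact ContMDiffAt.comp γ.src (g := Φ) (f := fun y => (γ.tgt, y))
        (Φ.contMDiffAt (h3 ▸ hp)) (contMDiffAt_const.prodMk contMDiffAt_id)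
    · have hγm : γ ∈ Φ.target := h4 ▸ hγ
      change Φ (anchor m γ) = γ
      rw [← h6 γ hγm, Φ.apply_symm_apply hγm]
    · filter_upwards [hV.isClosed.isOpen_compl.mem_nhds hγ] with y hy
      exact congrArg Prod.snd (h5 (γ.tgt, y) ⟨hp.1, hy⟩)

lemma IsPuffManifold.contMDiff_unit (h : IsPuffManifold m V) (hV : IsHypersurface m V) :
    ContMDiff (𝓡 m) 𝓘(ℝ, PairSpace m) ∞ (puffArrowGroupoid m V).unit := by
  intro x
  have ha : ContMDiffAt (𝓡 m) ((𝓡 m).prod (𝓡 m)) ∞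
      (fun z : M => anchor m ((puffArrowGroupoid m V).unit z)) x :=
    contMDiffAt_id.prodMk contMDiffAt_id
  by_cases hx : x ∈ V
  · obtain ⟨e, he, he'⟩ := hV.exists_sliceChart x hx
    -- With the same chart at range and source, the rate of a unit is constantly `1`.
    refine h.contMDiffWithinAt_of_rate he' he' ⟨he, he⟩ ha ?_
    refine ContMDiffAt.congr_of_eventuallyEq (contMDiffAt_const (c := (1 : ℝ))) ?_
    filter_upwards [e.open_source.mem_nhds he] with z hz
    exact (hasRate_unit he' hz).rate_eq he' he' hz hz
  · exact h.contMDiffWithinAt_of_notMem hV.isClosed hx ha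

lemma IsPuffManifold.contMDiff_inv (h : IsPuffManifold m V) (hV : IsHypersurface m V) :
    ContMDiff 𝓘(ℝ, PairSpace m) 𝓘(ℝ, PairSpace m) ∞ (puffArrowGroupoid m V).inv := by
  intro γ
  have ha : ContMDiffAt 𝓘(ℝ, PairSpace m) ((𝓡 m).prod (𝓡 m)) ∞
      (fun γ : PuffArrow m V => anchor m ((puffArrowGroupoid m V).inv γ)) γ :=
    (h.contMDiff_src hV γ).prodMk (h.contMDiff_tgt hV γ)
  by_cases hγ : γ.src ∈ V
  · obtain ⟨e₁, ht, h₁⟩ := hV.exists_sliceChart _ (γ.mem_iff.2 hγ)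
    obtain ⟨e₂, hs, h₂⟩ := hV.exists_sliceChart _ hγ
    have hnhds := (h.isOpen_arrowsBetween h₁ h₂).mem_nhds (show γ ∈ arrowsBetween V e₁ e₂ from
      ⟨ht, hs⟩)
    refine h.contMDiffWithinAt_of_rate h₂ h₁ ⟨hs, ht⟩ ha ?_
    have h0 := (hasRate_rate h₁ h₂ ht hs).ne_zero h₁ h₂ ht hs
    refine ContMDiffAt.congr_of_eventuallyEq (ContMDiffAt.comp γ (g := fun l : ℝ => l⁻¹)
      (contDiffAt_inv ℝ h0).contMDiffAt ((h.contMDiffOn_rate h₁ h₂).contMDiffAt hnhds)) ?_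
    filter_upwards [hnhds] with δ hδ
    have hr := hasRate_rate h₁ h₂ hδ.1 hδ.2
    exact (hr.inv (hr.ne_zero h₁ h₂ hδ.1 hδ.2)).rate_eq h₂ h₁ hδ.2 hδ.1
  · exact h.contMDiffWithinAt_of_notMem hV.isClosed (fun h => hγ (γ.mem_iff.1 h)) ha

lemma IsPuffManifold.contMDiffOn_puffMul (h : IsPuffManifold m V) (hV : IsHypersurface m V) :
    ContMDiffOn (𝓘(ℝ, PairSpace m).prod 𝓘(ℝ, PairSpace m)) 𝓘(ℝ, PairSpace m) ∞ puffMul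
      {p : PuffArrow m V × PuffArrow m V | p.1.src = p.2.tgt} := by
  rintro ⟨γ, δ⟩ hp
  change γ.src = δ.tgt at hp
  have ha : ContMDiffWithinAt (𝓘(ℝ, PairSpace m).prod 𝓘(ℝ, PairSpace m)) ((𝓡 m).prod (𝓡 m)) ∞
      (fun p : PuffArrow m V × PuffArrow m V => anchor m (puffMul p))
      {p | p.1.src = p.2.tgt} (γ, δ) := by
    refine ContMDiffWithinAt.congr (f := fun p => (p.1.tgt, p.2.src))
      (((h.contMDiff_tgt hV).comp contMDiff_fst).prodMk
        ((h.contMDiff_src hV).comp contMDiff_snd)).contMDiffAt.contMDiffWithinAt ?_ ?_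
    · rintro ⟨γ', δ'⟩ hp'
      rw [puffMul_eq _ _ hp']
      rfl
    · rw [puffMul_eq _ _ hp]
      rfl
  have hsrc : (puffMul (γ, δ)).src = δ.src := by
    rw [puffMul_eq _ _ hp]
    rfl
  have htgt : (puffMul (γ, δ)).tgt = γ.tgt := by
    rw [puffMul_eq _ _ hp]
    rfl
  by_cases hδ : δ.src ∈ V
  · have hδ' : δ.tgt ∈ V := δ.mem_iff.2 hδ
    obtain ⟨e₁, hs₁, h₁⟩ := hV.exists_sliceChart γ.tgt (γ.mem_iff.2 (hp ▸ hδ'))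
    -- A common chart at the middle point, as multiplicativity of rates requires.
    obtain ⟨e₂, hs₂, h₂⟩ := hV.exists_sliceChart _ hδ'
    obtain ⟨e₃, hs₃, h₃⟩ := hV.exists_sliceChart _ hδ
    have hγm : γ ∈ arrowsBetween V e₁ e₂ := ⟨hs₁, by rwa [hp]⟩
    have hδm : δ ∈ arrowsBetween V e₂ e₃ := ⟨hs₂, hs₃⟩
    have hnhds : ∀ᶠ p in 𝓝 (γ, δ), p.1 ∈ arrowsBetween V e₁ e₂ ∧ p.2 ∈ arrowsBetween V e₂ e₃ :=
      prod_mem_nhds ((h.isOpen_arrowsBetween h₁ h₂).mem_nhds hγm)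
        ((h.isOpen_arrowsBetween h₂ h₃).mem_nhds hδm)
    refine h.contMDiffWithinAt_of_rate h₁ h₃
      ⟨by rw [htgt]; exact hs₁, by rw [hsrc]; exact hs₃⟩ ha ?_
    have hr₁ : ContMDiffAt (𝓘(ℝ, PairSpace m).prod 𝓘(ℝ, PairSpace m)) 𝓘(ℝ, ℝ) ∞
        (fun p : PuffArrow m V × PuffArrow m V => rate e₁ e₂ p.1) (γ, δ) :=
      ContMDiffAt.comp (γ, δ) (g := rate e₁ e₂) ((h.contMDiffOn_rate h₁ h₂).contMDiffAt
        ((h.isOpen_arrowsBetween h₁ h₂).mem_nhds hγm)) contMDiffAt_fst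
    have hr₂ : ContMDiffAt (𝓘(ℝ, PairSpace m).prod 𝓘(ℝ, PairSpace m)) 𝓘(ℝ, ℝ) ∞
        (fun p : PuffArrow m V × PuffArrow m V => rate e₂ e₃ p.2) (γ, δ) :=
      ContMDiffAt.comp (γ, δ) (g := rate e₂ e₃) ((h.contMDiffOn_rate h₂ h₃).contMDiffAt
        ((h.isOpen_arrowsBetween h₂ h₃).mem_nhds hδm)) contMDiffAt_snd
    have key : ∀ p : PuffArrow m V × PuffArrow m V, p.1.src = p.2.tgt →
        p.1 ∈ arrowsBetween V e₁ e₂ ∧ p.2 ∈ arrowsBetween V e₂ e₃ →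
        rate e₁ e₃ (puffMul p) = rate e₁ e₂ p.1 * rate e₂ e₃ p.2 := by
      rintro ⟨γ', δ'⟩ hp' ⟨h5, h6⟩
      rw [puffMul_eq _ _ hp']
      exact ((hasRate_rate h₁ h₂ h5.1 h5.2).mul (hasRate_rate h₂ h₃ h6.1 h6.2) hp').rate_eq h₁ h₃
        h5.1 h6.2
    refine (hr₁.mul hr₂).contMDiffWithinAt.congr_of_eventuallyEq ?_ (key _ hp ⟨hγm, hδm⟩)
    filter_upwards [self_mem_nhdsWithin, mem_nhdsWithin_of_mem_nhds hnhds] with p hp1 hp2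
    exact key p hp1 hp2
  · exact h.contMDiffWithinAt_of_notMem hV.isClosed (by rw [hsrc]; exact hδ) ha

theorem IsPuffManifold.isLieGroupoid [IsManifold (𝓡 m) ∞ M]
    (h : IsPuffManifold m V) (hV : IsHypersurface m V) :
    IsLieGroupoid (𝓡 m) 𝓘(ℝ, PairSpace m) (puffArrowGroupoid m V) := by
  have := h.isManifold
  obtain ⟨h1, h2⟩ := isSubmersion_of_local_sections (puffArrowGroupoid m V)
    (h.contMDiff_src hV) (h.contMDiff_inv hV) (fun _ => rfl) (h.exists_local_section hV)
  exact ⟨inferInstance, h.isManifold, h1, h2, h.contMDiff_unit hV, h.contMDiff_inv hV,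
    puffMul, puffMul_eq, h.contMDiffOn_puffMul hV⟩

end PuffManifold

/-! ### Division of smooth functions by a coordinate -/

section Division

open MeasureTheory

variable {P : Type*} [NormedAddCommGroup P] [NormedSpace ℝ P]

/-- Integrals over a compact interval depend smoothly on parameters. -/
lemma ContDiff.integral_Icc_zero_one {D : P × ℝ → ℝ} (hD : ContDiff ℝ ∞ D) :
    ContDiff ℝ ∞ fun p => ∫ s in Icc (0 : ℝ) 1, D (p, s) := by
  -- The integral is the value at `0` of the convolution of the indicator of `[0, 1]` with `s ↦ χ s
  -- * D (p, -s)`. The cutoff `χ` provides the compact support and equals `1` on `[-1, 1]`, so it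
  -- does not alter the integral.
  let χ : ContDiffBump (0 : ℝ) := ⟨1, 2, one_pos, one_lt_two⟩
  let g : P → ℝ → ℝ := fun p s => χ s * D (p, -s)
  have hg : ContDiff ℝ ∞ (fun q : P × ℝ => g q.1 q.2) :=
    (χ.contDiff.comp contDiff_snd).mul (hD.comp (contDiff_fst.prodMk contDiff_snd.neg))
  have h := contDiffOn_convolution_right_with_param (μ := volume) (n := (⊤ : ℕ∞))
    (f := indicator (Icc (0 : ℝ) 1) fun _ => (1 : ℝ)) (ContinuousLinearMap.mul ℝ ℝ) (g := g)
    (s := univ) (k := Metric.closedBall (0 : ℝ) 2) isOpen_univ (isCompact_closedBall 0 2)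
    (fun p s _ hs => by
      have : χ s = 0 := χ.zero_of_le_dist (le_of_lt (not_le.1 hs))
      simp only [g, this, zero_mul])
    ((integrable_indicator_iff measurableSet_Icc).2
      (integrableOn_const (by simp))).locallyIntegrable hg.contDiffOn
  rw [univ_prod_univ, contDiffOn_univ] at h
  refine (congrArg (ContDiff ℝ ∞) (funext fun p => ?_)).mp
    (h.comp (contDiff_id.prodMk (contDiff_const (c := (0 : ℝ)))))
  simp only [Function.comp_apply, MeasureTheory.convolution, ContinuousLinearMap.mul_apply', id]
  rw [← integral_indicator measurableSet_Icc]
  congr 1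
  ext s
  by_cases hs : s ∈ Icc (0 : ℝ) 1
  · have : χ (0 - s) = 1 := χ.one_of_mem_closedBall (by
      simpa [abs_of_nonneg hs.1, χ] using hs.2)
    simp only [indicator_of_mem hs, g, this]
    simp
  · simp [indicator_of_notMem hs]

/-- **Hadamard's lemma**: a smooth function that vanishes where a coordinate vanishes is divisible
by this coordinate. -/
lemma exists_contDiff_eq_mul {F : P × ℝ → ℝ} (hF : ContDiff ℝ ∞ F) (h0 : ∀ a, F (a, 0) = 0) :
    ∃ H : P × ℝ → ℝ, ContDiff ℝ ∞ H ∧ ∀ p, F p = H p * p.2 := by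
  let D : P × ℝ → ℝ := fun p => fderiv ℝ F p (0, 1)
  have hD : ContDiff ℝ ∞ D := (hF.fderiv_right (by simp)).clm_apply contDiff_const
  -- The quotient is the mean of the partial derivative along the segment from `(a, 0)` to `(a, t)`,
  -- by the fundamental theorem of calculus for `s ↦ F (a, s * t)`.
  refine ⟨fun p => ∫ s in Icc (0 : ℝ) 1, D (p.1, s * p.2),
    ContDiff.integral_Icc_zero_one (P := P × ℝ) (D := fun q => D (q.1.1, q.2 * q.1.2))
      (hD.comp (by fun_prop)), fun ⟨a, t⟩ => ?_⟩
  have hd : ∀ s ∈ uIcc (0 : ℝ) 1, HasDerivAt (fun s => F (a, s * t)) (D (a, s * t) * t) s := by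
    intro s _
    have h1 : HasFDerivAt F (fderiv ℝ F (a, s * t)) (a, s * t) :=
      (hF.differentiable (by simp) _).hasFDerivAt
    have h2 : HasDerivAt (fun s : ℝ => (a, s * t)) ((0 : P), t) s :=
      (hasDerivAt_const s a).prodMk (by simpa using (hasDerivAt_id s).mul_const t)
    have h3 := h1.comp_hasDerivAt s h2
    have h4 : ((0 : P), t) = t • ((0 : P), (1 : ℝ)) := by simp
    rw [h4, map_smul, smul_eq_mul, mul_comm] at h3
    exact h3
  have hc : Continuous fun s => D (a, s * t) * t :=
    (hD.continuous.comp (by fun_prop)).mul continuous_const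
  have := intervalIntegral.integral_eq_sub_of_hasDerivAt hd (hc.intervalIntegrable 0 1)
  rw [intervalIntegral.integral_mul_const, zero_mul, one_mul, h0, sub_zero,
    intervalIntegral.integral_of_le zero_le_one, ← integral_Icc_eq_integral_Ioc] at this
  exact this.symm

/-- Local form of Hadamard's lemma. -/
lemma exists_contDiff_eventually_eq_mul [FiniteDimensional ℝ P] {F : P × ℝ → ℝ} {U : Set (P × ℝ)}
    (hU : IsOpen U) (hF : ContDiffOn ℝ ∞ F U) (h0 : ∀ a, (a, 0) ∈ U → F (a, 0) = 0) {p : P × ℝ}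
    (hp : p ∈ U) : ∃ H : P × ℝ → ℝ, ContDiff ℝ ∞ H ∧ ∀ᶠ q in 𝓝 p, F q = H q * q.2 := by
  have : HasContDiffBump (P × ℝ) := inferInstance
  obtain ⟨ε, hε, hεU⟩ := Metric.isOpen_iff.1 hU p hp
  -- The product `χ * F` is smooth everywhere, still vanishes where the coordinate does, and agrees
  -- with `F` near `p`.
  let χ : ContDiffBump p := ⟨ε / 4, ε / 2, by positivity, by linarith⟩
  have hs : tsupport χ ⊆ U := by
    rw [χ.tsupport_eq]
    exact (Metric.closedBall_subset_ball (by change ε / 2 < ε; linarith)).trans hεU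
  have h1 : ContDiff ℝ ∞ fun q => χ q * F q := by
    refine contDiff_iff_contDiffAt.2 fun q => ?_
    by_cases hq : q ∈ tsupport χ
    · exact χ.contDiff.contDiffAt.mul (hF.contDiffAt (hU.mem_nhds (hs hq)))
    · refine (contDiffAt_const (c := (0 : ℝ))).congr_of_eventuallyEq ?_
      filter_upwards [notMem_tsupport_iff_eventuallyEq.1 hq] with z hz
      rw [hz, Pi.zero_apply, zero_mul]
  obtain ⟨H, hH, hH'⟩ := exists_contDiff_eq_mul h1 fun a => by
    by_cases ha : (a, (0 : ℝ)) ∈ tsupport χ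
    · rw [h0 a (hs ha), mul_zero]
    · rw [image_eq_zero_of_notMem_tsupport ha, zero_mul]
  refine ⟨H, hH, ?_⟩
  filter_upwards [χ.eventuallyEq_one] with q hq
  have := hH' q
  rwa [hq, Pi.one_apply, one_mul] at this

end Division

/-! ### Smooth dependence of rates on the straightening charts. -/

section ChangeOfCharts

variable {m : ℕ} {M : Type*} [TopologicalSpace M] [ChartedSpace (EuclideanSpace ℝ (Fin m)) M]
  {V : Set M} {e e₁ e₂ e₁' e₂' : StraightChart m M} {x : M}

/-- The rates of the units with respect to two straightening charts are smooth functions. -/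
lemma contMDiffAt_rate_unit (he : IsSliceChart m V e₁) (he' : IsSliceChart m V e₂)
    (hx : x ∈ e₁.source) (hx' : x ∈ e₂.source) :
    ContMDiffAt (𝓡 m) 𝓘(ℝ, ℝ) ∞
      (fun z => rate e₁ e₂ ((puffArrowGroupoid m V).unit z)) x := by
  let U : Set (EuclideanSpace ℝ (Fin (m - 1)) × ℝ) := e₂.target ∩ e₂.symm ⁻¹' e₁.source
  have hU : IsOpen U :=
    e₂.symm.contMDiffOn_toFun.continuousOn.isOpen_inter_preimage e₂.open_target e₁.open_source
  -- In the chart `e₂`, the last coordinate of `e₁` vanishes where that of `e₂` does, as both vanish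
  -- exactly on `V`. The smooth quotient `H` is the rate of the units, also on `V`.
  obtain ⟨H, hH, hHe⟩ := exists_contDiff_eventually_eq_mul (p := e₂ x)
    (F := fun p => (e₁ (e₂.symm p)).2) hU
    (contMDiffOn_iff_contDiffOn.1 ((contMDiffOn_lastCoord e₁).comp
      (e₂.symm.contMDiffOn_toFun.mono inter_subset_left) fun _ h => h.2))
    (fun a ha => (he _ ha.2).1 ((he' _ (e₂.symm_mem_source ha.1)).2 (by
      rw [e₂.apply_symm_apply ha.1])))
    ⟨e₂.map_mem_target hx', by rw [mem_preimage, e₂.symm_apply_apply hx']; exact hx⟩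
  have hev : ∀ᶠ z in 𝓝 x, (e₁ z).2 = H (e₂ z) * (e₂ z).2 := by
    filter_upwards [(e₂.contMDiffAt hx').continuousAt.eventually hHe,
      e₂.open_source.mem_nhds hx'] with z hz hz'
    rwa [e₂.symm_apply_apply hz'] at hz
  refine (hH.contMDiff.contMDiffAt.comp x (e₂.contMDiffAt hx')).congr_of_eventuallyEq ?_
  filter_upwards [hev.eventually_nhds, e₁.open_source.mem_nhds hx, e₂.open_source.mem_nhds hx']
    with z hz hz₁ hz₂
  refine HasRate.rate_eq ⟨hz.self_of_nhds, fun hV v w hvw => ?_⟩ he he' hz₁ hz₂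
  have hvw' : lastCoordDeriv m e₂ z v = lastCoordDeriv m e₂ z w :=
    (he'.mk_eq_mk_iff hz₂ hV).1 hvw
  have h0 : (e₂ z).2 = 0 := (he' z hz₂).1 hV
  -- On `V` the last coordinate is `0`, so the product rule leaves only `H` times the differential
  -- of the last coordinate: the normal dilation rate is `H`.
  have hd : HasFDerivAt (fun p : EuclideanSpace ℝ (Fin (m - 1)) × ℝ => H p * p.2)
      (H (e₂ z) • ContinuousLinearMap.snd ℝ (EuclideanSpace ℝ (Fin (m - 1))) ℝ) (e₂ z) := by
    refine (((hH.differentiable (by simp) (e₂ z)).hasFDerivAt).mul hasFDerivAt_snd).congr_fderiv ?_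
    rw [h0, zero_smul, add_zero]
  have h1 := mfderiv_comp (I'' := 𝓘(ℝ, ℝ)) z hd.differentiableAt.mdifferentiableAt
    ((e₂.contMDiffAt hz₂).mdifferentiableAt (by simp))
  rw [mfderiv_eq_fderiv, hd.fderiv] at h1
  have h2 : mfderiv (𝓡 m) 𝓘(ℝ, ℝ) (fun y => (e₁ y).2) z = _ := (EventuallyEq.mfderiv_eq hz).trans h1
  refine (congrArg (fun A => (A w : ℝ)) h2).trans ?_
  change H (e₂ z) * (mfderiv (𝓡 m) 𝓘(ℝ, EuclideanSpace ℝ (Fin (m - 1)) × ℝ) e₂ z w :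
        EuclideanSpace ℝ (Fin (m - 1)) × ℝ).2 = H (e₂ z) * lastCoordDeriv m e₂ z v
  exact (congrArg (H (e₂ z) * ·) (hvw'.trans (lastCoordDeriv_eq_snd hz₂ w))).symm

/-- The effect on rates of a change of charts. -/
lemma rate_eq_rate_mul {γ : PuffArrow m V} (h₁ : IsSliceChart m V e₁) (h₂ : IsSliceChart m V e₂)
    (h₁' : IsSliceChart m V e₁') (h₂' : IsSliceChart m V e₂') (hγ : γ ∈ arrowsBetween V e₁ e₂)
    (hγ' : γ ∈ arrowsBetween V e₁' e₂') :
    rate e₁' e₂' γ = rate e₁' e₁ ((puffArrowGroupoid m V).unit γ.tgt) * rate e₁ e₂ γ *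
      rate e₂ e₂' ((puffArrowGroupoid m V).unit γ.src) :=
  -- `γ` is written as unit · `γ` · unit, with the successive charts `e₁'`, `e₁`, `e₂`, `e₂'`.
  (((hasRate_rate h₁' h₁ (γ := (puffArrowGroupoid m V).unit γ.tgt) hγ'.1 hγ.1).mul
    (hasRate_rate h₁ h₂ hγ.1 hγ.2) rfl).mul
    (hasRate_rate h₂ h₂' (γ := (puffArrowGroupoid m V).unit γ.src) hγ.2 hγ'.2) rfl).rate_eq
    h₁' h₂' hγ'.1 hγ'.2

end ChangeOfCharts

/-! ### Existence of the smooth structure of the puff of a hypersurface -/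

section Existence

variable {m : ℕ} {M : Type*} [TopologicalSpace M] [ChartedSpace (EuclideanSpace ℝ (Fin m)) M]
  {V : Set M} {e e₁ e₂ e₁' e₂' : StraightChart m M} {x y : M}

/-- `T_xV` is the kernel of the differential of the last coordinate, which maps onto `ℝ`. -/
lemma exists_normalEquiv (he : IsSliceChart m V e) (hx : x ∈ e.source) (hxV : x ∈ V) :
    ∃ ν : NormalFiber m V x ≃ₗ[ℝ] ℝ, ∀ v, ν (Submodule.Quotient.mk v) = lastCoordDeriv m e x v := by
  let f : TangentSpace (𝓡 m) x →ₗ[ℝ] ℝ :=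
    (mfderiv (𝓡 m) 𝓘(ℝ, ℝ) (fun z => (e z).2) x).toLinearMap
  have hf : Function.Surjective f := fun c => by
    obtain ⟨v, hv⟩ := exists_lastCoordDeriv_eq_one hx
    exact ⟨c • v, (lastCoordDeriv_smul c v).trans (by rw [hv, mul_one])⟩
  have hk : tangentTo m V x = LinearMap.ker f := Submodule.ext fun v => by
    rw [he.mem_tangentTo_iff hx hxV]
    rfl
  exact ⟨(Submodule.quotEquivOfEq _ _ hk).trans (f.quotKerEquivOfSurjective hf), fun v => rfl⟩

lemma exists_arrow_of_notMem (hx : x ∉ V) (hy : y ∉ V) :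
    ∃ γ : PuffArrow m V, γ.tgt = x ∧ γ.src = y := by
  have := subsingleton_normalFiber m hx
  have := subsingleton_normalFiber m hy
  exact ⟨⟨x, y, iff_of_false hx hy, ⟨0, 0, fun _ => Subsingleton.elim _ _,
    fun _ => Subsingleton.elim _ _⟩⟩, rfl, rfl⟩

/-- On `V` the isomorphism is multiplication by `l` read in the two trivialisations of the normal
bundle. Off `V` the equation `hxy` alone says that the rate is `l`. -/
lemma exists_arrow_hasRate (h₁ : IsSliceChart m V e₁) (h₂ : IsSliceChart m V e₂)
    (hx : x ∈ e₁.source) (hy : y ∈ e₂.source) {l : ℝ} (hl : l ≠ 0)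
    (hxy : (e₁ x).2 = l * (e₂ y).2) :
    ∃ γ : PuffArrow m V, γ.tgt = x ∧ γ.src = y ∧ HasRate e₁ e₂ γ l := by
  have hV : x ∈ V ↔ y ∈ V := by
    rw [h₁ x hx, h₂ y hy, hxy, mul_eq_zero, or_iff_right hl]
  by_cases hyV : y ∈ V
  · obtain ⟨ν₁, hν₁⟩ := exists_normalEquiv h₁ hx (hV.2 hyV)
    obtain ⟨ν₂, hν₂⟩ := exists_normalEquiv h₂ hy hyV
    refine ⟨⟨x, y, hV, (ν₂.trans (LinearEquiv.smulOfNeZero ℝ ℝ l hl)).trans ν₁.symm⟩, rfl, rfl, hxy,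
      fun _ v w hvw => ?_⟩
    have h3 : ν₁.symm (l • ν₂ (Submodule.Quotient.mk v)) = Submodule.Quotient.mk w := hvw
    rw [LinearEquiv.symm_apply_eq, hν₁, hν₂] at h3
    exact h3.symm
  · obtain ⟨γ, rfl, rfl⟩ := exists_arrow_of_notMem (m := m) (fun h => hyV (hV.1 h)) hyV
    exact ⟨γ, rfl, rfl, hxy, fun h => absurd h hyV⟩

/-- The arrow off `V` with given range and source. -/
def complArrow (V : Set M) (p : M × M) : PuffArrow m V :=
  haveI : Nonempty (PuffArrow m V) := ⟨(puffArrowGroupoid m V).unit p.1⟩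
  Classical.epsilon fun γ => anchor m γ = p

lemma anchor_complArrow {p : M × M} (hp : p ∈ Vᶜ ×ˢ Vᶜ) :
    anchor m (complArrow V p : PuffArrow m V) = p := by
  obtain ⟨γ, h1, h2⟩ := exists_arrow_of_notMem (m := m) hp.1 hp.2
  exact Classical.epsilon_spec (p := fun γ : PuffArrow m V => anchor m γ = p) ⟨γ, Prod.ext h1 h2⟩

/-- The parametrisation of the arrows off `V` by their ranges and sources. -/
def complParam (V : Set M) : PartialEquiv (M × M) (PuffArrow m V) where
  toFun := complArrow V
  invFun := anchor m
  source := Vᶜ ×ˢ Vᶜ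
  target := {γ | γ.src ∉ V}
  map_source' p hp := by
    have := congrArg Prod.snd (anchor_complArrow (m := m) hp)
    change (complArrow V p : PuffArrow m V).src = p.2 at this
    exact fun h => hp.2 (this ▸ h)
  map_target' γ hγ := ⟨fun h => hγ (γ.mem_iff.1 h), hγ⟩
  left_inv' p hp := anchor_complArrow hp
  right_inv' γ hγ := by
    have hp : anchor m γ ∈ Vᶜ ×ˢ Vᶜ := ⟨fun h => hγ (γ.mem_iff.1 h), hγ⟩
    have := anchor_complArrow (m := m) hp
    refine (PuffArrow.ext_of_notMem m (congrArg Prod.fst this).symm (congrArg Prod.snd this).symm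
      hp.1).symm

/-- The arrow with given coordinates. -/
def sliceArrow (V : Set M) (e₁ e₂ : StraightChart m M) (q : SliceSpace m) : PuffArrow m V :=
  haveI : Nonempty (PuffArrow m V) :=
    ⟨(puffArrowGroupoid m V).unit (e₁.symm (q.1, q.2.2.2 * q.2.2.1))⟩
  Classical.epsilon fun γ => γ.tgt = e₁.symm (q.1, q.2.2.2 * q.2.2.1) ∧
    γ.src = e₂.symm (q.2.1, q.2.2.1) ∧ HasRate e₁ e₂ γ q.2.2.2

/-- The domain of the parametrisation of the arrows by their coordinates. -/
def sliceDomain (e₁ e₂ : StraightChart m M) : Set (SliceSpace m) :=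
  {q | q.2.2.2 ≠ 0 ∧ (q.1, q.2.2.2 * q.2.2.1) ∈ e₁.target ∧ (q.2.1, q.2.2.1) ∈ e₂.target}

lemma isOpen_sliceDomain (e₁ e₂ : StraightChart m M) : IsOpen (sliceDomain e₁ e₂) :=
  ((isOpen_compl_singleton (x := (0 : ℝ))).preimage (by fun_prop : Continuous
    fun q : SliceSpace m => q.2.2.2)).inter
  ((e₁.open_target.preimage (by fun_prop : Continuous
    fun q : SliceSpace m => (q.1, q.2.2.2 * q.2.2.1))).inter
  (e₂.open_target.preimage (by fun_prop : Continuous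
    fun q : SliceSpace m => (q.2.1, q.2.2.1))))

lemma sliceArrow_spec (h₁ : IsSliceChart m V e₁) (h₂ : IsSliceChart m V e₂) {q : SliceSpace m}
    (hq : q ∈ sliceDomain e₁ e₂) :
    (sliceArrow V e₁ e₂ q).tgt = e₁.symm (q.1, q.2.2.2 * q.2.2.1) ∧
      (sliceArrow V e₁ e₂ q).src = e₂.symm (q.2.1, q.2.2.1) ∧
      HasRate e₁ e₂ (sliceArrow V e₁ e₂ q) q.2.2.2 :=
  Classical.epsilon_spec (p := fun γ : PuffArrow m V =>
    γ.tgt = e₁.symm (q.1, q.2.2.2 * q.2.2.1) ∧ γ.src = e₂.symm (q.2.1, q.2.2.1) ∧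
      HasRate e₁ e₂ γ q.2.2.2)
    (exists_arrow_hasRate h₁ h₂ (e₁.symm_mem_source hq.2.1) (e₂.symm_mem_source hq.2.2) hq.1 (by
      rw [e₁.apply_symm_apply hq.2.1, e₂.apply_symm_apply hq.2.2]))

lemma sliceArrow_mem (h₁ : IsSliceChart m V e₁) (h₂ : IsSliceChart m V e₂) {q : SliceSpace m}
    (hq : q ∈ sliceDomain e₁ e₂) : sliceArrow V e₁ e₂ q ∈ arrowsBetween V e₁ e₂ := by
  obtain ⟨ht, hs, -⟩ := sliceArrow_spec h₁ h₂ hq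
  exact ⟨by rw [ht]; exact e₁.symm_mem_source hq.2.1,
    by rw [hs]; exact e₂.symm_mem_source hq.2.2⟩

lemma rate_sliceArrow (h₁ : IsSliceChart m V e₁) (h₂ : IsSliceChart m V e₂) {q : SliceSpace m}
    (hq : q ∈ sliceDomain e₁ e₂) : rate e₁ e₂ (sliceArrow V e₁ e₂ q) = q.2.2.2 :=
  (sliceArrow_spec h₁ h₂ hq).2.2.rate_eq h₁ h₂ (sliceArrow_mem h₁ h₂ hq).1
    (sliceArrow_mem h₁ h₂ hq).2

lemma sliceCoord_mem (h₁ : IsSliceChart m V e₁) (h₂ : IsSliceChart m V e₂) {γ : PuffArrow m V}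
    (hγ : γ ∈ arrowsBetween V e₁ e₂) : sliceCoord e₁ e₂ γ ∈ sliceDomain e₁ e₂ := by
  have hr := hasRate_rate h₁ h₂ hγ.1 hγ.2
  refine ⟨hr.ne_zero h₁ h₂ hγ.1 hγ.2, ?_, e₂.map_mem_target hγ.2⟩
  change ((e₁ γ.tgt).1, rate e₁ e₂ γ * (e₂ γ.src).2) ∈ e₁.target
  rw [← hr.1]
  exact e₁.map_mem_target hγ.1

/-- The parametrisation of the arrows by their coordinates. -/
def sliceParam (h₁ : IsSliceChart m V e₁) (h₂ : IsSliceChart m V e₂) :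
    PartialEquiv (SliceSpace m) (PuffArrow m V) where
  toFun := sliceArrow V e₁ e₂
  invFun := sliceCoord e₁ e₂
  source := sliceDomain e₁ e₂
  target := arrowsBetween V e₁ e₂
  map_source' q hq := sliceArrow_mem h₁ h₂ hq
  map_target' γ hγ := sliceCoord_mem h₁ h₂ hγ
  left_inv' q hq := by
    obtain ⟨ht, hs, -⟩ := sliceArrow_spec h₁ h₂ hq
    rw [sliceCoord, rate_sliceArrow h₁ h₂ hq, ht, hs, e₁.apply_symm_apply hq.2.1,
      e₂.apply_symm_apply hq.2.2]
  right_inv' γ hγ := by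
    have hr := hasRate_rate h₁ h₂ hγ.1 hγ.2
    have hq := sliceCoord_mem h₁ h₂ hγ
    obtain ⟨ht, hs, hr'⟩ := sliceArrow_spec h₁ h₂ hq
    refine (hr.arrow_ext hr' h₁ hγ.1 (Eq.trans ?_ ht.symm) (Eq.trans ?_ hs.symm)).symm
    · change γ.tgt = e₁.symm ((e₁ γ.tgt).1, rate e₁ e₂ γ * (e₂ γ.src).2)
      rw [← hr.1]
      exact (e₁.symm_apply_apply hγ.1).symm
    · exact (e₂.symm_apply_apply hγ.2).symm

/-! ### Smooth families of arrows, and charts on the set of arrows before it has a topology. -/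

section Plot

variable {EX HX X : Type*} [NormedAddCommGroup EX] [NormedSpace ℝ EX] [TopologicalSpace HX]
  {I : ModelWithCorners ℝ EX HX} [TopologicalSpace X] [ChartedSpace HX X]
  {EY HY Y : Type*} [NormedAddCommGroup EY] [NormedSpace ℝ EY] [TopologicalSpace HY]
  {J : ModelWithCorners ℝ EY HY} [TopologicalSpace Y] [ChartedSpace HY Y]

variable (I) in
/-- A map from a manifold to the set of arrows of a puff whose ranges, sources and rates depend
smoothly on the parameters. -/
structure IsPlotAt (P : X → PuffArrow m V) (z : X) : Prop where
  anchor : ContMDiffAt I ((𝓡 m).prod (𝓡 m)) ∞ (fun z => anchor m (P z)) z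
  rate : ∀ e₁ e₂, IsSliceChart m V e₁ → IsSliceChart m V e₂ → P z ∈ arrowsBetween V e₁ e₂ →
    ContMDiffAt I 𝓘(ℝ, ℝ) ∞ (fun z => rate e₁ e₂ (P z)) z

variable {P : X → PuffArrow m V} {z : X}

lemma IsPlotAt.comp {f : Y → X} {y : Y} (hP : IsPlotAt I P (f y)) (hf : ContMDiffAt J I ∞ f y) :
    IsPlotAt J (P ∘ f) y :=
  ⟨hP.anchor.comp y hf, fun e₁ e₂ h₁ h₂ hy => (hP.rate e₁ e₂ h₁ h₂ hy).comp y hf⟩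

lemma IsPlotAt.congr_of_eventuallyEq {Q : X → PuffArrow m V} (hP : IsPlotAt I P z)
    (h : Q =ᶠ[𝓝 z] P) : IsPlotAt I Q z :=
  ⟨hP.anchor.congr_of_eventuallyEq (h.fun_comp (_root_.anchor m)), fun e₁ e₂ h₁ h₂ hz =>
    (hP.rate e₁ e₂ h₁ h₂ (h.self_of_nhds ▸ hz)).congr_of_eventuallyEq
      (h.fun_comp (_root_.rate e₁ e₂))⟩

lemma contMDiffAt_tgt_of_anchor
    (ha : ContMDiffAt I ((𝓡 m).prod (𝓡 m)) ∞ (fun z => anchor m (P z)) z) :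
    ContMDiffAt I (𝓡 m) ∞ (fun z => (P z).tgt) z :=
  contMDiff_fst.contMDiffAt.comp z ha

lemma contMDiffAt_src_of_anchor
    (ha : ContMDiffAt I ((𝓡 m).prod (𝓡 m)) ∞ (fun z => anchor m (P z)) z) :
    ContMDiffAt I (𝓡 m) ∞ (fun z => (P z).src) z :=
  contMDiff_snd.contMDiffAt.comp z ha

lemma eventually_mem_arrowsBetween
    (ha : ContMDiffAt I ((𝓡 m).prod (𝓡 m)) ∞ (fun z => anchor m (P z)) z)
    (hz : P z ∈ arrowsBetween V e₁ e₂) : ∀ᶠ w in 𝓝 z, P w ∈ arrowsBetween V e₁ e₂ :=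
  ha.continuousAt.eventually ((e₁.open_source.prod e₂.open_source).mem_nhds hz)

/-- One pair of charts suffices: any other pair multiplies the rate by rates of units at the range
and the source, which are smooth. -/
lemma isPlotAt_of_rate (h₁ : IsSliceChart m V e₁) (h₂ : IsSliceChart m V e₂)
    (hz : P z ∈ arrowsBetween V e₁ e₂)
    (ha : ContMDiffAt I ((𝓡 m).prod (𝓡 m)) ∞ (fun z => anchor m (P z)) z)
    (hr : ContMDiffAt I 𝓘(ℝ, ℝ) ∞ (fun z => rate e₁ e₂ (P z)) z) : IsPlotAt I P z := by
  refine ⟨ha, fun e₁' e₂' h₁' h₂' hz' => ?_⟩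
  have h3 := ContMDiffAt.comp z (contMDiffAt_rate_unit h₁' h₁ hz'.1 hz.1)
    (contMDiffAt_tgt_of_anchor ha)
  have h4 := ContMDiffAt.comp z (contMDiffAt_rate_unit h₂ h₂' hz.2 hz'.2)
    (contMDiffAt_src_of_anchor ha)
  refine ((h3.mul hr).mul h4).congr_of_eventuallyEq ?_
  filter_upwards [eventually_mem_arrowsBetween ha hz, eventually_mem_arrowsBetween ha hz']
    with w hw hw'
  exact rate_eq_rate_mul h₁ h₂ h₁' h₂' hw hw'

/-- Off `V` the rate is a quotient of last coordinates with nonvanishing denominator, hence is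
smooth as soon as the anchor is. -/
lemma isPlotAt_of_notMem (hV : IsClosed V) (hz : (P z).src ∉ V)
    (ha : ContMDiffAt I ((𝓡 m).prod (𝓡 m)) ∞ (fun z => anchor m (P z)) z) : IsPlotAt I P z := by
  refine ⟨ha, fun e₁ e₂ h₁ h₂ hm => ?_⟩
  have h3 := (contMDiffAt_lastCoord hm.1).comp z (contMDiffAt_tgt_of_anchor ha)
  have h4 := (contMDiffAt_lastCoord hm.2).comp z (contMDiffAt_src_of_anchor ha)
  have h0 : ∀ w, P w ∈ arrowsBetween V e₁ e₂ → (P w).src ∉ V → (e₂ (P w).src).2 ≠ 0 :=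
    fun w hw hw' h => hw' ((h₂ _ hw.2).2 h)
  refine (h3.mul (ContMDiffAt.comp z (g := fun l : ℝ => l⁻¹)
      (contDiffAt_inv ℝ (h0 z hm hz)).contMDiffAt h4)).congr_of_eventuallyEq ?_
  filter_upwards [eventually_mem_arrowsBetween ha hm,
    (contMDiffAt_src_of_anchor ha).continuousAt.eventually (hV.isOpen_compl.mem_nhds hz)]
    with w hw hw'
  change rate e₁ e₂ (P w) = (e₁ (P w).tgt).2 * ((e₂ (P w).src).2)⁻¹
  rw [(hasRate_rate h₁ h₂ hw.1 hw.2).1, mul_inv_cancel_right₀ (h0 w hw hw')]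

lemma isPlotAt_complArrow (hV : IsClosed V) {p : M × M} (hp : p ∈ Vᶜ ×ˢ Vᶜ) :
    IsPlotAt ((𝓡 m).prod (𝓡 m)) (complArrow V : M × M → PuffArrow m V) p := by
  refine isPlotAt_of_notMem hV ((complParam V).map_source hp)
    (contMDiffAt_id.congr_of_eventuallyEq ?_)
  filter_upwards [(hV.isOpen_compl.prod hV.isOpen_compl).mem_nhds hp] with q hq
  exact anchor_complArrow hq

lemma isPlotAt_sliceArrow (h₁ : IsSliceChart m V e₁) (h₂ : IsSliceChart m V e₂) {q : SliceSpace m}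
    (hq : q ∈ sliceDomain e₁ e₂) : IsPlotAt 𝓘(ℝ, SliceSpace m) (sliceArrow V e₁ e₂) q := by
  have hnhds := (isOpen_sliceDomain e₁ e₂).mem_nhds hq
  refine isPlotAt_of_rate h₁ h₂ (sliceArrow_mem h₁ h₂ hq) ?_ ?_
  · have h3 : ContMDiffAt 𝓘(ℝ, SliceSpace m) (𝓡 m) ∞
        (fun q : SliceSpace m => e₁.symm (q.1, q.2.2.2 * q.2.2.1)) q :=
      ContMDiffAt.comp q (g := e₁.symm) (e₁.contMDiffAt_symm hq.2.1)
        (ContDiff.contMDiff (by fun_prop)).contMDiffAt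
    have h4 : ContMDiffAt 𝓘(ℝ, SliceSpace m) (𝓡 m) ∞
        (fun q : SliceSpace m => e₂.symm (q.2.1, q.2.2.1)) q :=
      ContMDiffAt.comp q (g := e₂.symm) (e₂.contMDiffAt_symm hq.2.2)
        (ContDiff.contMDiff (by fun_prop)).contMDiffAt
    refine (h3.prodMk h4).congr_of_eventuallyEq ?_
    filter_upwards [hnhds] with w hw
    exact Prod.ext (sliceArrow_spec h₁ h₂ hw).1 (sliceArrow_spec h₁ h₂ hw).2.1
  · refine ContMDiffAt.congr_of_eventuallyEq (f := fun q : SliceSpace m => q.2.2.2)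
      (ContDiff.contMDiff (by fun_prop)).contMDiffAt ?_
    filter_upwards [hnhds] with w hw
    exact rate_sliceArrow h₁ h₂ hw

lemma IsPlotAt.contMDiffAt_sliceCoord (hP : IsPlotAt I P z) (h₁ : IsSliceChart m V e₁)
    (h₂ : IsSliceChart m V e₂) (hz : P z ∈ arrowsBetween V e₁ e₂) :
    ContMDiffAt I 𝓘(ℝ, SliceSpace m) ∞ (fun z => sliceCoord e₁ e₂ (P z)) z := by
  have h5 : ContMDiffAt I _ ∞ (fun z => e₁ (P z).tgt) z :=
    (e₁.contMDiffAt hz.1).comp z (contMDiffAt_tgt_of_anchor hP.anchor)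
  have h6 : ContMDiffAt I _ ∞ (fun z => e₂ (P z).src) z :=
    (e₂.contMDiffAt hz.2).comp z (contMDiffAt_src_of_anchor hP.anchor)
  exact (contDiff_fst.contMDiff.contMDiffAt.comp z h5).prodMk_space
    ((contDiff_fst.contMDiff.contMDiffAt.comp z h6).prodMk_space
      ((contDiff_snd.contMDiff.contMDiffAt.comp z h6).prodMk_space (hP.rate e₁ e₂ h₁ h₂ hz)))

/-- The charts of the puff. The last condition states that they are smooth functions of the
ranges, of the sources and of the rates of the arrows. -/
structure IsPuffChart (c : PartialEquiv (PuffArrow m V) (PairSpace m)) : Prop where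
  isOpen_target : IsOpen c.target
  exists_isOpen : ∃ O : Set (M × M), IsOpen O ∧ c.source = anchor m ⁻¹' O
  isPlotAt : ∀ u ∈ c.target, IsPlotAt 𝓘(ℝ, PairSpace m) c.symm u
  exists_eq : (∃ F : M × M → PairSpace m, ∀ γ ∈ c.source,
      ContMDiffAt ((𝓡 m).prod (𝓡 m)) 𝓘(ℝ, PairSpace m) ∞ F (anchor m γ) ∧ c γ = F (anchor m γ)) ∨
    ∃ (e₁ e₂ : StraightChart m M) (F : SliceSpace m → PairSpace m), IsSliceChart m V e₁ ∧
      IsSliceChart m V e₂ ∧ ContDiff ℝ ∞ F ∧ c.source ⊆ arrowsBetween V e₁ e₂ ∧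
      ∀ γ ∈ c.source, c γ = F (sliceCoord e₁ e₂ γ)

variable {c : PartialEquiv (PuffArrow m V) (PairSpace m)}

lemma IsPuffChart.eventually_mem_source (hc : IsPuffChart c)
    (hP : ContinuousAt (fun z => anchor m (P z)) z)
    (hz : P z ∈ c.source) : ∀ᶠ w in 𝓝 z, P w ∈ c.source := by
  obtain ⟨O, hO, hcO⟩ := hc.exists_isOpen
  rw [hcO] at hz ⊢
  exact hP.eventually (hO.mem_nhds hz)

/-- Taking for `P` the inverse of another chart gives the smoothness of coordinate changes. -/
lemma IsPuffChart.contMDiffAt_comp (hc : IsPuffChart c) (hP : IsPlotAt I P z)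
    (hz : P z ∈ c.source) : ContMDiffAt I 𝓘(ℝ, PairSpace m) ∞ (c ∘ P) z := by
  have hev := hc.eventually_mem_source hP.anchor.continuousAt hz
  obtain ⟨F, hF⟩ | ⟨e₁, e₂, F, h₁, h₂, hF, hcs, hcF⟩ := hc.exists_eq
  · refine (ContMDiffAt.comp z (hF _ hz).1 hP.anchor).congr_of_eventuallyEq ?_
    filter_upwards [hev] with w hw
    exact (hF _ hw).2
  · refine (hF.contMDiff.contMDiffAt.comp z
      (hP.contMDiffAt_sliceCoord h₁ h₂ (hcs hz))).congr_of_eventuallyEq ?_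
    filter_upwards [hev] with w hw
    exact hcF _ hw

lemma exists_sliceSpace_equiv (hx : x ∈ e.source) : Nonempty (SliceSpace m ≃L[ℝ] PairSpace m) := by
  -- The count `2 * (m - 1) + 2 = 2 * m` fails for `m = 0` because of truncated subtraction. A
  -- straightening chart with a point excludes this case, since its last coordinate has nonzero
  -- differential.
  have hm : m ≠ 0 := by
    rintro rfl
    obtain ⟨v, hv⟩ := exists_lastCoordDeriv_eq_one hx
    have : v = (0 : ℝ) • v := (Subsingleton.elim (α := EuclideanSpace ℝ (Fin 0)) _ _)
    rw [this, lastCoordDeriv_smul, zero_mul] at hv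
    exact zero_ne_one hv
  refine ⟨ContinuousLinearEquiv.ofFinrankEq ?_⟩
  simp only [Module.finrank_prod, finrank_euclideanSpace_fin, Module.finrank_self]
  omega

lemma exists_isPuffChart [IsManifold (𝓡 m) ∞ M] (hV : IsHypersurface m V) (γ : PuffArrow m V) :
    ∃ c : PartialEquiv (PuffArrow m V) (PairSpace m), IsPuffChart c ∧ γ ∈ c.source := by
  by_cases hγ : γ.src ∈ V
  · obtain ⟨e₁, ht, h₁⟩ := hV.exists_sliceChart _ (γ.mem_iff.2 hγ)
    obtain ⟨e₂, hs, h₂⟩ := hV.exists_sliceChart _ hγ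
    obtain ⟨L⟩ := exists_sliceSpace_equiv hs
    refine ⟨(sliceParam h₁ h₂).symm.transEquiv L.toEquiv, ⟨?_, ?_, ?_, ?_⟩, ⟨ht, hs⟩⟩
    · exact (isOpen_sliceDomain e₁ e₂).preimage L.symm.continuous
    · exact ⟨e₁.source ×ˢ e₂.source, e₁.open_source.prod e₂.open_source, rfl⟩
    · exact fun u hu => (isPlotAt_sliceArrow h₁ h₂ hu).comp
        (L.symm.contDiff.contMDiff.contMDiffAt (x := u))
    · exact Or.inr ⟨e₁, e₂, L, h₁, h₂, L.contDiff, subset_rfl, fun _ _ => rfl⟩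
  · let ψ := PartialDiffeomorph.extChart ((𝓡 m).prod (𝓡 m)) (anchor m γ)
    have ho := hV.isClosed.isOpen_compl.prod hV.isClosed.isOpen_compl
    have hsrc : ((complParam V).symm.trans ψ.toPartialEquiv).source =
        anchor m ⁻¹' (Vᶜ ×ˢ Vᶜ ∩ ψ.source) := by
      refine Set.ext fun δ => and_congr_left fun _ => ⟨fun h => ?_, fun h => h.2⟩
      exact ⟨fun h' => h (δ.mem_iff.1 h'), h⟩
    refine ⟨(complParam V).symm.trans ψ.toPartialEquiv, ⟨?_, ?_, ?_, ?_⟩, hγ,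
      PartialDiffeomorph.mem_extChart_source _⟩
    · exact ψ.symm.contMDiffOn_toFun.continuousOn.isOpen_inter_preimage ψ.open_target ho
    · exact ⟨_, ho.inter ψ.open_source, hsrc⟩
    · exact fun u hu => (isPlotAt_complArrow hV.isClosed hu.2).comp (ψ.contMDiffAt_symm hu.1)
    · exact Or.inl ⟨ψ, fun δ hδ => ⟨ψ.contMDiffAt hδ.2, rfl⟩⟩

/-! ### The manifold structure defined by an atlas of such charts. -/

section Atlas

variable [TopologicalSpace (PuffArrow m V)] [ChartedSpace (PairSpace m) (PuffArrow m V)]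

lemma isManifold_of_isPuffChart
    (hA : ∀ φ ∈ atlas (PairSpace m) (PuffArrow m V), IsPuffChart φ.toPartialEquiv) :
    IsManifold 𝓘(ℝ, PairSpace m) ∞ (PuffArrow m V) := by
  refine isManifold_of_contDiffOn _ _ _ fun φ φ' hφ hφ' => ?_
  simp only [mfld_simps]
  refine contMDiffOn_iff_contDiffOn.1 fun u hu => ContMDiffAt.contMDiffWithinAt ?_
  exact (hA φ' hφ').contMDiffAt_comp ((hA φ hφ).isPlotAt u hu.1) hu.2

lemma contMDiffAt_of_isPlotAt [IsManifold 𝓘(ℝ, PairSpace m) ∞ (PuffArrow m V)]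
    (hA : ∀ φ ∈ atlas (PairSpace m) (PuffArrow m V), IsPuffChart φ.toPartialEquiv)
    (hP : IsPlotAt I P z) : ContMDiffAt I 𝓘(ℝ, PairSpace m) ∞ P z := by
  let φ := chartAt (PairSpace m) (P z)
  have hφ := hA φ (chart_mem_atlas _ _)
  have hz : P z ∈ φ.source := mem_chart_source _ _
  have h1 : ContMDiffAt 𝓘(ℝ, PairSpace m) 𝓘(ℝ, PairSpace m) ∞ φ.symm (φ (P z)) :=
    (contMDiffOn_symm_of_mem_maximalAtlas (IsManifold.chart_mem_maximalAtlas (P z))).contMDiffAt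
      (φ.open_target.mem_nhds (φ.map_source hz))
  refine (ContMDiffAt.comp z h1 (hφ.contMDiffAt_comp hP hz)).congr_of_eventuallyEq ?_
  filter_upwards [hφ.eventually_mem_source hP.anchor.continuousAt hz] with w hw
  exact (φ.left_inv hw).symm

/-- Together with `contMDiffAt_of_isPlotAt` this identifies plots and smooth maps; in particular
anchors and rates are smooth functions of the arrow. -/
lemma isPlotAt_id [IsManifold 𝓘(ℝ, PairSpace m) ∞ (PuffArrow m V)]
    (hA : ∀ φ ∈ atlas (PairSpace m) (PuffArrow m V), IsPuffChart φ.toPartialEquiv)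
    (γ : PuffArrow m V) : IsPlotAt 𝓘(ℝ, PairSpace m) (fun γ : PuffArrow m V => γ) γ := by
  let φ := chartAt (PairSpace m) γ
  have hφ := hA φ (chart_mem_atlas _ _)
  have hγ : γ ∈ φ.source := mem_chart_source _ _
  have h1 : ContMDiffAt 𝓘(ℝ, PairSpace m) 𝓘(ℝ, PairSpace m) ∞ φ γ :=
    contMDiffAt_of_mem_maximalAtlas (IsManifold.chart_mem_maximalAtlas γ) hγ
  refine ((hφ.isPlotAt _ (φ.map_source hγ)).comp h1).congr_of_eventuallyEq ?_
  filter_upwards [φ.open_source.mem_nhds hγ] with δ hδ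
  exact (φ.left_inv hδ).symm

/-- The parametrisations are smooth because they are plots, and their inverses because they are made
of anchors and rates, which are smooth by `isPlotAt_id`. -/
lemma isPuffManifold_of_isPuffChart (hV : IsHypersurface m V)
    (hA : ∀ φ ∈ atlas (PairSpace m) (PuffArrow m V), IsPuffChart φ.toPartialEquiv) :
    IsPuffManifold m V := by
  have hm := isManifold_of_isPuffChart hA
  have hid := isPlotAt_id hA
  have ha : ContMDiff 𝓘(ℝ, PairSpace m) ((𝓡 m).prod (𝓡 m)) ∞
      (anchor m : PuffArrow m V → M × M) := fun γ => (hid γ).anchor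
  refine ⟨hm, ⟨⟨complParam V, ?_, ?_, ?_, ?_⟩, rfl, fun p hp => anchor_complArrow hp⟩,
    fun e₁ e₂ h₁ h₂ => ⟨⟨sliceParam h₁ h₂, ?_, ?_, ?_, ?_⟩, rfl, ?_⟩⟩
  · exact hV.isClosed.isOpen_compl.prod hV.isClosed.isOpen_compl
  · exact hV.isClosed.isOpen_compl.preimage ha.continuous.snd
  · exact fun p hp => (contMDiffAt_of_isPlotAt hA
      (isPlotAt_complArrow hV.isClosed hp)).contMDiffWithinAt
  · exact ha.contMDiffOn
  · exact isOpen_sliceDomain e₁ e₂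
  · exact (e₁.open_source.prod e₂.open_source).preimage ha.continuous
  · exact fun q hq => (contMDiffAt_of_isPlotAt hA
      (isPlotAt_sliceArrow h₁ h₂ hq)).contMDiffWithinAt
  · exact fun γ hγ => ((hid γ).contMDiffAt_sliceCoord h₁ h₂ hγ).contMDiffWithinAt
  · intro a b t l hq
    obtain ⟨ht, hs, hr⟩ := sliceArrow_spec h₁ h₂ hq
    refine ⟨ht, hs, fun h0 => hr.2 ?_⟩
    rw [hs, h₂ _ (e₂.symm_mem_source hq.2.2), e₂.apply_symm_apply hq.2.2]
    exact h0

end Atlas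

/-- The smooth structure of the puff of a hypersurface exists. -/
theorem exists_isPuffManifold [IsManifold (𝓡 m) ∞ M] (hV : IsHypersurface m V) :
    ∃ (_ : TopologicalSpace (PuffArrow m V)) (_ : ChartedSpace (PairSpace m) (PuffArrow m V)),
      IsPuffManifold m V := by
  choose c hc hγc using exists_isPuffChart hV
  -- The atlas also defines the topology. Overlaps are open because the source of a chart is the
  -- preimage of an open set under the anchor, and inverse charts have continuous anchor.
  let core : ChartedSpaceCore (PairSpace m) (PuffArrow m V) :=
    { atlas := {c | IsPuffChart c}
      chartAt := c
      mem_chart_source := hγc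
      chart_mem_atlas := hc
      open_source := fun e e' he he' => by
        obtain ⟨O, hO, hO'⟩ := he'.exists_isOpen
        rw [PartialEquiv.trans_source, hO']
        have : ContinuousOn (fun u => anchor m (e.symm u)) e.target := fun u hu =>
          (he.isPlotAt u hu).anchor.continuousAt.continuousWithinAt
        exact this.isOpen_inter_preimage he.isOpen_target hO
      continuousOn_toFun := fun e e' he he' u hu =>
        (he'.contMDiffAt_comp (he.isPlotAt u hu.1) hu.2).continuousAt.continuousWithinAt }
  let _ := core.toTopologicalSpace
  let _ := core.toChartedSpace
  refine ⟨core.toTopologicalSpace, core.toChartedSpace, isPuffManifold_of_isPuffChart hV ?_⟩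
  intro φ hφ
  obtain ⟨c, hc, rfl⟩ := mem_iUnion₂.1 hφ
  exact hc

end Plot

end Existence

/-! ### Transversality of the anchors of a decoupage -/

section Transversality

/-- Restricted to `T × 0`, a relation between forms orthogonal to the `W i` is a relation between
forms orthogonal to the `A i`, so all restrictions vanish. By `h₂`, a form orthogonal to `W i` whose
restriction vanishes is zero. -/
lemma iSupIndep_dualAnnihilator_of_prod {ι T T' : Type*} [AddCommGroup T] [Module ℝ T]
    [AddCommGroup T'] [Module ℝ T'] {W : ι → Submodule ℝ (T × T')} {A : ι → Submodule ℝ T}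
    (hA : iSupIndep fun i => (A i).dualAnnihilator) (h₁ : ∀ i, ∀ w ∈ A i, (w, (0 : T')) ∈ W i)
    (h₂ : ∀ i w', ∃ w, (w, w') ∈ W i) : iSupIndep fun i => (W i).dualAnnihilator := by
  rw [iSupIndep_iff_finsetSum_eq_zero_imp_eq_zero] at hA ⊢
  intro s v hv hv0 i hi
  have h0 : v i ∘ₗ LinearMap.inl ℝ T T' = 0 := by
    refine hA s (fun i => v i ∘ₗ LinearMap.inl ℝ T T') (fun j hj => ?_) ?_ i hi
    · rw [Submodule.mem_dualAnnihilator]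
      exact fun w hw => (Submodule.mem_dualAnnihilator _).1 (hv j hj) _ (h₁ j w hw)
    · ext w
      have := LinearMap.congr_fun hv0 (w, 0)
      simpa [LinearMap.sum_apply] using this
  refine LinearMap.ext fun ⟨a, b⟩ => ?_
  obtain ⟨w, hw⟩ := h₂ i b
  have h3 : v i (w, b) = 0 := (Submodule.mem_dualAnnihilator _).1 (hv i hi) _ hw
  have h4 : v i (a - w, 0) = 0 := LinearMap.congr_fun h0 (a - w)
  have h5 : ((a, b) : T × T') = (w, b) + (a - w, 0) := by simp
  rw [h5, map_add, h3, h4, add_zero, LinearMap.zero_apply]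

lemma iSupIndep_of_subtype {ι α : Type*} [CompleteLattice α] {t : ι → α} (J : Set ι)
    (h : ∀ i, i ∉ J → t i = ⊥) (hJ : iSupIndep fun j : J => t j) : iSupIndep t := by
  let f : {i // t i ≠ ⊥} → J := fun i => ⟨i.1, not_not.1 fun hi => i.2 (h i.1 hi)⟩
  have hf : Function.Injective f := fun a b hab =>
    Subtype.ext (show (f a : ι) = f b from congrArg Subtype.val hab)
  exact iSupIndep_ne_bot.1 (hJ.comp hf)

/-- By duality: a form `g` on `κ → ℝ` that vanishes on the image is a linear relation between the `f
j`, with coefficients the values of `g` on the standard basis. -/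
lemma surjective_pi_of_linearIndependent {κ T : Type*} [Finite κ] [AddCommGroup T] [Module ℝ T]
    {f : κ → T →ₗ[ℝ] ℝ} (hf : LinearIndependent ℝ f) : Function.Surjective (LinearMap.pi f) := by
  have := Fintype.ofFinite κ
  classical
  rw [← LinearMap.dualMap_injective_iff, ← LinearMap.ker_eq_bot, LinearMap.ker_eq_bot']
  intro g hg
  have h1 : ∑ j, g (fun k => if j = k then 1 else 0) • f j = 0 := by
    ext v
    have h2 := LinearMap.congr_fun hg v
    rw [LinearMap.dualMap_apply, LinearMap.pi_apply_eq_sum_univ g] at h2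
    simpa [LinearMap.sum_apply, mul_comm] using h2
  refine LinearMap.pi_ext' fun j => LinearMap.ext_ring ?_
  have h2 : (Pi.single j 1 : κ → ℝ) = fun k => if j = k then 1 else 0 := funext fun k => by
    simp [Pi.single_apply, eq_comm]
  exact (congrArg g h2).trans (Fintype.linearIndependent_iff.1 hf _ h1 j)

variable {m : ℕ} {M : Type*} [TopologicalSpace M] [ChartedSpace (EuclideanSpace ℝ (Fin m)) M]
  {ι : Type*}

/-- Hypersurfaces that avoid `x` may be included: there `tangentTo` is the whole space and its
orthogonal is zero. -/
lemma IsDecoupage.iSupIndep_dualAnnihilator {V : ι → Set M} (hV : IsDecoupage m V) (x : M) :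
    iSupIndep fun i => (tangentTo m (V i) x).dualAnnihilator := by
  refine iSupIndep_of_subtype {i | x ∈ V i} (fun i hx => ?_)
    (hV.transverse {i | x ∈ V i} x fun _ hj => hj)
  have ht : tangentTo m (V i) x = ⊤ := eq_top_iff.2 fun _ _ hx' => absurd hx' hx
  exact (congrArg Submodule.dualAnnihilator ht).trans Submodule.dualAnnihilator_top

variable {V : Set M} [TopologicalSpace (PuffArrow m V)] [ChartedSpace (PairSpace m) (PuffArrow m V)]

/-- Any map to the puff of a hypersurface whose ranges, sources and rates depend smoothly on
parameters is smooth. -/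
lemma IsPuffManifold.contMDiffAt_of_isPlotAt (h : IsPuffManifold m V) (hV : IsHypersurface m V)
    {EX HX X : Type*} [NormedAddCommGroup EX] [NormedSpace ℝ EX] [TopologicalSpace HX]
    {I : ModelWithCorners ℝ EX HX} [TopologicalSpace X] [ChartedSpace HX X]
    {P : X → PuffArrow m V} {z : X} (hP : IsPlotAt I P z) :
    ContMDiffAt I 𝓘(ℝ, PairSpace m) ∞ P z := by
  by_cases hz : (P z).src ∈ V
  · obtain ⟨e₁, ht, h₁⟩ := hV.exists_sliceChart _ ((P z).mem_iff.2 hz)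
    obtain ⟨e₂, hs, h₂⟩ := hV.exists_sliceChart _ hz
    exact h.contMDiffWithinAt_of_rate h₁ h₂ ⟨ht, hs⟩ hP.anchor (hP.rate e₁ e₂ h₁ h₂ ⟨ht, hs⟩)
  · exact h.contMDiffWithinAt_of_notMem hV.isClosed hz hP.anchor

/-- The range map has partial smooth sections along the hypersurface, with constant source. -/
lemma IsPuffManifold.exists_section_along (h : IsPuffManifold m V) (hV : IsHypersurface m V)
    (γ : PuffArrow m V) : ∃ (σ : M → PuffArrow m V) (r : M → M),
      ContMDiffAt (𝓡 m) 𝓘(ℝ, PairSpace m) ∞ σ γ.tgt ∧ σ γ.tgt = γ ∧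
      MDifferentiableAt (𝓡 m) (𝓡 m) r γ.tgt ∧
      (∀ᶠ z in 𝓝 γ.tgt, anchor m (σ z) = (r z, γ.src)) ∧
      ∀ w ∈ tangentTo m V γ.tgt,
        (mfderiv (𝓡 m) (𝓡 m) r γ.tgt w : EuclideanSpace ℝ (Fin m)) = w := by
  by_cases hγ : γ.src ∈ V
  · obtain ⟨e₁, ht, h₁⟩ := hV.exists_sliceChart _ (γ.mem_iff.2 hγ)
    obtain ⟨e₂, hs, h₂⟩ := hV.exists_sliceChart _ hγ
    have hr := hasRate_rate h₁ h₂ ht hs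
    have ht0 : (e₁ γ.tgt).2 = 0 := (h₁ _ ht).1 (γ.mem_iff.2 hγ)
    have hs0 : (e₂ γ.src).2 = 0 := (h₂ _ hs).1 hγ
    -- Only `a` varies. The source is constant, and so is the last coordinate `l * t` of the range,
    -- whence the range is `freezeLast` of `z`.
    let c : M → SliceSpace m := fun z => ((e₁ z).1, (e₂ γ.src).1, (e₂ γ.src).2, rate e₁ e₂ γ)
    have hc : ContMDiffAt (𝓡 m) 𝓘(ℝ, SliceSpace m) ∞ c γ.tgt := by
      refine ContMDiffAt.comp γ.tgt (g := fun q : EuclideanSpace ℝ (Fin (m - 1)) × ℝ =>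
        ((q.1, (e₂ γ.src).1, (e₂ γ.src).2, rate e₁ e₂ γ) : SliceSpace m))
        (ContDiff.contMDiff ?_).contMDiffAt (e₁.contMDiffAt ht)
      fun_prop
    have hγm : γ ∈ arrowsBetween V e₁ e₂ := ⟨ht, hs⟩
    have hcs : c γ.tgt ∈ sliceDomain e₁ e₂ := sliceCoord_mem h₁ h₂ hγm
    refine ⟨sliceArrow V e₁ e₂ ∘ c, freezeLast e₁ (e₁ γ.tgt).2,
      (h.contMDiffAt_of_isPlotAt hV (isPlotAt_sliceArrow h₁ h₂ hcs)).comp _ hc,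
      (sliceParam h₁ h₂).right_inv hγm, (contMDiffAt_freezeLast ht).mdifferentiableAt (by simp), ?_,
      fun w hw => mfderiv_freezeLast ht ((h₁.mem_tangentTo_iff ht (γ.mem_iff.2 hγ)).1 hw)⟩
    filter_upwards [hc.continuousAt.eventually ((isOpen_sliceDomain e₁ e₂).mem_nhds hcs)] with z hz
    obtain ⟨h3, h4, -⟩ := sliceArrow_spec h₁ h₂ hz
    refine Prod.ext (h3.trans ?_) (h4.trans (e₂.symm_apply_apply hs))
    change e₁.symm ((e₁ z).1, rate e₁ e₂ γ * (e₂ γ.src).2) = e₁.symm ((e₁ z).1, (e₁ γ.tgt).2)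
    rw [hr.1]
  · have hp : anchor m γ ∈ Vᶜ ×ˢ Vᶜ := ⟨fun h => hγ (γ.mem_iff.1 h), hγ⟩
    refine ⟨fun z => complArrow V (z, γ.src), id, ?_, (complParam V).right_inv hγ,
      mdifferentiableAt_id, ?_, fun w _ => by rw [mfderiv_id]; rfl⟩
    · exact ContMDiffAt.comp γ.tgt (g := complArrow V) (f := fun z => (z, γ.src))
        (h.contMDiffAt_of_isPlotAt hV (isPlotAt_complArrow hV.isClosed hp))
        (contMDiffAt_id.prodMk contMDiffAt_const)
    · filter_upwards [hV.isClosed.isOpen_compl.mem_nhds hp.1] with z hz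
      exact anchor_complArrow ⟨hz, hγ⟩

/-- Differentiate `anchor (σ z) = (r z, γ.src)` along `w`, where the differential of `r` fixes the
vectors tangent to `V`. -/
lemma IsPuffManifold.mem_range_mfderiv_anchor (h : IsPuffManifold m V) (hV : IsHypersurface m V)
    (γ : PuffArrow m V) {w : TangentSpace (𝓡 m) γ.tgt} (hw : w ∈ tangentTo m V γ.tgt) :
    ∃ u, (mfderiv 𝓘(ℝ, PairSpace m) ((𝓡 m).prod (𝓡 m)) (anchor m : PuffArrow m V → M × M) γ u :
      PairSpace m) = (w, 0) := by
  obtain ⟨σ, r, hσ, hσγ, hr, hσr, hrw⟩ := h.exists_section_along hV γ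
  have h1 := mfderiv_comp_of_eq ((h.contMDiff_anchor hV).mdifferentiableAt (x := γ) (by simp))
    (hσ.mdifferentiableAt (by simp)) hσγ
  have h2 : mfderiv (𝓡 m) ((𝓡 m).prod (𝓡 m)) (anchor m ∘ σ) γ.tgt =
      mfderiv (𝓡 m) ((𝓡 m).prod (𝓡 m)) (fun z => (r z, γ.src)) γ.tgt :=
    EventuallyEq.mfderiv_eq hσr
  have h3 := h2.trans (mfderiv_prodMk hr mdifferentiableAt_const)
  rw [mfderiv_const] at h3
  refine ⟨mfderiv (𝓡 m) 𝓘(ℝ, PairSpace m) σ γ.tgt w, ?_⟩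
  -- The point `σ γ.tgt` equals `γ` only propositionally; this moves the differential to `γ`.
  have h4 : ∀ δ, δ = γ → ∀ u : PairSpace m,
      (mfderiv 𝓘(ℝ, PairSpace m) ((𝓡 m).prod (𝓡 m)) (anchor m) δ u : PairSpace m) =
        mfderiv 𝓘(ℝ, PairSpace m) ((𝓡 m).prod (𝓡 m)) (anchor m) γ u := by
    rintro _ rfl _
    rfl
  refine (h4 _ hσγ _).symm.trans
    ((congrArg (fun A => (A w : PairSpace m)) (h1.symm.trans h3)).trans ?_)
  exact Prod.ext (hrw w hw) rfl

lemma IsPuffManifold.exists_mem_range_mfderiv_anchor (h : IsPuffManifold m V)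
    (hV : IsHypersurface m V) (γ : PuffArrow m V) (w' : TangentSpace (𝓡 m) γ.src) :
    ∃ u, (mfderiv 𝓘(ℝ, PairSpace m) ((𝓡 m).prod (𝓡 m)) (anchor m : PuffArrow m V → M × M) γ u :
      PairSpace m).2 = w' := by
  obtain ⟨σ, hσ, hσγ, hσs⟩ := h.exists_local_section hV γ
  have h1 := mfderiv_comp_apply_of_eventually_eq (f := (PuffArrow.src : PuffArrow m V → M)) (s := σ)
    ((h.contMDiff_src hV).mdifferentiableAt (by simp)) (hσ.mdifferentiableAt (by simp)) hσs w'
  rw [hσγ] at h1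
  have h2 := mfderiv_comp γ mdifferentiableAt_snd
    ((h.contMDiff_anchor hV).mdifferentiableAt (x := γ) (by simp))
  rw [mfderiv_snd] at h2
  exact ⟨mfderiv (𝓡 m) 𝓘(ℝ, PairSpace m) σ γ.src w',
    (congrArg (fun A => (A (mfderiv (𝓡 m) 𝓘(ℝ, PairSpace m) σ γ.src w') :
      EuclideanSpace ℝ (Fin m))) h2).symm.trans h1⟩

end Transversality

/-! ### Transversality for the whole family. -/

section Family

variable {m : ℕ} {M : Type*} [TopologicalSpace M] [ChartedSpace (EuclideanSpace ℝ (Fin m)) M]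
  {ι : Type*} {V : ι → Set M} [∀ i, TopologicalSpace (PuffArrow m (V i))]
  [∀ i, ChartedSpace (PairSpace m) (PuffArrow m (V i))]

/-- The anchors of the puffs of the hypersurfaces of a decoupage are transverse. -/
theorem IsDecoupage.transverseMaps_anchor (hV : IsDecoupage m V)
    (h : ∀ i, IsPuffManifold m (V i)) :
    TransverseMaps 𝓘(ℝ, PairSpace m) ((𝓡 m).prod (𝓡 m))
      (fun i => (anchor m : PuffArrow m (V i) → M × M)) := by
  refine ⟨fun i => (h i).contMDiff_anchor (hV.isHypersurface i), fun γ y hγ => ?_⟩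
  refine iSupIndep_dualAnnihilator_of_prod (T := TangentSpace (𝓡 m) y.1)
    (T' := TangentSpace (𝓡 m) y.2) (hV.iSupIndep_dualAnnihilator y.1) (fun i w hw => ?_)
    fun i w' => ?_
  -- Replacing `y` by the anchor itself removes the transport of tangent spaces in `TransverseMaps`.
  · generalize hγ i = hi
    generalize γ i = δ at hi
    subst hi
    exact (h i).mem_range_mfderiv_anchor (hV.isHypersurface i) δ hw
  · generalize hγ i = hi
    generalize γ i = δ at hi
    subst hi
    obtain ⟨u, hu⟩ := (h i).exists_mem_range_mfderiv_anchor (hV.isHypersurface i) δ w'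
    exact ⟨_, u, Prod.ext rfl hu⟩

end Family

/-! ### Charts adapted to a decoupage and parametrisations of its puff -/

section AdaptedChart

variable {m : ℕ} {M : Type*} [TopologicalSpace M] [ChartedSpace (EuclideanSpace ℝ (Fin m)) M]
  {ι : Type*} {V : ι → Set M}

/-- A chart of `M` in which the hypersurfaces `V j`, `j ∈ J`, are straightened simultaneously: their
equations `(equation j z).2 = 0` are linear in the chart, and independent. The other hypersurfaces
do not meet the domain of the chart. -/
structure AdaptedChart (V : ι → Set M) (J : Set ι) [Fintype J] where
  equation : J → StraightChart m M
  isSliceChart : ∀ j : J, IsSliceChart m (V j) (equation j)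
  chart : PartialDiffeomorph (𝓡 m) 𝓘(ℝ, EuclideanSpace ℝ (Fin m)) M (EuclideanSpace ℝ (Fin m)) ∞
  proj : EuclideanSpace ℝ (Fin m) →L[ℝ] J → ℝ
  lift : (J → ℝ) →L[ℝ] EuclideanSpace ℝ (Fin m)
  proj_lift : ∀ v, proj (lift v) = v
  mem_source : ∀ z ∈ chart.source, ∀ j, z ∈ (equation j).source
  proj_chart : ∀ z ∈ chart.source, ∀ j, proj (chart z) j = (equation j z).2
  notMem : ∀ z ∈ chart.source, ∀ i ∉ J, z ∉ V i

lemma IsDecoupage.exists_adaptedChart [IsManifold (𝓡 m) ∞ M] [Finite ι] (hV : IsDecoupage m V)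
    (J : Set ι) [Fintype J] (x : M) (hJ : ∀ i, i ∈ J ↔ x ∈ V i) :
    ∃ a : AdaptedChart (m := m) V J, x ∈ a.chart.source := by
  choose e hxe he using fun j : J =>
    (hV.isHypersurface j).exists_sliceChart x ((hJ j).1 j.2)
  let U : Set M := (⋂ j, (e j).source) ∩ ⋂ i ∈ Jᶜ, (V i)ᶜ
  have hU : IsOpen U := (isOpen_iInter_of_finite fun j => (e j).open_source).inter
    (Set.Finite.isOpen_biInter (toFinite _) fun i _ => (hV.isHypersurface i).isClosed.isOpen_compl)
  have hxU : x ∈ U := ⟨mem_iInter.2 hxe, mem_iInter₂.2 fun i hi h => hi ((hJ i).2 h)⟩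
  let f : M → J → ℝ := fun z j => (e j z).2
  have hf : ContMDiffOn (𝓡 m) 𝓘(ℝ, J → ℝ) ∞ f U := contMDiffOn_pi_space.2 fun j =>
    (contMDiffOn_lastCoord (e j)).mono fun z hz => mem_iInter.1 hz.1 j
  let d : J → TangentSpace (𝓡 m) x →ₗ[ℝ] ℝ := fun j =>
    (mfderiv (𝓡 m) 𝓘(ℝ, ℝ) (fun z => (e j z).2) x).toLinearMap
  -- The differential of the equation of `V j` is a nonzero element of the orthogonal of `T_x (V
  -- j)`, and these orthogonals are independent. Hence `f` has surjective differential at `x`.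
  have hli : LinearIndependent ℝ d := by
    refine ((hV.iSupIndep_dualAnnihilator x).comp Subtype.val_injective).linearIndependent _
      (fun j => ?_) fun j hj => ?_
    · refine (Submodule.mem_dualAnnihilator _).2 fun w hw => ?_
      exact ((he j).mem_tangentTo_iff (hxe j) ((hJ j).1 j.2)).1 hw
    · obtain ⟨v, hv⟩ := exists_lastCoordDeriv_eq_one (hxe j)
      exact one_ne_zero (hv.symm.trans (LinearMap.congr_fun hj v))
  have hsurj : Function.Surjective (mfderiv (𝓡 m) 𝓘(ℝ, J → ℝ) f x) := by
    intro c
    obtain ⟨v, hv⟩ := surjective_pi_of_linearIndependent hli c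
    refine ⟨v, funext fun j => (Eq.trans ?_ (congrFun hv j) : _)⟩
    have h1 := mfderiv_comp (I'' := 𝓘(ℝ, ℝ)) (g := fun c : J → ℝ => c j) x
      (ContinuousLinearMap.proj (R := ℝ) (φ := fun _ : J => ℝ) j).differentiableAt.mdifferentiableAt
      ((hf.contMDiffAt (hU.mem_nhds hxU)).mdifferentiableAt (by simp))
    rw [mfderiv_eq_fderiv] at h1
    have h2 : fderiv ℝ (fun c : J → ℝ => c j) (f x) =
        ContinuousLinearMap.proj (R := ℝ) (φ := fun _ : J => ℝ) j :=
      (ContinuousLinearMap.proj (R := ℝ) (φ := fun _ : J => ℝ) j).fderiv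
    rw [h2] at h1
    exact (congrArg (fun A => (A v : ℝ)) h1).symm
  obtain ⟨Φ, D, hD, h1, h2, h3⟩ := exists_partialDiffeomorph_of_surjective_mfderiv hU hxU hf hsurj
  obtain ⟨A, hA⟩ := D.toLinearMap.exists_rightInverse_of_surjective (LinearMap.range_eq_top.2 hD)
  exact ⟨⟨e, he, Φ, D, LinearMap.toContinuousLinearMap A, fun v => LinearMap.congr_fun hA v,
    fun z hz j => mem_iInter.1 (h2 hz).1 j, fun z hz j => congrFun (h3 z hz) j,
    fun z hz i hi => mem_iInter₂.1 (h2 hz).2 i hi⟩, h1⟩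

variable {J : Set ι} [Fintype J]

/-- The fiber product of the puffs of a family of hypersurfaces, as a subset of the product. -/
abbrev puffSet (m : ℕ) [ChartedSpace (EuclideanSpace ℝ (Fin m)) M] (V : ι → Set M) :
    Set ((M × M) × ∀ i, PuffArrow m (V i)) :=
  {q | ∀ i, anchor m (q.2 i) = q.1}

/-- The coordinates of the puff of a decoupage defined by adapted charts. -/
def AdaptedChart.coord (a b : AdaptedChart (m := m) V J)
    (q : (M × M) × ∀ i, PuffArrow m (V i)) : PairSpace m :=
  -- The values at the range of the equations of the `V j` are redundant, being the rates times the
  -- values at the source. They are replaced by the rates.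
  (a.chart q.1.1 - a.lift (a.proj (a.chart q.1.1)) +
    a.lift fun j => rate (a.equation j) (b.equation j) (q.2 j), b.chart q.1.2)

/-- The coordinates of the range of an arrow of the puff, in terms of its coordinates. -/
def AdaptedChart.tgtCoord (a b : AdaptedChart (m := m) V J) (u : PairSpace m) :
    EuclideanSpace ℝ (Fin m) :=
  -- Here `a.proj u.1` holds the rates and `b.proj u.2` the equations at the source; their products
  -- are put back as the equations at the range.
  u.1 - a.lift (a.proj u.1) + a.lift fun j => a.proj u.1 j * b.proj u.2 j

/-- The set of coordinates of the puff. -/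
def AdaptedChart.coordSet (a b : AdaptedChart (m := m) V J) : Set (PairSpace m) :=
  {u | u.2 ∈ b.chart.target ∧ a.tgtCoord b u ∈ a.chart.target ∧ ∀ j, a.proj u.1 j ≠ 0}

lemma AdaptedChart.contDiff_tgtCoord (a b : AdaptedChart (m := m) V J) :
    ContDiff ℝ ∞ (a.tgtCoord b) := by
  unfold AdaptedChart.tgtCoord
  refine ContDiff.add (by fun_prop) (a.lift.contDiff.comp (contDiff_pi.2 fun j => ?_))
  exact ((contDiff_apply ℝ ℝ j).comp (a.proj.contDiff.comp contDiff_fst)).mul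
    ((contDiff_apply ℝ ℝ j).comp (b.proj.contDiff.comp contDiff_snd))

lemma AdaptedChart.isOpen_coordSet (a b : AdaptedChart (m := m) V J) : IsOpen (a.coordSet b) := by
  refine (b.chart.open_target.preimage continuous_snd).inter
    ((a.chart.open_target.preimage (a.contDiff_tgtCoord b).continuous).inter ?_)
  change IsOpen {u : PairSpace m | ∀ j, a.proj u.1 j ≠ 0}
  rw [ofPred_forall]
  refine isOpen_iInter_of_finite fun j => ?_
  exact isOpen_compl_singleton.preimage
    ((continuous_apply j).comp (a.proj.continuous.comp continuous_fst))

lemma AdaptedChart.proj_tgtCoord (a b : AdaptedChart (m := m) V J) (u : PairSpace m) (j : J) :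
    a.proj (a.tgtCoord b u) j = a.proj u.1 j * b.proj u.2 j := by
  simp [AdaptedChart.tgtCoord, a.proj_lift]

/-- For `i ∈ J`, `proj_tgtCoord` is the compatibility of range, source and rate needed to build an
arrow. For the other indices both points lie off `V i`. -/
lemma AdaptedChart.exists_arrow (a b : AdaptedChart (m := m) V J) {u : PairSpace m}
    (hu : u ∈ a.coordSet b) (i : ι) : ∃ γ : PuffArrow m (V i),
      anchor m γ = (a.chart.symm (a.tgtCoord b u), b.chart.symm u.2) ∧
      ∀ hi : i ∈ J, HasRate (a.equation ⟨i, hi⟩) (b.equation ⟨i, hi⟩) γ (a.proj u.1 ⟨i, hi⟩) := by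
  obtain ⟨hu1, hu2, hu3⟩ := hu
  have hx := a.chart.symm_mem_source hu2
  have hy := b.chart.symm_mem_source hu1
  by_cases hi : i ∈ J
  · have h1 := a.proj_chart _ hx ⟨i, hi⟩
    have h2 := b.proj_chart _ hy ⟨i, hi⟩
    rw [a.chart.apply_symm_apply hu2, a.proj_tgtCoord] at h1
    rw [b.chart.apply_symm_apply hu1] at h2
    obtain ⟨γ, h3, h4, h5⟩ := exists_arrow_hasRate (a.isSliceChart ⟨i, hi⟩)
      (b.isSliceChart ⟨i, hi⟩) (a.mem_source _ hx ⟨i, hi⟩) (b.mem_source _ hy ⟨i, hi⟩)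
      (hu3 ⟨i, hi⟩) (by rw [← h1, h2])
    exact ⟨γ, Prod.ext h3 h4, fun _ => h5⟩
  · obtain ⟨γ, h3, h4⟩ := exists_arrow_of_notMem (m := m) (a.notMem _ hx i hi) (b.notMem _ hy i hi)
    exact ⟨γ, Prod.ext h3 h4, fun h => absurd h hi⟩

open Classical in
/-- The arrows of the puff with given coordinates. -/
def AdaptedChart.arrow (a b : AdaptedChart (m := m) V J) (u : PairSpace m) (i : ι) :
    PuffArrow m (V i) :=
  if hu : u ∈ a.coordSet b then (a.exists_arrow b hu i).choose
  else (puffArrowGroupoid m (V i)).unit (b.chart.symm u.2)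

lemma AdaptedChart.anchor_arrow (a b : AdaptedChart (m := m) V J) {u : PairSpace m}
    (hu : u ∈ a.coordSet b) (i : ι) :
    anchor m (a.arrow b u i) = (a.chart.symm (a.tgtCoord b u), b.chart.symm u.2) := by
  rw [AdaptedChart.arrow, dif_pos hu]
  exact (a.exists_arrow b hu i).choose_spec.1

lemma AdaptedChart.arrow_mem (a b : AdaptedChart (m := m) V J) {u : PairSpace m}
    (hu : u ∈ a.coordSet b) (j : J) :
    a.arrow b u j ∈ arrowsBetween (V j) (a.equation j) (b.equation j) := by
  have h := a.anchor_arrow b hu j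
  have h1 : (a.arrow b u j).tgt = _ := congrArg Prod.fst h
  have h2 : (a.arrow b u j).src = _ := congrArg Prod.snd h
  constructor
  · rw [h1]
    exact a.mem_source _ (a.chart.symm_mem_source hu.2.1) j
  · rw [h2]
    exact b.mem_source _ (b.chart.symm_mem_source hu.1) j

lemma AdaptedChart.rate_arrow (a b : AdaptedChart (m := m) V J) {u : PairSpace m}
    (hu : u ∈ a.coordSet b) (j : J) :
    rate (a.equation j) (b.equation j) (a.arrow b u j) = a.proj u.1 j := by
  refine HasRate.rate_eq ?_ (a.isSliceChart j) (b.isSliceChart j) (a.arrow_mem b hu j).1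
    (a.arrow_mem b hu j).2
  rw [AdaptedChart.arrow, dif_pos hu]
  exact (a.exists_arrow b hu j).choose_spec.2 j.2

/-- The parametrisation of the puff of a decoupage defined by adapted charts. -/
def AdaptedChart.param (a b : AdaptedChart (m := m) V J) (u : PairSpace m) :
    (M × M) × ∀ i, PuffArrow m (V i) :=
  ((a.chart.symm (a.tgtCoord b u), b.chart.symm u.2), a.arrow b u)

/-- The domain of the coordinates of the puff. -/
def AdaptedChart.domain (a b : AdaptedChart (m := m) V J) :
    Set ((M × M) × ∀ i, PuffArrow m (V i)) :=
  {q | q.1.1 ∈ a.chart.source ∧ q.1.2 ∈ b.chart.source ∧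
    -- On the fiber product this follows from the other two conditions (`mem_domain`). In the
    -- ambient product the arrows are unrelated to the pair of points, and it is needed for the
    -- rates to be smooth.
    ∀ j : J, q.2 j ∈ arrowsBetween (V j) (a.equation j) (b.equation j)}

lemma AdaptedChart.mem_domain (a b : AdaptedChart (m := m) V J)
    {q : (M × M) × ∀ i, PuffArrow m (V i)} (hq : q ∈ puffSet m V) (h1 : q.1.1 ∈ a.chart.source)
    (h2 : q.1.2 ∈ b.chart.source) : q ∈ a.domain b := by
  refine ⟨h1, h2, fun j => ?_⟩
  have h3 : (q.2 j).tgt = q.1.1 := congrArg Prod.fst (hq j)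
  have h4 : (q.2 j).src = q.1.2 := congrArg Prod.snd (hq j)
  exact ⟨h3 ▸ a.mem_source _ h1 j, h4 ▸ b.mem_source _ h2 j⟩

/-- On the puff, the equation at the range is the rate times the equation at the source, so putting
the products back undoes the replacement made in `coord`. -/
lemma AdaptedChart.tgtCoord_coord (a b : AdaptedChart (m := m) V J)
    {q : (M × M) × ∀ i, PuffArrow m (V i)} (hq : q ∈ puffSet m V) (hd : q ∈ a.domain b) :
    a.tgtCoord b (a.coord b q) = a.chart q.1.1 := by
  have h : (fun j => a.proj (a.coord b q).1 j * b.proj (a.coord b q).2 j) =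
      a.proj (a.chart q.1.1) := funext fun j => by
    have h3 : (q.2 j).tgt = q.1.1 := congrArg Prod.fst (hq j)
    have h4 : (q.2 j).src = q.1.2 := congrArg Prod.snd (hq j)
    have h5 := (hasRate_rate (a.isSliceChart j) (b.isSliceChart j) (hd.2.2 j).1 (hd.2.2 j).2).1
    rw [a.proj_chart _ hd.1 j, ← h3, h5, h4, ← b.proj_chart _ hd.2.1 j]
    simp [AdaptedChart.coord, a.proj_lift]
  rw [AdaptedChart.tgtCoord, h]
  simp [AdaptedChart.coord, a.proj_lift]

lemma AdaptedChart.coord_mem (a b : AdaptedChart (m := m) V J)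
    {q : (M × M) × ∀ i, PuffArrow m (V i)} (hq : q ∈ puffSet m V) (hd : q ∈ a.domain b) :
    a.coord b q ∈ a.coordSet b := by
  refine ⟨b.chart.map_mem_target hd.2.1, ?_, fun j => ?_⟩
  · rw [a.tgtCoord_coord b hq hd]
    exact a.chart.map_mem_target hd.1
  · have : a.proj (a.coord b q).1 j = rate (a.equation j) (b.equation j) (q.2 j) := by
      simp [AdaptedChart.coord, a.proj_lift]
    rw [this]
    exact (hasRate_rate (a.isSliceChart j) (b.isSliceChart j) (hd.2.2 j).1 (hd.2.2 j).2).ne_zero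
      (a.isSliceChart j) (b.isSliceChart j) (hd.2.2 j).1 (hd.2.2 j).2

lemma AdaptedChart.coord_param (a b : AdaptedChart (m := m) V J) {u : PairSpace m}
    (hu : u ∈ a.coordSet b) : a.coord b (a.param b u) = u := by
  have h : (fun j => rate (a.equation j) (b.equation j) ((a.param b u).2 j)) = a.proj u.1 :=
    funext fun j => a.rate_arrow b hu j
  have h1 : a.chart (a.param b u).1.1 = a.tgtCoord b u := a.chart.apply_symm_apply hu.2.1
  have h2 : b.chart (a.param b u).1.2 = u.2 := b.chart.apply_symm_apply hu.1
  rw [AdaptedChart.coord, h, h1, h2]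
  refine Prod.ext ?_ rfl
  have h3 : a.proj (a.tgtCoord b u) = fun j => a.proj u.1 j * b.proj u.2 j :=
    funext fun j => a.proj_tgtCoord b u j
  change a.tgtCoord b u - a.lift (a.proj (a.tgtCoord b u)) + a.lift (a.proj u.1) = u.1
  rw [h3, AdaptedChart.tgtCoord]
  abel

/-- The anchors agree, so the arrows with `i ∈ J` are recovered from their rates, and the others,
lying off `V i`, from their anchors alone. -/
lemma AdaptedChart.param_coord (a b : AdaptedChart (m := m) V J)
    {q : (M × M) × ∀ i, PuffArrow m (V i)} (hq : q ∈ puffSet m V) (hd : q ∈ a.domain b) :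
    a.param b (a.coord b q) = q := by
  have hu := a.coord_mem b hq hd
  have h1 : a.chart.symm (a.tgtCoord b (a.coord b q)) = q.1.1 := by
    rw [a.tgtCoord_coord b hq hd, a.chart.symm_apply_apply hd.1]
  have h2 : b.chart.symm (a.coord b q).2 = q.1.2 := b.chart.symm_apply_apply hd.2.1
  refine Prod.ext (Prod.ext h1 h2) (funext fun i => ?_)
  have h3 : anchor m (a.arrow b (a.coord b q) i) = anchor m (q.2 i) := by
    rw [a.anchor_arrow b hu, h1, h2, hq i]
  change a.arrow b (a.coord b q) i = q.2 i
  by_cases hi : i ∈ J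
  · have h4 := hasRate_rate (a.isSliceChart ⟨i, hi⟩) (b.isSliceChart ⟨i, hi⟩)
      (a.arrow_mem b hu ⟨i, hi⟩).1 (a.arrow_mem b hu ⟨i, hi⟩).2
    have h5 := hasRate_rate (a.isSliceChart ⟨i, hi⟩) (b.isSliceChart ⟨i, hi⟩)
      (hd.2.2 ⟨i, hi⟩).1 (hd.2.2 ⟨i, hi⟩).2
    rw [a.rate_arrow b hu] at h4
    have h6 : a.proj (a.coord b q).1 ⟨i, hi⟩ =
        rate (a.equation ⟨i, hi⟩) (b.equation ⟨i, hi⟩) (q.2 i) := by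
      simp [AdaptedChart.coord, a.proj_lift]
    rw [h6] at h4
    exact h4.arrow_ext h5 (a.isSliceChart ⟨i, hi⟩) (a.arrow_mem b hu ⟨i, hi⟩).1
      (congrArg Prod.fst h3) (congrArg Prod.snd h3)
  · refine PuffArrow.ext_of_notMem m (congrArg Prod.fst h3) (congrArg Prod.snd h3) ?_
    rw [show (a.arrow b (a.coord b q) i).tgt = (q.2 i).tgt from congrArg Prod.fst h3,
      show (q.2 i).tgt = q.1.1 from congrArg Prod.fst (hq i)]
    exact a.notMem _ hd.1 i hi

/-- The model of the product of `M²` and of the puffs of a family of hypersurfaces. -/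
abbrev puffProdModel (m : ℕ) (ι : Type*) [Fintype ι] :=
  ((𝓡 m).prod (𝓡 m)).prod (ModelWithCorners.pi fun _ : ι => 𝓘(ℝ, PairSpace m))

variable [∀ i, TopologicalSpace (PuffArrow m (V i))]
  [∀ i, ChartedSpace (PairSpace m) (PuffArrow m (V i))] [Fintype ι]

/-- In these coordinates the rates are linear functions; for `i ∉ J` the arrow stays off `V i` and
only its anchor matters. -/
lemma AdaptedChart.contMDiffAt_param (h : ∀ i, IsPuffManifold m (V i)) (hV : IsDecoupage m V)
    (a b : AdaptedChart (m := m) V J) {u : PairSpace m} (hu : u ∈ a.coordSet b) :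
    ContMDiffAt 𝓘(ℝ, PairSpace m) (puffProdModel m ι) ∞ (a.param b) u := by
  have hnhds := (a.isOpen_coordSet b).mem_nhds hu
  have hxy : ContMDiffAt 𝓘(ℝ, PairSpace m) ((𝓡 m).prod (𝓡 m)) ∞
      (fun u => (a.chart.symm (a.tgtCoord b u), b.chart.symm u.2)) u :=
    (ContMDiffAt.comp u (a.chart.contMDiffAt_symm hu.2.1)
      (a.contDiff_tgtCoord b).contMDiff.contMDiffAt).prodMk
    (ContMDiffAt.comp u (b.chart.contMDiffAt_symm hu.1) contDiff_snd.contMDiff.contMDiffAt)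
  refine hxy.prodMk (contMDiffAt_pi_manifold.2 fun i => ?_)
  have ha : ContMDiffAt 𝓘(ℝ, PairSpace m) ((𝓡 m).prod (𝓡 m)) ∞
      (fun u => anchor m (a.arrow b u i)) u := by
    refine hxy.congr_of_eventuallyEq ?_
    filter_upwards [hnhds] with w hw
    exact a.anchor_arrow b hw i
  by_cases hi : i ∈ J
  · refine (h i).contMDiffWithinAt_of_rate (a.isSliceChart ⟨i, hi⟩) (b.isSliceChart ⟨i, hi⟩)
      (a.arrow_mem b hu ⟨i, hi⟩) ha ?_
    refine ContMDiffAt.congr_of_eventuallyEq (f := fun u : PairSpace m => a.proj u.1 ⟨i, hi⟩)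
      (ContDiff.contMDiff ((contDiff_apply ℝ ℝ (⟨i, hi⟩ : J)).comp
        (a.proj.contDiff.comp contDiff_fst))).contMDiffAt ?_
    filter_upwards [hnhds] with w hw
    exact a.rate_arrow b hw ⟨i, hi⟩
  · refine (h i).contMDiffWithinAt_of_notMem (hV.isHypersurface i).isClosed ?_ ha
    rw [show (a.arrow b u i).src = b.chart.symm u.2 from congrArg Prod.snd (a.anchor_arrow b hu i)]
    exact b.notMem _ (b.chart.symm_mem_source hu.1) i hi

lemma AdaptedChart.isOpen_domain (h : ∀ i, IsPuffManifold m (V i))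
    (a b : AdaptedChart (m := m) V J) : IsOpen (a.domain b) := by
  refine (a.chart.open_source.preimage continuous_fst.fst).inter
    ((b.chart.open_source.preimage continuous_fst.snd).inter ?_)
  change IsOpen {q : (M × M) × ∀ i, PuffArrow m (V i) |
    ∀ j : J, q.2 j ∈ arrowsBetween (V j) (a.equation j) (b.equation j)}
  rw [ofPred_forall]
  exact isOpen_iInter_of_finite fun j => ((h j).isOpen_arrowsBetween (a.isSliceChart j)
    (b.isSliceChart j)).preimage ((continuous_apply (j : ι)).comp continuous_snd)

lemma AdaptedChart.contMDiffOn_coord (h : ∀ i, IsPuffManifold m (V i))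
    (a b : AdaptedChart (m := m) V J) :
    ContMDiffOn (puffProdModel m ι) 𝓘(ℝ, PairSpace m) ∞ (a.coord b) (a.domain b) := by
  refine fun q hq => ContMDiffAt.contMDiffWithinAt ?_
  have h1 : ContMDiffAt (puffProdModel m ι) 𝓘(ℝ, EuclideanSpace ℝ (Fin m)) ∞
      (fun q : (M × M) × ∀ i, PuffArrow m (V i) => a.chart q.1.1) q :=
    ContMDiffAt.comp q (a.chart.contMDiffAt hq.1) (contMDiff_fst.comp contMDiff_fst).contMDiffAt
  have h2 : ContMDiffAt (puffProdModel m ι) 𝓘(ℝ, EuclideanSpace ℝ (Fin m)) ∞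
      (fun q : (M × M) × ∀ i, PuffArrow m (V i) => b.chart q.1.2) q :=
    ContMDiffAt.comp q (b.chart.contMDiffAt hq.2.1) (contMDiff_snd.comp contMDiff_fst).contMDiffAt
  have h3 : ContMDiffAt (puffProdModel m ι) 𝓘(ℝ, J → ℝ) ∞
      (fun (q : (M × M) × ∀ i, PuffArrow m (V i)) (j : J) =>
        rate (a.equation j) (b.equation j) (q.2 j)) q :=
    contMDiffAt_pi_space.2 fun j => ContMDiffAt.comp q
      (g := rate (a.equation j) (b.equation j))
      (((h j).contMDiffOn_rate (a.isSliceChart j) (b.isSliceChart j)).contMDiffAt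
        (((h j).isOpen_arrowsBetween (a.isSliceChart j) (b.isSliceChart j)).mem_nhds (hq.2.2 j)))
      ((contMDiff_eval (j : ι)).comp contMDiff_snd).contMDiffAt
  refine ContMDiffAt.prodMk_space ?_ h2
  exact (ContMDiffAt.comp q (g := fun v : EuclideanSpace ℝ (Fin m) => v - a.lift (a.proj v))
    (ContDiff.contMDiff (by fun_prop)).contMDiffAt h1).add
    (a.lift.contDiff.contMDiff.contMDiffAt.comp q h3)

/-- The parametrisation of the puff defined by adapted charts. -/
def AdaptedChart.submanifoldParam (h : ∀ i, IsPuffManifold m (V i)) (hV : IsDecoupage m V)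
    (a b : AdaptedChart (m := m) V J) :
    SubmanifoldParam (PairSpace m) (puffProdModel m ι) (puffSet m V) where
  domain := a.domain b
  isOpen_domain := a.isOpen_domain h b
  coord := a.coord b
  contMDiffOn_coord := a.contMDiffOn_coord h b
  range := a.coordSet b
  isOpen_range := a.isOpen_coordSet b
  param := a.param b
  contMDiffOn_param := fun _ hu => (a.contMDiffAt_param h hV b hu).contMDiffWithinAt
  param_mem := fun _ hu => ⟨a.anchor_arrow b hu, a.mem_domain b (a.anchor_arrow b hu)
    (a.chart.symm_mem_source hu.2.1) (b.chart.symm_mem_source hu.1)⟩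
  coord_mem := fun _ hq => a.coord_mem b hq.1 hq.2
  coord_param := fun _ hu => a.coord_param b hu
  param_coord := fun _ hq => a.param_coord b hq.1 hq.2

/-- Each arrow joins points that are both on `V i` or both off it, so one set `J` serves for range
and source. The map `c` freezes the first component of the coordinates and lets the source vary: it
yields local sections of the source map. -/
lemma IsDecoupage.exists_submanifoldParam [IsManifold (𝓡 m) ∞ M]
    (h : ∀ i, IsPuffManifold m (V i)) (hV : IsDecoupage m V) (q : puffSet m V) :
    ∃ (p : SubmanifoldParam (PairSpace m) (puffProdModel m ι) (puffSet m V)) (c : M → PairSpace m),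
      q.1 ∈ p.domain ∧ ContMDiffAt (𝓡 m) 𝓘(ℝ, PairSpace m) ∞ c q.1.1.2 ∧
      c q.1.1.2 = p.coord q.1 ∧
      ∀ᶠ y in 𝓝 q.1.1.2, (p.param (c y)).1.2 = y := by
  classical
  let J : Set ι := {i | q.1.1.1 ∈ V i}
  have hJ : ∀ i, i ∈ J ↔ q.1.1.2 ∈ V i := fun i => by
    rw [← show (q.1.2 i).src = q.1.1.2 from congrArg Prod.snd (q.2 i), ← (q.1.2 i).mem_iff,
      show (q.1.2 i).tgt = q.1.1.1 from congrArg Prod.fst (q.2 i)]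
    rfl
  obtain ⟨a, ha⟩ := hV.exists_adaptedChart J q.1.1.1 fun _ => Iff.rfl
  obtain ⟨b, hb⟩ := hV.exists_adaptedChart J q.1.1.2 hJ
  refine ⟨a.submanifoldParam h hV b, fun y => ((a.coord b q.1).1, b.chart y),
    a.mem_domain b q.2 ha hb, contMDiffAt_const.prodMk_space (b.chart.contMDiffAt hb), rfl, ?_⟩
  filter_upwards [b.chart.open_source.mem_nhds hb] with y hy
  exact b.chart.symm_apply_apply hy

end AdaptedChart

/-! ### The puff of a decoupage -/

section RetractionEmbedding

variable {E : Type*} [NormedAddCommGroup E] [NormedSpace ℝ E]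
  {E' H' : Type*} [NormedAddCommGroup E'] [NormedSpace ℝ E'] [TopologicalSpace H']
  {J : ModelWithCorners ℝ E' H'} {Y : Type*} [TopologicalSpace Y] [ChartedSpace H' Y]
  {S : Set Y}

/-- Every point of the submanifold `S` of `Y` has a neighborhood in `Y` with a smooth map to `S`
that fixes the points of `S`. -/
def HasSmoothRetractions (J : ModelWithCorners ℝ E' H') (S : Set Y) [ChartedSpace E S] : Prop :=
  ∀ x : S, ∃ (ρ : Y → S) (W : Set Y), IsOpen W ∧ (x : Y) ∈ W ∧
    ContMDiffOn J 𝓘(ℝ, E) ∞ ρ W ∧ ∀ z : S, (z : Y) ∈ W → ρ z = z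

variable [ChartedSpace E S]

lemma HasSmoothRetractions.contMDiffWithinAt (hS : HasSmoothRetractions (E := E) J S)
    {EX HX : Type*} [NormedAddCommGroup EX] [NormedSpace ℝ EX] [TopologicalSpace HX]
    {I : ModelWithCorners ℝ EX HX} {X : Type*} [TopologicalSpace X] [ChartedSpace HX X]
    {f : X → S} {s : Set X} {x : X}
    (hf : ContMDiffWithinAt I J ∞ (fun z => (f z : Y)) s x) :
    ContMDiffWithinAt I 𝓘(ℝ, E) ∞ f s x := by
  obtain ⟨ρ, W, hW, hx, hρ, hρ'⟩ := hS (f x)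
  exact contMDiffWithinAt_subtype_of_retraction hW hx hρ hρ' hf

/-- A map from a submanifold to a manifold from which the points can be recovered smoothly is a
smooth embedding. -/
lemma HasSmoothRetractions.isSmoothEmbedding [FiniteDimensional ℝ E]
    (hS : HasSmoothRetractions (E := E) J S) [IsManifold 𝓘(ℝ, E) ∞ S]
    {EZ HZ : Type*} [NormedAddCommGroup EZ] [NormedSpace ℝ EZ] [FiniteDimensional ℝ EZ]
    [TopologicalSpace HZ] {K : ModelWithCorners ℝ EZ HZ} [K.Boundaryless] {Z : Type*}
    [TopologicalSpace Z] [ChartedSpace HZ Z] [IsManifold K ∞ Z] {f : S → Z} {g : Z → Y}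
    (hf : ContMDiff 𝓘(ℝ, E) K ∞ f) (hg : ContMDiff K J ∞ g) (hgf : ∀ x, g (f x) = x) :
    Manifold.IsSmoothEmbedding 𝓘(ℝ, E) K ∞ f := by
  constructor
  · refine Manifold.IsImmersionOfComplement.isImmersion (F := CodimSpace EZ E) fun x => ?_
    obtain ⟨ρ, W, hW, hx, hρ, hρ'⟩ := hS x
    refine isImmersionAtOfComplement_of_local_leftInverse hf (hW.preimage hg.continuous)
      (r := ρ ∘ g) (by rwa [mem_preimage, hgf]) (hρ.comp hg.contMDiffOn fun _ h => h) ?_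
    filter_upwards [(hW.preimage continuous_subtype_val).mem_nhds hx] with z hz
    rw [Function.comp_apply, hgf]
    exact hρ' z hz
  · refine Topology.IsEmbedding.of_comp hf.continuous hg.continuous ?_
    have : g ∘ f = Subtype.val := funext hgf
    rw [this]
    exact Topology.IsEmbedding.subtypeVal

end RetractionEmbedding

/-! ### Manifold and Lie groupoid structure of the fiber product. -/

section Puff

variable {m : ℕ} {M : Type*} [TopologicalSpace M] [ChartedSpace (EuclideanSpace ℝ (Fin m)) M]
  {ι : Type*} [Fintype ι] {V : ι → Set M} [∀ i, TopologicalSpace (PuffArrow m (V i))]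
  [∀ i, ChartedSpace (PairSpace m) (PuffArrow m (V i))]

/-- The groupoid structure on the puff of a family, as a subset of the product. -/
abbrev puffSetGroupoid (m : ℕ) [ChartedSpace (EuclideanSpace ℝ (Fin m)) M] (V : ι → Set M) :
    GroupoidOver M (puffSet m V) := puffGroupoid m V

open Classical in
/-- The composition of the puff of a family, extended to all pairs. -/
def puffFamilyMul (p : puffSet m V × puffSet m V) : puffSet m V :=
  if h : p.1.1.1.2 = p.2.1.1.1 then (puffSetGroupoid m V).mul p.1 p.2 h else p.1

lemma contMDiff_puff_eval [ChartedSpace (PairSpace m) (puffSet m V)]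
    (hval : ContMDiff 𝓘(ℝ, PairSpace m) (puffProdModel m ι) ∞
    (Subtype.val : puffSet m V → (M × M) × ∀ i, PuffArrow m (V i))) (i : ι) :
    ContMDiff 𝓘(ℝ, PairSpace m) 𝓘(ℝ, PairSpace m) ∞ (fun q : puffSet m V => q.1.2 i) :=
  (contMDiff_eval i).comp (contMDiff_snd.comp hval)

/-- By the retractions, a map to the puff is smooth as soon as it is smooth into the ambient
product, where the operations are componentwise and smooth on each factor. -/
theorem isLieGroupoid_puff [IsManifold (𝓡 m) ∞ M]
    [ChartedSpace (PairSpace m) (puffSet m V)] [IsManifold 𝓘(ℝ, PairSpace m) ∞ (puffSet m V)]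
    (h : ∀ i, IsPuffManifold m (V i)) (hV : IsDecoupage m V)
    (hval : ContMDiff 𝓘(ℝ, PairSpace m) (puffProdModel m ι) ∞
      (Subtype.val : puffSet m V → (M × M) × ∀ i, PuffArrow m (V i)))
    (hS : HasSmoothRetractions (E := PairSpace m) (puffProdModel m ι) (puffSet m V)) :
    IsLieGroupoid (𝓡 m) 𝓘(ℝ, PairSpace m) (puffSetGroupoid m V) := by
  have htgt : ContMDiff 𝓘(ℝ, PairSpace m) (𝓡 m) ∞ (fun q : puffSet m V => q.1.1.1) :=
    contMDiff_fst.comp (contMDiff_fst.comp hval)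
  have hsrc : ContMDiff 𝓘(ℝ, PairSpace m) (𝓡 m) ∞ (fun q : puffSet m V => q.1.1.2) :=
    contMDiff_snd.comp (contMDiff_fst.comp hval)
  have hinv : ContMDiff 𝓘(ℝ, PairSpace m) 𝓘(ℝ, PairSpace m) ∞
      (fun q : puffSet m V => (puffSetGroupoid m V).inv q) := fun q => by
    refine hS.contMDiffWithinAt (((hsrc q).prodMk (htgt q)).prodMk
      (contMDiffAt_pi_manifold.2 fun i => ?_))
    exact ((h i).contMDiff_inv (hV.isHypersurface i)).comp (contMDiff_puff_eval hval i) q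
  have hunit : ContMDiff (𝓡 m) 𝓘(ℝ, PairSpace m) ∞
      (fun x : M => (puffSetGroupoid m V).unit x) := fun x => by
    refine hS.contMDiffWithinAt ((contMDiffAt_id.prodMk contMDiffAt_id).prodMk
      (contMDiffAt_pi_manifold.2 fun i => ?_))
    exact (h i).contMDiff_unit (hV.isHypersurface i) x
  have hmul : ∀ (p : puffSet m V × puffSet m V) (hp : p.1.1.1.2 = p.2.1.1.1),
      puffFamilyMul p = (puffSetGroupoid m V).mul p.1 p.2 hp := fun p hp => dif_pos hp
  have hmulOn : ContMDiffOn (𝓘(ℝ, PairSpace m).prod 𝓘(ℝ, PairSpace m)) 𝓘(ℝ, PairSpace m) ∞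
      (puffFamilyMul : puffSet m V × puffSet m V → puffSet m V)
      {p | p.1.1.1.2 = p.2.1.1.1} := fun p hp => by
    have hcomp : ∀ p : puffSet m V × puffSet m V, p.1.1.1.2 = p.2.1.1.1 → ∀ i,
        (p.1.1.2 i).src = (p.2.1.2 i).tgt := fun p hp i =>
      ((congrArg Prod.snd (p.1.2 i)).trans hp).trans (congrArg Prod.fst (p.2.2 i)).symm
    have hco : ∀ p : puffSet m V × puffSet m V, p.1.1.1.2 = p.2.1.1.1 →
        (puffFamilyMul p : (M × M) × ∀ i, PuffArrow m (V i)) =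
          ((p.1.1.1.1, p.2.1.1.2), fun i => puffMul (p.1.1.2 i, p.2.1.2 i)) := fun p hp => by
      rw [hmul p hp]
      exact Prod.ext rfl (funext fun i => (puffMul_eq _ _ (hcomp p hp i)).symm)
    refine hS.contMDiffWithinAt (ContMDiffWithinAt.congr ?_ hco (hco p hp))
    refine ((htgt.comp contMDiff_fst).prodMk (hsrc.comp contMDiff_snd)).contMDiffAt
      |>.contMDiffWithinAt.prodMk (contMDiffWithinAt_pi_manifold.2 fun i => ?_)
    refine ((h i).contMDiffOn_puffMul (hV.isHypersurface i) _ (hcomp p hp i)).comp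
      (f := fun p : puffSet m V × puffSet m V => (p.1.1.2 i, p.2.1.2 i)) p ?_
      fun p hp => hcomp p hp i
    exact (((contMDiff_puff_eval hval i).comp contMDiff_fst).prodMk
      ((contMDiff_puff_eval hval i).comp contMDiff_snd)).contMDiffAt.contMDiffWithinAt
  have hsec : ∀ q : puffSet m V, ∃ σ : M → puffSet m V,
      ContMDiffAt (𝓡 m) 𝓘(ℝ, PairSpace m) ∞ σ q.1.1.2 ∧ σ q.1.1.2 = q ∧
      ∀ᶠ y in 𝓝 q.1.1.2, (σ y).1.1.2 = y := fun q => by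
    obtain ⟨p, c, hqp, hc, hcq, hcy⟩ := hV.exists_submanifoldParam h q
    obtain ⟨ρ, W, hW, hqW, hρ, hρ'⟩ := hS q
    have hcr : c q.1.1.2 ∈ p.range := hcq ▸ p.coord_mem _ ⟨q.2, hqp⟩
    have hpc : p.param (c q.1.1.2) = q.1 := by rw [hcq, p.param_coord _ ⟨q.2, hqp⟩]
    have hpcs : ContMDiffAt (𝓡 m) (puffProdModel m ι) ∞ (p.param ∘ c) q.1.1.2 :=
      (p.contMDiffOn_param.contMDiffAt (p.isOpen_range.mem_nhds hcr)).comp _ hc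
    have hW' : W ∈ 𝓝 ((p.param ∘ c) q.1.1.2) := hW.mem_nhds (by rwa [Function.comp_apply, hpc])
    -- `p.param ∘ c` takes values in the puff only near the base point; the retraction `ρ` turns it
    -- into a map to the subtype.
    refine ⟨ρ ∘ p.param ∘ c, ContMDiffAt.comp _ (hρ.contMDiffAt hW') hpcs, ?_, ?_⟩
    · rw [Function.comp_apply, Function.comp_apply, hpc, hρ' q hqW]
    · filter_upwards [hc.continuousAt.eventually (p.isOpen_range.mem_nhds hcr),
        hpcs.continuousAt.eventually hW', hcy] with y hy hyW hy'
      have := hρ' ⟨p.param (c y), (p.param_mem _ hy).1⟩ hyW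
      rw [Function.comp_apply, Function.comp_apply, this]
      exact hy'
  obtain ⟨h1, h2⟩ := isSubmersion_of_local_sections (puffSetGroupoid m V)
    hsrc hinv (fun _ => rfl) hsec
  exact ⟨inferInstance, inferInstance, h1, h2, hunit, hinv, puffFamilyMul,
    fun g g' p => hmul (g, g') p, hmulOn⟩

/-- The puff of a decoupage is a manifold, smoothly embedded in the product of the puffs of the
hypersurfaces, and a Lie groupoid. -/
theorem IsDecoupage.exists_chartedSpace_puff [IsManifold (𝓡 m) ∞ M] [T2Space M]
    [SecondCountableTopology M] (h : ∀ i, IsPuffManifold m (V i)) (hV : IsDecoupage m V) :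
    ∃ _ : ChartedSpace (PairSpace m) (puffSet m V),
      T2Space (puffSet m V) ∧ SecondCountableTopology (puffSet m V) ∧
      IsManifold 𝓘(ℝ, PairSpace m) ∞ (puffSet m V) ∧
      Manifold.IsSmoothEmbedding 𝓘(ℝ, PairSpace m) (puffProdModel m ι) ∞
        (Subtype.val : puffSet m V → (M × M) × (∀ i, PuffArrow m (V i))) ∧
      (Nonempty ι → Manifold.IsSmoothEmbedding 𝓘(ℝ, PairSpace m)
        (ModelWithCorners.pi fun _ : ι => 𝓘(ℝ, PairSpace m)) ∞
        (fun q : puffSet m V => (q.1.2 : ∀ i, PuffArrow m (V i)))) ∧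
      IsLieGroupoid (𝓡 m) 𝓘(ℝ, PairSpace m) (puffSetGroupoid m V) := by
  have := fun i => (h i).isManifold
  have := fun i => (h i).t2Space (hV.isHypersurface i)
  have := fun i => (h i).secondCountableTopology (hV.isHypersurface i)
  obtain ⟨_, hm, hval, hS⟩ := exists_chartedSpace_of_submanifoldParam (S := puffSet m V)
    (E := PairSpace m) (J := puffProdModel m ι) fun q => by
      obtain ⟨p, -, hp, -⟩ := hV.exists_submanifoldParam h q
      exact ⟨p, hp⟩
  have hS : HasSmoothRetractions (E := PairSpace m) (puffProdModel m ι) (puffSet m V) := hS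
  refine ⟨inferInstance, inferInstance, inferInstance, hm, ?_, fun ⟨i⟩ => ?_,
    isLieGroupoid_puff h hV hval hS⟩
  · exact hS.isSmoothEmbedding hval contMDiff_id fun _ => rfl
  · refine hS.isSmoothEmbedding (contMDiff_snd.comp hval)
      -- The forgotten pair of points is the anchor of any of the arrows; this is where an index is
      -- needed.
      (g := fun γ => (anchor m (γ i), γ)) ?_ fun q => Prod.ext (q.2 i) rfl
    exact (((h i).contMDiff_anchor (hV.isHypersurface i)).comp (contMDiff_eval i)).prodMk
      contMDiff_id

end Puff

end

theorem mainTheorem4 {m : ℕ} {M : Type*} [TopologicalSpace M]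
    [ChartedSpace (EuclideanSpace ℝ (Fin m)) M] [IsManifold (𝓡 m) ∞ M]
    [T2Space M] [SecondCountableTopology M]
    {ι : Type*} [Fintype ι] (V : ι → Set M) (hV : IsDecoupage m V) :
    (∀ i, ∃ (_ : TopologicalSpace (PuffArrow m (V i)))
      (_ : ChartedSpace (EuclideanSpace ℝ (Fin m) × EuclideanSpace ℝ (Fin m))
        (PuffArrow m (V i))),
      T2Space (PuffArrow m (V i)) ∧ SecondCountableTopology (PuffArrow m (V i)) ∧
      IsPuffManifold m (V i) ∧
      IsLieGroupoid (𝓡 m) 𝓘(ℝ, EuclideanSpace ℝ (Fin m) × EuclideanSpace ℝ (Fin m))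
        (puffArrowGroupoid m (V i))) ∧
    ∀ [∀ i, TopologicalSpace (PuffArrow m (V i))]
      [∀ i, ChartedSpace (EuclideanSpace ℝ (Fin m) × EuclideanSpace ℝ (Fin m))
        (PuffArrow m (V i))],
      (∀ i, IsPuffManifold m (V i)) →
      TransverseMaps 𝓘(ℝ, EuclideanSpace ℝ (Fin m) × EuclideanSpace ℝ (Fin m))
        ((𝓡 m).prod (𝓡 m)) (fun i => (anchor m : PuffArrow m (V i) → M × M)) ∧
      ∃ _ : ChartedSpace (EuclideanSpace ℝ (Fin m) × EuclideanSpace ℝ (Fin m)) (Puff m V),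
        T2Space (Puff m V) ∧ SecondCountableTopology (Puff m V) ∧
        IsManifold 𝓘(ℝ, EuclideanSpace ℝ (Fin m) × EuclideanSpace ℝ (Fin m)) ∞ (Puff m V) ∧
        Manifold.IsSmoothEmbedding 𝓘(ℝ, EuclideanSpace ℝ (Fin m) × EuclideanSpace ℝ (Fin m))
          (((𝓡 m).prod (𝓡 m)).prod (ModelWithCorners.pi fun _ : ι =>
            𝓘(ℝ, EuclideanSpace ℝ (Fin m) × EuclideanSpace ℝ (Fin m)))) ∞
          (Subtype.val : Puff m V → (M × M) × (∀ i, PuffArrow m (V i))) ∧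
        (Nonempty ι →
          Manifold.IsSmoothEmbedding 𝓘(ℝ, EuclideanSpace ℝ (Fin m) × EuclideanSpace ℝ (Fin m))
            (ModelWithCorners.pi fun _ : ι =>
              𝓘(ℝ, EuclideanSpace ℝ (Fin m) × EuclideanSpace ℝ (Fin m))) ∞
            (fun q : Puff m V => (q.1.2 : ∀ i, PuffArrow m (V i)))) ∧
        IsLieGroupoid (𝓡 m) 𝓘(ℝ, EuclideanSpace ℝ (Fin m) × EuclideanSpace ℝ (Fin m))
          (puffGroupoid m V) := by
  refine ⟨fun i => ?_, fun h => ⟨hV.transverseMaps_anchor h, hV.exists_chartedSpace_puff h⟩⟩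
  obtain ⟨_, _, h⟩ := exists_isPuffManifold (hV.isHypersurface i)
  exact ⟨_, _, h.t2Space (hV.isHypersurface i), h.secondCountableTopology (hV.isHypersurface i), h,
    h.isLieGroupoid (hV.isHypersurface i)⟩
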